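/- Let $N\ge 1$. Let $R(u)=1-P\,u^{-1}$, where $P$ is the permutation operator on $\mathbb C^N\otimes\mathbb C^N$, and let $\overline R(u)=g(u)R(u)$, where $g(u)\in 1+u^{-1}\mathbb C[[u^{-1}]]$ is the unique series with $g(u+N)=g(u)(1-u^{-2})$. The double Yangian $\mathrm{DY}(\mathfrak{gl}_N)$ is the associative algebra over $\mathbb C$ generated by a central element $C$ and elements $t_{ij}^{(r)}$, $t_{ij}^{(-r)}$ ($1\le i,j\le N$, $r\ge 1$). In terms of the matrices $T(u)=[t_{ij}(u)]$ and $T^+(u)=[t^+_{ij}(u)]$, where $t_{ij}(u)=\delta_{ij}+\sum_{r\ge1}t_{ij}^{(r)}u^{-r}$ and $t^+_{ij}(u)=\delta_{ij}-\sum_{r\ge1}t_{ij}^{(-r)}u^{r-1}$, its defining relations are $$R(u-v)T_1(u)T_2(v)=T_2(v)T_1(u)R(u-v),\qquad R(u-v)T^+_1(u)T^+_2(v)=T^+_2(v)T^+_1(u)R(u-v),$$ $$\overline R(u-v+C/2)\,T_1(u)T^+_2(v)=T^+_2(v)T_1(u)\,\overline R(u-v-C/2).$$ Let $\widehat{\mathrm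 Y}^+(\mathfrak{gl}_N)$ be the completion of the subalgebra generated by the $t_{ij}^{(-r)}$ with respect to the descending filtration with $\deg t_{ij}^{(-r)}=r$. Let $\mathrm{DY}^\circ(\mathfrak{gl}_N)$ be the extended double Yangian: the algebra of finite $\mathbb C[C]$-linear combinations of products $xy$ with $x\in\widehat{\mathrm Y}^+(\mathfrak{gl}_N)$ and $y$ in the subalgebra generated by the $t_{ij}^{(r)}$, $r\ge1$, with the multiplication extended by continuity. The extended vacuum module at the critical level, $\widehat{\mathcal V}_{\mathrm{cri}}$, is the quotient of $\mathrm{DY}^\circ(\mathfrak{gl}_N)$ by the left ideal generated by $C+N$ and all $t_{ij}^{(r)}$ with $r\ge1$; let $\mathbf 1$ be the image of $1$. Set $$\mathfrak z(\widehat{\mathcal V}_{\mathrm{cri}})=\{v\in\widehat{\mathcal V}_{\mathrm{cri}}\mid t_{ij}(u)v=\delta_{ij}v\ \text{for all } i,j\}.$$ Let $\mu$ be a Young diagram with $m$ boxes and at most $N$ rows, let $\mathcal U$ be a standard $\mu$-tableau with entries $1,\dots,m$, and let $c_a=j-i$ if $a$ occupies the box $(i,j)$ of $\mathcal U$. Let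 $e_{\mathcal U}\in\mathbb C[\mathfrak S_m]$ be the primitive idempotent given by the diagonal matrix unit of the vector labelled by $\mathcal U$ in the orthonormal Young basis of the irreducible representation of $\mathfrak S_m$ associated with $\mu$. Let $\mathcal E_{\mathcal U}$ be the image of $e_{\mathcal U}$ under the action of $\mathfrak S_m$ on $(\mathbb C^N)^{\otimes m}$ by permutations of tensor factors. Put $$\mathbb T^+_\mu(u)=\operatorname{tr}_{1,\dots,m}\,\mathcal E_{\mathcal U}\,T^+_1(u+c_1)\cdots T^+_m(u+c_m)\in\widehat{\mathrm Y}^+(\mathfrak{gl}_N)[[u]].$$ **Theorem.** For every such $\mu$ and $\mathcal U$, all coefficients of the series $\mathbb T^+_\mu(u)\,\mathbf 1$ belong to the subspace of invariants $\mathfrak z(\widehat{\mathcal V}_{\mathrm{cri}})$. -/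

import Mathlib

open scoped PowerSeries

namespace DoubleYangianGL

noncomputable section

/-! ### Formal series in `u⁻¹` -/

/-- The expansion of `(u - w)⁻¹ = ∑ j ≥ 0, w ^ j u ^ (-j-1)` as a power series in `X = u⁻¹`
(here `u` commutes with `w`). -/
def invSub {S : Type*} [Ring S] (w : S) : S⟦X⟧ :=
  PowerSeries.mk fun p => match p with
    | 0 => 0
    | j + 1 => w ^ j

/-- For `φ(u) = ∑ k, φ_k u ^ (-k)`, encoded as a power series in `X = u⁻¹`, the expansion of
`φ(u - w) = ∑ k, φ_k (u - w) ^ (-k)` as a power series in `X = u⁻¹`.  The series `(u - w) ^ (-k)`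
starts with `u ^ (-k)`, so only the terms with `k ≤ p` contribute to the coefficient
of `u ^ (-p)`. -/
def evalSub {S : Type*} [Ring S] [Algebra ℂ S] (φ : ℂ⟦X⟧) (w : S) : S⟦X⟧ :=
  PowerSeries.mk fun p =>
    ∑ k ∈ Finset.range (p + 1), PowerSeries.coeff k φ • PowerSeries.coeff p (invSub w ^ k)

theorem coeff_invSub_pow {S : Type*} [Ring S] (w : S) (k : ℕ) :
    PowerSeries.coeff k (invSub w ^ k) = 1 ∧
      PowerSeries.coeff (k + 1) (invSub w ^ k) = (k : S) * w := by
  set E : S⟦X⟧ := PowerSeries.mk fun j => w ^ j with hE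
  have h1 : invSub w = PowerSeries.X * E := by
    ext p
    cases p with
    | zero => simp [invSub]
    | succ p => simp [invSub, hE, PowerSeries.coeff_succ_X_mul]
  have hc : Commute (PowerSeries.X : S⟦X⟧) E := (PowerSeries.commute_X E).symm
  have h2 : invSub w ^ k = PowerSeries.X ^ k * E ^ k := by rw [h1, hc.mul_pow]
  have h4 : ∀ k : ℕ, PowerSeries.coeff 0 (E ^ k) = 1 ∧
      PowerSeries.coeff 1 (E ^ k) = (k : S) * w := by
    intro k
    induction k with
    | zero => simp [PowerSeries.coeff_one]
    | succ k ih =>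
      have h0 : PowerSeries.coeff 0 E = 1 := by simp [hE]
      have h1 : PowerSeries.coeff 1 E = w := by simp [hE]
      have ha : Finset.HasAntidiagonal.antidiagonal (1 : ℕ) = ({(0, 1), (1, 0)} : Finset (ℕ × ℕ)) := rfl
      have hb : Finset.HasAntidiagonal.antidiagonal (0 : ℕ) = ({(0, 0)} : Finset (ℕ × ℕ)) := rfl
      rw [pow_succ, PowerSeries.coeff_mul, PowerSeries.coeff_mul, ha, hb, Finset.sum_singleton,
        Finset.sum_pair (by decide)]
      simp only [ih.1, ih.2, h0, h1, Nat.cast_succ]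
      exact ⟨one_mul 1, by rw [one_mul, mul_one, add_mul, one_mul, add_comm]⟩
  rw [h2, PowerSeries.coeff_X_pow_mul', PowerSeries.coeff_X_pow_mul', if_pos le_rfl,
    if_pos (Nat.le_succ k), Nat.sub_self, Nat.add_sub_cancel_left]
  exact h4 k

/-- There is exactly one series `g(u) = 1 + ∑ i ≥ 1, g_i u ^ (-i)` with
`g(u + N) = g(u) (1 - u⁻²)`. -/
theorem existsUnique_normSeries (N : ℕ) [NeZero N] :
    ∃! g : ℂ⟦X⟧, PowerSeries.constantCoeff g = 1 ∧
      evalSub g (-(N : ℂ)) = g * (1 - PowerSeries.X ^ 2) := by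
  have hN : (N : ℂ) ≠ 0 := by exact_mod_cast NeZero.ne N
  have key : ∀ g : ℂ⟦X⟧, evalSub g (-(N : ℂ)) = g * (1 - PowerSeries.X ^ 2) ↔
      ∀ n, PowerSeries.coeff (n + 1) g = (((n : ℂ) + 1) * N)⁻¹ * (PowerSeries.coeff n g +
        ∑ k ∈ Finset.range (n + 1), PowerSeries.coeff k g *
          PowerSeries.coeff (n + 2) (invSub (-(N : ℂ)) ^ k)) := by
    intro g
    have hcoef : ∀ p, PowerSeries.coeff p (g * (1 - PowerSeries.X ^ 2)) =
        PowerSeries.coeff p g - if 2 ≤ p then PowerSeries.coeff (p - 2) g else 0 := by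
      intro p
      rw [mul_sub, mul_one, map_sub, PowerSeries.coeff_mul_X_pow']
    rw [PowerSeries.ext_iff]
    have hmain : ∀ n, (PowerSeries.coeff (n + 2) (evalSub g (-(N : ℂ))) =
        PowerSeries.coeff (n + 2) (g * (1 - PowerSeries.X ^ 2))) ↔
        PowerSeries.coeff (n + 1) g = (((n : ℂ) + 1) * N)⁻¹ * (PowerSeries.coeff n g +
        ∑ k ∈ Finset.range (n + 1), PowerSeries.coeff k g *
          PowerSeries.coeff (n + 2) (invSub (-(N : ℂ)) ^ k)) := by
      intro n
      rw [hcoef, evalSub, PowerSeries.coeff_mk, Finset.sum_range_succ, Finset.sum_range_succ,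
        (coeff_invSub_pow _ (n + 2)).1, (coeff_invSub_pow _ (n + 1)).2]
      have hn : ((n : ℂ) + 1) * N ≠ 0 := mul_ne_zero (by exact_mod_cast Nat.succ_ne_zero n) hN
      simp only [smul_eq_mul]
      rw [if_pos (by omega), eq_inv_mul_iff_mul_eq₀ hn]
      push_cast
      constructor <;> intro h <;> linear_combination -h
    constructor
    · intro h n
      exact (hmain n).1 (h (n + 2))
    · intro h p
      match p with
      | 0 => rw [hcoef]; simp [evalSub]
      | 1 => rw [hcoef]; simp [evalSub, Finset.sum_range_succ, invSub, PowerSeries.coeff_one]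
      | n + 2 => exact (hmain n).2 (h n)
  simp only [key]
  let G : ℕ → ℂ := fun n => Nat.strongRec (motive := fun _ => ℂ) (fun n ih => match n, ih with
    | 0, _ => 1
    | n + 1, ih => (((n : ℂ) + 1) * N)⁻¹ * (ih n (Nat.lt_succ_self n) +
        ∑ k : Fin (n + 1), ih k.1 k.2 *
          PowerSeries.coeff (n + 2) (invSub (-(N : ℂ)) ^ k.1))) n
  refine ⟨PowerSeries.mk G, ⟨?_, ?_⟩, ?_⟩
  · rw [← PowerSeries.coeff_zero_eq_constantCoeff_apply, PowerSeries.coeff_mk]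
    simp only [G]
    rw [Nat.strongRec]
  · intro n
    simp only [PowerSeries.coeff_mk]
    rw [Finset.sum_range]
    conv_lhs => simp only [G]
    rw [Nat.strongRec]
  · rintro g ⟨h0, h1⟩
    ext n
    rw [PowerSeries.coeff_mk]
    induction n using Nat.strong_induction_on with
    | _ n ih =>
      match n, ih with
      | 0, _ =>
        rw [PowerSeries.coeff_zero_eq_constantCoeff_apply, h0]
        simp only [G]
        rw [Nat.strongRec]
      | n + 1, ih =>
        rw [h1, Finset.sum_range, ih n (by omega)]
        conv_rhs => simp only [G]
        rw [Nat.strongRec]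
        congr 2
        exact Finset.sum_congr rfl fun k _ => by rw [ih k.1 k.2]

/-- The normalizing series `g(u) = 1 + ∑ i ≥ 1, g_i u ^ (-i)`, determined by
`g(u + N) = g(u) (1 - u⁻²)`. -/
def normSeries (N : ℕ) [NeZero N] : ℂ⟦X⟧ := (existsUnique_normSeries N).choose

/-! ### The double Yangian -/

/-- Generators: the central element `C`, the `t_{ij}^{(r+1)}` (written `pos i j r`) and
the `t_{ij}^{(-r-1)}` (written `neg i j r`), for `r ≥ 0`. -/
inductive Gen (N : ℕ) : Type
  | central : Gen N
  | pos (i j : Fin N) (r : ℕ) : Gen N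
  | neg (i j : Fin N) (r : ℕ) : Gen N

/-- The free associative algebra on the generators. -/
abbrev Free (N : ℕ) : Type := FreeAlgebra ℂ (Gen N)

namespace Free

variable {N : ℕ}

/-- The generator `C`. -/
def central : Free N := FreeAlgebra.ι ℂ Gen.central

/-- The element `t_{ij}^{(r)}`, `r ≥ 0`, with the convention `t_{ij}^{(0)} = δ_{ij}`. -/
def tPos (i j : Fin N) : ℕ → Free N
  | 0 => if i = j then 1 else 0
  | r + 1 => FreeAlgebra.ι ℂ (Gen.pos i j r)

/-- The generator `t_{ij}^{(-r-1)}`. -/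
def tNeg (i j : Fin N) (r : ℕ) : Free N := FreeAlgebra.ι ℂ (Gen.neg i j r)

/-- The coefficient of `v ^ s` in `t⁺_{ij}(v) = δ_{ij} - ∑ r ≥ 1, t_{ij}^{(-r)} v ^ (r-1)`. -/
def tPlusCoeff (i j : Fin N) (s : ℕ) : Free N :=
  (if i = j ∧ s = 0 then 1 else 0) - tNeg i j s

/-- The series `t_{ij}(u)`, as a series in `u⁻¹` (outer variable) over series in `v`. -/
def tSeries (i j : Fin N) : (Free N)⟦X⟧⟦X⟧ :=
  PowerSeries.mk fun r => PowerSeries.C (tPos i j r)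

/-- The series `t⁺_{ij}(v)`, as a series in `u⁻¹` (outer variable) over series in `v`. -/
def tPlusSeries (i j : Fin N) : (Free N)⟦X⟧⟦X⟧ :=
  PowerSeries.C (PowerSeries.mk fun s => tPlusCoeff i j s)

/-- The series `v - C/2`, so that `u - (v - C/2) = u - v + C/2`. -/
def argL : (Free N)⟦X⟧ := PowerSeries.X - PowerSeries.C ((1 / 2 : ℂ) • central)

/-- The series `v + C/2`, so that `u - (v + C/2) = u - v - C/2`. -/
def argR : (Free N)⟦X⟧ := PowerSeries.X + PowerSeries.C ((1 / 2 : ℂ) • central)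

/-- The `(ij, kl)` entry of `R̄(u - v + C/2) T₁(u) T⁺₂(v)`, where `R̄(u) = g(u) (1 - P u⁻¹)`. -/
def mixedL [NeZero N] (i j k l : Fin N) : (Free N)⟦X⟧⟦X⟧ :=
  evalSub (normSeries N) argL *
    (tSeries i j * tPlusSeries k l - invSub argL * (tSeries k j * tPlusSeries i l))

/-- The `(ij, kl)` entry of `T⁺₂(v) T₁(u) R̄(u - v - C/2)`, where `R̄(u) = g(u) (1 - P u⁻¹)`. -/
def mixedR [NeZero N] (i j k l : Fin N) : (Free N)⟦X⟧⟦X⟧ :=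
  evalSub (normSeries N) argR *
    (tPlusSeries k l * tSeries i j - invSub argR * (tPlusSeries k j * tSeries i l))

end Free

open Free in
/-- The defining relations of the double Yangian `DY(gl_N)`: `C` is central; the relations
`R(u-v) T₁(u) T₂(v) = T₂(v) T₁(u) R(u-v)` and `R(u-v) T⁺₁(u) T⁺₂(v) = T⁺₂(v) T⁺₁(u) R(u-v)` of the
Yangian and of the dual Yangian, in terms of generators; and all coefficients of the relation
`R̄(u-v+C/2) T₁(u) T⁺₂(v) = T⁺₂(v) T₁(u) R̄(u-v-C/2)`, expanded in `u⁻¹` and `v`. -/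
inductive Rel (N : ℕ) [NeZero N] : Free N → Free N → Prop
  | central (x : Free N) : Rel N (central * x) (x * central)
  | yangian (i j k l : Fin N) (r s : ℕ) :
      Rel N (tPos i j r * tPos k l s - tPos k l s * tPos i j r)
        (∑ a ∈ Finset.Icc 1 (min r s),
          (tPos k j (a - 1) * tPos i l (r + s - a) - tPos k j (r + s - a) * tPos i l (a - 1)))
  /- the relation for `[t_{ij}^{(-r-1)}, t_{kl}^{(-s-1)}]`; the index `a` is the usual one
  lowered by `1` -/
  | dual (i j k l : Fin N) (r s : ℕ) :
      Rel N (tNeg i j r * tNeg k l s - tNeg k l s * tNeg i j r)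
        ((if k = j then tNeg i l (r + s + 1) else 0) - (if i = l then tNeg k j (r + s + 1) else 0) +
          ∑ a ∈ Finset.range (min r s + 1),
            (tNeg k j (r + s + 1 - a) * tNeg i l a - tNeg k j a * tNeg i l (r + s + 1 - a)))
  | mixed (i j k l : Fin N) (r s : ℕ) :
      Rel N (PowerSeries.coeff s (PowerSeries.coeff r (mixedL i j k l)))
        (PowerSeries.coeff s (PowerSeries.coeff r (mixedR i j k l)))

/-- The double Yangian `DY(gl_N)`. -/
def DY (N : ℕ) [NeZero N] : Type := RingQuot (Rel N)

namespace DY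

variable {N : ℕ} [NeZero N]

instance : Ring (DY N) := inferInstanceAs (Ring (RingQuot (Rel N)))

instance : Algebra ℂ (DY N) := inferInstanceAs (Algebra ℂ (RingQuot (Rel N)))

/-- The quotient map from the free algebra. -/
def proj : Free N →ₐ[ℂ] DY N := RingQuot.mkAlgHom ℂ (Rel N)

theorem proj_surjective : Function.Surjective (proj (N := N)) :=
  RingQuot.mkAlgHom_surjective ℂ (Rel N)

theorem proj_rel {x y : Free N} (h : Rel N x y) : proj x = proj y :=
  RingQuot.mkAlgHom_rel ℂ h

/-- The central element `C`. -/
def central : DY N := proj Free.central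

/-- The element `t_{ij}^{(r)}`, with `t_{ij}^{(0)} = δ_{ij}`. -/
def tPos (i j : Fin N) (r : ℕ) : DY N := proj (Free.tPos i j r)

/-- The generator `t_{ij}^{(-r-1)}`. -/
def tNeg (i j : Fin N) (r : ℕ) : DY N := proj (Free.tNeg i j r)

/-- The product of the generators `t_{ij}^{(-r-1)}` for `(i, j, r)` in a list. -/
def negMonomial (l : List (Fin N × Fin N × ℕ)) : DY N :=
  (l.map fun x => tNeg x.1 x.2.1 x.2.2).prod

/-- The degree of a monomial in the `t_{ij}^{(-r-1)}`, where `t_{ij}^{(-r)}` has degree `r`. -/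
def negDegree (l : List (Fin N × Fin N × ℕ)) : ℕ :=
  (l.map fun x => x.2.2 + 1).sum

/-- The right ideal of `DY(gl_N)` generated by the monomials of degree at least `p` in the
generators `t_{ij}^{(-r)}` of the dual Yangian, with `deg t_{ij}^{(-r)} = r`. -/
def negFiltration (N : ℕ) [NeZero N] (p : ℕ) : Submodule ℂ (DY N) :=
  Submodule.span ℂ {y | ∃ l d, p ≤ negDegree l ∧ y = negMonomial l * d}

theorem negFiltration_anti {p q : ℕ} (h : p ≤ q) : negFiltration N q ≤ negFiltration N p :=
  Submodule.span_mono fun _ ⟨l, d, hl, hy⟩ => ⟨l, d, h.trans hl, hy⟩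

theorem mem_negFiltration_zero (y : DY N) : y ∈ negFiltration N 0 :=
  Submodule.subset_span ⟨[], y, by simp [negDegree], by simp [negMonomial]⟩

theorem mul_right_mem_negFiltration {p : ℕ} {x : DY N} (hx : x ∈ negFiltration N p) (y : DY N) :
    x * y ∈ negFiltration N p := by
  induction hx using Submodule.span_induction with
  | mem x h =>
    obtain ⟨l, d, hl, rfl⟩ := h
    exact Submodule.subset_span ⟨l, d * y, hl, mul_assoc _ _ _⟩
  | zero => simp
  | add a b _ _ ha hb => rw [add_mul]; exact add_mem ha hb
  | smul c a _ ha => rw [smul_mul_assoc]; exact Submodule.smul_mem _ _ ha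

/-- To bound the left multiplication by `a` it suffices to look at monomials. -/
theorem mul_left_mem_of_monomial {a : DY N} {p n : ℕ}
    (h : ∀ l, n ≤ negDegree l → a * negMonomial l ∈ negFiltration N p)
    {y : DY N} (hy : y ∈ negFiltration N n) : a * y ∈ negFiltration N p := by
  induction hy using Submodule.span_induction with
  | mem x hx =>
    obtain ⟨l, d, hl, rfl⟩ := hx
    rw [← mul_assoc]
    exact mul_right_mem_negFiltration (h l hl) d
  | zero => simp
  | add a b _ _ ha hb => rw [mul_add]; exact add_mem ha hb
  | smul c a _ ha => rw [mul_smul_comm]; exact Submodule.smul_mem _ _ ha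

theorem tNeg_mul_mem {n : ℕ} {y : DY N} (hy : y ∈ negFiltration N n) (k l : Fin N) (s : ℕ) :
    tNeg k l s * y ∈ negFiltration N (n + s + 1) := by
  refine mul_left_mem_of_monomial (n := n) (fun L hL => ?_) hy
  refine Submodule.subset_span ⟨(k, l, s) :: L, 1, ?_, by simp [negMonomial]⟩
  simp only [negDegree, List.map_cons, List.sum_cons] at hL ⊢
  omega

theorem central_mul (x : DY N) : central * x = x * central := by
  obtain ⟨x, rfl⟩ := proj_surjective x
  simp only [central, ← map_mul]
  exact proj_rel (Rel.central x)

/-- Elements of the free algebra whose left multiplication preserves the filtration. -/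
def stab (N : ℕ) [NeZero N] : Subalgebra ℂ (Free N) where
  carrier := {x | ∀ p, ∀ y ∈ negFiltration N p, proj x * y ∈ negFiltration N p}
  mul_mem' := fun ha hb p y hy => by rw [map_mul, mul_assoc]; exact ha p _ (hb p y hy)
  add_mem' := fun ha hb p y hy => by rw [map_add, add_mul]; exact add_mem (ha p y hy) (hb p y hy)
  algebraMap_mem' := fun c p y hy => by
    rw [AlgHom.commutes, ← Algebra.smul_def]
    exact Submodule.smul_mem _ _ hy

theorem central_mem_stab : Free.central ∈ stab N := fun p y hy => by
  change central * y ∈ _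
  rw [central_mul]
  exact mul_right_mem_negFiltration hy _

/-- Series with coefficients in a given subalgebra, and with the degree in `v` less than the degree
in `u⁻¹` by at least `e` in every term. -/
def LowDegree (e : ℕ) (F : (Free N)⟦X⟧⟦X⟧) : Prop :=
  ∀ p q, PowerSeries.coeff q (PowerSeries.coeff p F) ∈ stab N ∧
    (p < q + e → PowerSeries.coeff q (PowerSeries.coeff p F) = 0)

theorem LowDegree.mul {e f : ℕ} {F G : (Free N)⟦X⟧⟦X⟧} (hF : LowDegree e F) (hG : LowDegree f G) :
    LowDegree (e + f) (F * G) := by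
  intro p q
  simp only [PowerSeries.coeff_mul, map_sum]
  refine ⟨sum_mem fun a _ => sum_mem fun b _ => mul_mem (hF _ _).1 (hG _ _).1, fun h => ?_⟩
  refine Finset.sum_eq_zero fun a ha => Finset.sum_eq_zero fun b hb => ?_
  rw [Finset.HasAntidiagonal.mem_antidiagonal] at ha hb
  by_cases h1 : a.1 < b.1 + e
  · rw [(hF _ _).2 h1, zero_mul]
  · rw [(hG _ _).2 (by omega), mul_zero]

theorem LowDegree.one : LowDegree 0 (1 : (Free N)⟦X⟧⟦X⟧) := by
  intro p q
  rw [PowerSeries.coeff_one]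
  split_ifs with h
  · rw [PowerSeries.coeff_one]
    split_ifs with h'
    · exact ⟨one_mem _, fun h2 => absurd h2 (by omega)⟩
    · exact ⟨zero_mem _, fun _ => rfl⟩
  · simp [zero_mem]

theorem LowDegree.mono {e f : ℕ} {F : (Free N)⟦X⟧⟦X⟧} (hF : LowDegree f F) (h : e ≤ f) :
    LowDegree e F := fun p q => ⟨(hF p q).1, fun h' => (hF p q).2 (by omega)⟩

theorem LowDegree.pow {e : ℕ} {F : (Free N)⟦X⟧⟦X⟧} (hF : LowDegree e F) (k : ℕ) :
    LowDegree (k * e) (F ^ k) := by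
  induction k with
  | zero => simpa using LowDegree.one
  | succ k ih => rw [pow_succ, Nat.succ_mul]; exact ih.mul hF

/-- The property of a series in `v` of being a polynomial of degree at most one, with coefficients
preserving the filtration. -/
def Linear (w : (Free N)⟦X⟧) : Prop :=
  ∀ q, PowerSeries.coeff q w ∈ stab N ∧ (1 < q → PowerSeries.coeff q w = 0)

theorem linear_argL : Linear (Free.argL (N := N)) := by
  intro q
  simp only [Free.argL, map_sub, PowerSeries.coeff_X, PowerSeries.coeff_C]
  refine ⟨sub_mem ?_ ?_, fun h => ?_⟩
  · split_ifs <;> simp [one_mem, zero_mem]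
  · split_ifs
    · exact Subalgebra.smul_mem _ central_mem_stab _
    · exact zero_mem _
  · rw [if_neg (by omega), if_neg (by omega), sub_zero]

theorem linear_argR : Linear (Free.argR (N := N)) := by
  intro q
  simp only [Free.argR, map_add, PowerSeries.coeff_X, PowerSeries.coeff_C]
  refine ⟨add_mem ?_ ?_, fun h => ?_⟩
  · split_ifs <;> simp [one_mem, zero_mem]
  · split_ifs
    · exact Subalgebra.smul_mem _ central_mem_stab _
    · exact zero_mem _
  · rw [if_neg (by omega), if_neg (by omega), add_zero]

theorem lowDegree_invSub {w : (Free N)⟦X⟧} (hw : Linear w) : LowDegree 1 (invSub w) := by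
  have key : ∀ j q, PowerSeries.coeff q (w ^ j) ∈ stab N ∧
      (j < q → PowerSeries.coeff q (w ^ j) = 0) := by
    intro j
    induction j with
    | zero =>
      intro q
      rw [pow_zero, PowerSeries.coeff_one]
      split_ifs with h
      · exact ⟨one_mem _, fun h' => absurd h' (by omega)⟩
      · exact ⟨zero_mem _, fun _ => rfl⟩
    | succ j ih =>
      intro q
      rw [pow_succ, PowerSeries.coeff_mul]
      refine ⟨sum_mem fun a _ => mul_mem (ih _).1 (hw _).1, fun h => ?_⟩
      refine Finset.sum_eq_zero fun a ha => ?_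
      rw [Finset.HasAntidiagonal.mem_antidiagonal] at ha
      by_cases h1 : j < a.1
      · rw [(ih _).2 h1, zero_mul]
      · rw [(hw _).2 (by omega), mul_zero]
  intro p q
  cases p with
  | zero => simp [invSub, zero_mem]
  | succ j =>
    simp only [invSub, PowerSeries.coeff_mk]
    exact ⟨(key j q).1, fun h => (key j q).2 (by omega)⟩

theorem constantCoeff_normSeries : PowerSeries.coeff 0 (normSeries N) = 1 := by
  rw [PowerSeries.coeff_zero_eq_constantCoeff_apply]
  exact (existsUnique_normSeries N).choose_spec.1.1

theorem lowDegree_evalSub {w : (Free N)⟦X⟧} (hw : Linear w) :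
    LowDegree 1 (evalSub (normSeries N) w - 1) := by
  intro p q
  cases p with
  | zero =>
    have h : PowerSeries.coeff 0 (evalSub (normSeries N) w - 1) = 0 := by
      rw [map_sub, evalSub, PowerSeries.coeff_mk, Finset.sum_range_one, pow_zero,
        constantCoeff_normSeries, one_smul, sub_self]
    rw [h]
    simp [zero_mem]
  | succ p =>
    have h : PowerSeries.coeff (p + 1) (evalSub (normSeries N) w - 1) =
        ∑ k ∈ Finset.range (p + 1), PowerSeries.coeff (k + 1) (normSeries N) •
          PowerSeries.coeff (p + 1) (invSub w ^ (k + 1)) := by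
      rw [map_sub, evalSub, PowerSeries.coeff_mk, Finset.sum_range_succ', pow_zero,
        PowerSeries.coeff_one, if_neg (Nat.succ_ne_zero p), smul_zero, add_zero, sub_zero]
    rw [h, map_sum]
    have hk : ∀ k, LowDegree 1 (invSub w ^ (k + 1)) := fun k =>
      ((lowDegree_invSub hw).pow (k + 1)).mono (by omega)
    refine ⟨sum_mem fun k _ => ?_, fun hq => Finset.sum_eq_zero fun k _ => ?_⟩
    · rw [PowerSeries.coeff_smul]
      exact Subalgebra.smul_mem _ (hk k _ _).1 _
    · have := (hk k _ _).2 hq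
      rw [PowerSeries.coeff_smul, this, smul_zero]

/-- The image in `DY(gl_N)` of the coefficient of `u ^ (-r) v ^ s`. -/
def projCoeff (r s : ℕ) (F : (Free N)⟦X⟧⟦X⟧) : DY N :=
  proj (PowerSeries.coeff s (PowerSeries.coeff r F))

theorem tPlusCoeff_mul_mem {n : ℕ} {y : DY N} (hy : y ∈ negFiltration N n) (k l : Fin N) (s : ℕ) :
    proj (Free.tPlusCoeff k l s) * y ∈ negFiltration N (n + s) := by
  have h := negFiltration_anti (Nat.le_succ _) (tNeg_mul_mem hy k l s)
  rw [Free.tPlusCoeff, map_sub, sub_mul]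
  refine sub_mem ?_ h
  split_ifs with h0
  · rw [map_one, one_mul, h0.2]; exact hy
  · simp

theorem projCoeff_mul_mem {F G : (Free N)⟦X⟧⟦X⟧} (hF : LowDegree 1 F) {r s n p : ℕ} {y : DY N}
    (hG : ∀ a b m, a < r → m + a ≤ n + b →
      projCoeff a b G * y ∈ negFiltration N m)
    (h : p + r ≤ n + s + 1) : projCoeff r s (F * G) * y ∈ negFiltration N p := by
  rw [projCoeff, PowerSeries.coeff_mul, map_sum, map_sum, Finset.sum_mul]
  refine sum_mem fun a ha => ?_
  rw [PowerSeries.coeff_mul, map_sum, Finset.sum_mul]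
  refine sum_mem fun b hb => ?_
  rw [Finset.HasAntidiagonal.mem_antidiagonal] at ha hb
  by_cases h1 : a.1 < b.1 + 1
  · rw [(hF _ _).2 h1, zero_mul, map_zero, zero_mul]
    exact zero_mem _
  · rw [map_mul, mul_assoc]
    exact (hF _ _).1 p _ (hG a.2 b.2 p (by omega) (by omega))

theorem projCoeff_tSeries_mul (i j k l : Fin N) (r s : ℕ) :
    projCoeff r s (Free.tSeries i j * Free.tPlusSeries k l) =
      tPos i j r * proj (Free.tPlusCoeff k l s) := by
  simp [projCoeff, Free.tSeries, Free.tPlusSeries, tPos]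

theorem projCoeff_mul_tSeries (i j k l : Fin N) (r s : ℕ) :
    projCoeff r s (Free.tPlusSeries k l * Free.tSeries i j) =
      proj (Free.tPlusCoeff k l s) * tPos i j r := by
  simp [projCoeff, Free.tSeries, Free.tPlusSeries, tPos]

/-- Left multiplication by `t_{ij}^{(r)}` lowers the degree by at most `r`. -/
theorem tPos_mul_mem (r : ℕ) : ∀ (i j : Fin N) (p n : ℕ) (y : DY N), p + r ≤ n →
    y ∈ negFiltration N n → tPos i j r * y ∈ negFiltration N p := by
  induction r using Nat.strong_induction_on with
  | _ r ih =>
    intro i j p n y hpn hy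
    refine mul_left_mem_of_monomial (n := n) (fun L hL => ?_) hy
    clear hy y
    have hpL : p + r ≤ negDegree L := hpn.trans hL
    clear hL hpn n
    by_cases hr : r = 0
    · subst hr
      have : negMonomial L ∈ negFiltration N p :=
        Submodule.subset_span ⟨L, 1, by omega, by simp⟩
      simp only [tPos, Free.tPos]
      split_ifs
      · simpa using this
      · simp
    induction L generalizing p with
    | nil => simp [negDegree] at hpL; omega
    | cons x L ihL =>
      obtain ⟨k, l, s⟩ := x
      set y := negMonomial L with hy
      set n := negDegree L with hn
      have hyn : y ∈ negFiltration N n := Submodule.subset_span ⟨L, 1, le_rfl, by simp [hy]⟩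
      have hps : p + r ≤ n + s + 1 := by
        simp only [negDegree, List.map_cons, List.sum_cons] at hpL hn; omega
      have hcons : negMonomial ((k, l, s) :: L) = tNeg k l s * y := by simp [negMonomial, hy]
      rw [hcons, ← mul_assoc]
      have hA : ∀ i j k l : Fin N, ∀ a b m, a < r → m + a ≤ n + b →
          projCoeff a b (Free.tSeries i j * Free.tPlusSeries k l) * y ∈ negFiltration N m := by
        intro i j k l a b m ha hm
        rw [projCoeff_tSeries_mul, mul_assoc]
        exact ih a ha i j m (n + b) _ (by omega) (tPlusCoeff_mul_mem hyn k l b)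
      have hB : ∀ i j k l : Fin N, ∀ a b m, a < r → m + a ≤ n + b →
          projCoeff a b (Free.tPlusSeries k l * Free.tSeries i j) * y ∈ negFiltration N m := by
        intro i j k l a b m ha hm
        rw [projCoeff_mul_tSeries, mul_assoc]
        by_cases han : a ≤ n
        · exact negFiltration_anti (by omega) (tPlusCoeff_mul_mem
            (ih a ha i j (n - a) n y (by omega) hyn) k l b)
        · exact negFiltration_anti (by omega) (tPlusCoeff_mul_mem
            (mem_negFiltration_zero (tPos i j a * y)) k l b)
      have hrel := proj_rel (Rel.mixed i j k l r s)
      have hL : Free.mixedL i j k l = Free.tSeries i j * Free.tPlusSeries k l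
          + (evalSub (normSeries N) Free.argL - 1) * (Free.tSeries i j * Free.tPlusSeries k l)
          - (evalSub (normSeries N) Free.argL * invSub Free.argL) *
            (Free.tSeries k j * Free.tPlusSeries i l) := by
        rw [Free.mixedL]; noncomm_ring
      have hR : Free.mixedR i j k l = Free.tPlusSeries k l * Free.tSeries i j
          + (evalSub (normSeries N) Free.argR - 1) * (Free.tPlusSeries k l * Free.tSeries i j)
          - (evalSub (normSeries N) Free.argR * invSub Free.argR) *
            (Free.tPlusSeries k j * Free.tSeries i l) := by
        rw [Free.mixedR]; noncomm_ring
      have hlow : ∀ w : (Free N)⟦X⟧, Linear w →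
          LowDegree 1 (evalSub (normSeries N) w * invSub w) := by
        intro w hw
        have h1 := (lowDegree_evalSub hw).mono (Nat.zero_le 1)
        have h2 : LowDegree 0 (evalSub (normSeries N) w) := by
          intro a b
          have e : evalSub (normSeries N) w = (evalSub (normSeries N) w - 1) + 1 := by
            rw [sub_add_cancel]
          rw [e, map_add, map_add]
          exact ⟨add_mem (h1 a b).1 (LowDegree.one a b).1, fun h => by
            rw [(h1 a b).2 h, (LowDegree.one a b).2 h, add_zero]⟩
        have := h2.mul (lowDegree_invSub hw)
        rwa [zero_add] at this
      have e1 := projCoeff_mul_mem (lowDegree_evalSub linear_argL) (hA i j k l) hps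
      have e2 := projCoeff_mul_mem (hlow _ linear_argL) (hA k j i l) hps
      have e3 := projCoeff_mul_mem (lowDegree_evalSub linear_argR) (hB i j k l) hps
      have e4 := projCoeff_mul_mem (hlow _ linear_argR) (hB i l k j) hps
      have hmain : tPos i j r * tNeg k l s * y = tNeg k l s * (tPos i j r * y)
          + projCoeff r s ((evalSub (normSeries N) Free.argL - 1) *
              (Free.tSeries i j * Free.tPlusSeries k l)) * y
          - projCoeff r s ((evalSub (normSeries N) Free.argL * invSub Free.argL) *
            (Free.tSeries k j * Free.tPlusSeries i l)) * y
          - (projCoeff r s ((evalSub (normSeries N) Free.argR - 1) *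
              (Free.tPlusSeries k l * Free.tSeries i j)) * y
            - projCoeff r s ((evalSub (normSeries N) Free.argR * invSub Free.argR) *
            (Free.tPlusSeries k j * Free.tSeries i l)) * y) := by
        have h1 : projCoeff r s (Free.mixedL i j k l) = projCoeff r s (Free.mixedR i j k l) := hrel
        have hadd : ∀ F G, projCoeff (N := N) r s (F + G) = projCoeff r s F + projCoeff r s G := by
          intro F G; simp [projCoeff]
        have hsub : ∀ F G, projCoeff (N := N) r s (F - G) = projCoeff r s F - projCoeff r s G := by
          intro F G; simp [projCoeff]
        rw [hL, hR, hsub, hadd, hsub, hadd, projCoeff_tSeries_mul, projCoeff_mul_tSeries] at h1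
        have hplus : proj (Free.tPlusCoeff k l s) =
            (algebraMap ℂ (DY N) (if k = l ∧ s = 0 then 1 else 0)) - tNeg k l s := by
          rw [Free.tPlusCoeff, map_sub]
          split_ifs <;> simp [tNeg]
        generalize projCoeff (N := N) r s ((evalSub (normSeries N) Free.argL - 1) * _) = E1 at h1 ⊢
        generalize projCoeff (N := N) r s ((evalSub (normSeries N) Free.argR - 1) * _) = E2 at h1 ⊢
        generalize projCoeff (N := N) r s ((evalSub (normSeries N) Free.argL * _) * _) = E3 at h1 ⊢
        generalize projCoeff (N := N) r s ((evalSub (normSeries N) Free.argR * _) * _) = E4 at h1 ⊢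
        rw [hplus, mul_sub, sub_mul, Algebra.commutes] at h1
        have h2 := congrArg (· * y) h1
        simp only [add_mul, sub_mul, mul_assoc] at h2 ⊢
        rw [← sub_eq_zero] at h2 ⊢
        rw [← neg_eq_zero, ← h2]
        abel
      rw [hmain]
      refine sub_mem (sub_mem (add_mem ?_ e1) e2) (sub_mem e3 e4)
      by_cases hsp : s + 1 ≤ p
      · have := ihL (p - (s + 1)) (by omega)
        exact negFiltration_anti (by omega) (tNeg_mul_mem this k l s)
      · exact negFiltration_anti (by omega)
          (tNeg_mul_mem (mem_negFiltration_zero (tPos i j r * y)) k l s)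

theorem exists_mul_left_mem (x : DY N) :
    ∀ p, ∃ n, ∀ y ∈ negFiltration N n, x * y ∈ negFiltration N p := by
  obtain ⟨x, rfl⟩ := proj_surjective x
  induction x using FreeAlgebra.induction with
  | grade0 c =>
    exact fun p => ⟨p, fun y hy => by
      rw [AlgHom.commutes, ← Algebra.smul_def]; exact Submodule.smul_mem _ _ hy⟩
  | grade1 g =>
    intro p
    cases g with
    | central => exact ⟨p, fun y hy => central_mem_stab p y hy⟩
    | pos i j r =>
      refine ⟨p + (r + 1), fun y hy => ?_⟩
      change tPos i j (r + 1) * y ∈ _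
      exact tPos_mul_mem (r + 1) i j p _ y le_rfl hy
    | neg i j r =>
      refine ⟨p, fun y hy => ?_⟩
      change tNeg i j r * y ∈ _
      have h : p ≤ p + r + 1 := by omega
      exact negFiltration_anti h (tNeg_mul_mem hy i j r)
  | mul a b ha hb =>
    intro p
    obtain ⟨n, hn⟩ := ha p
    obtain ⟨m, hm⟩ := hb n
    exact ⟨m, fun y hy => by rw [map_mul, mul_assoc]; exact hn _ (hm y hy)⟩
  | add a b ha hb =>
    intro p
    obtain ⟨n, hn⟩ := ha p
    obtain ⟨m, hm⟩ := hb p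
    refine ⟨max n m, fun y hy => ?_⟩
    rw [map_add, add_mul]
    exact add_mem (hn y (negFiltration_anti (le_max_left _ _) hy))
      (hm y (negFiltration_anti (le_max_right _ _) hy))

theorem negFiltration_basis :
    RingSubgroupsBasis fun p : ℕ => (negFiltration N p).toAddSubgroup where
  inter p q := ⟨max p q, fun _ hy => ⟨negFiltration_anti (le_max_left p q) hy,
    negFiltration_anti (le_max_right p q) hy⟩⟩
  mul p := ⟨p, by
    rintro _ ⟨x, hx, y, -, rfl⟩
    exact mul_right_mem_negFiltration hx y⟩
  leftMul x p := by
    obtain ⟨n, hn⟩ := exists_mul_left_mem x p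
    exact ⟨n, hn⟩
  rightMul x p := ⟨p, fun _ hy => mul_right_mem_negFiltration hy x⟩

/-- The ring topology on `DY(gl_N)` with the right ideals `negFiltration N p` as a basis of
neighbourhoods of zero. -/
instance : TopologicalSpace (DY N) := negFiltration_basis.topology

instance : NonarchimedeanRing (DY N) := negFiltration_basis.nonarchimedean

instance : UniformSpace (DY N) := IsTopologicalAddGroup.rightUniformSpace (DY N)

instance : IsUniformAddGroup (DY N) := isUniformAddGroup_of_addCommGroup

instance : UniformContinuousConstSMul ℂ (DY N) where
  uniformContinuous_const_smul c := by
    have h : Continuous fun x : DY N => algebraMap ℂ (DY N) c * x := continuous_const.mul continuous_id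
    have h' : (fun x : DY N => c • x) = AddMonoidHom.mulLeft (algebraMap ℂ (DY N) c) := by
      ext x; simp [Algebra.smul_def]
    rw [h']
    exact uniformContinuous_of_continuousAt_zero _ h.continuousAt

end DY

/-! ### The extended double Yangian -/

/-- The completion of `DY(gl_N)` with respect to the right ideals `negFiltration N p`. -/
abbrev DYHat (N : ℕ) [NeZero N] : Type := UniformSpace.Completion (DY N)

/-- The canonical map from the double Yangian to its completion. -/
def toHat (N : ℕ) [NeZero N] : DY N →ₐ[ℂ] DYHat N :=
  { UniformSpace.Completion.coeRingHom with commutes' := fun _ => rfl }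

/-- The completed dual Yangian `Ŷ⁺(gl_N)`: the closure of the subalgebra generated by
the `t_{ij}^{(-r)}`. -/
def dualYangianHat (N : ℕ) [NeZero N] : Subalgebra ℂ (DYHat N) :=
  (Algebra.adjoin ℂ {x | ∃ i j r, x = toHat N (DY.tNeg i j r)}).topologicalClosure

/-- The Yangian `Y(gl_N)`: the subalgebra generated by the `t_{ij}^{(r)}`, `r ≥ 1`. -/
def yangian (N : ℕ) [NeZero N] : Subalgebra ℂ (DYHat N) :=
  Algebra.adjoin ℂ {x | ∃ i j r, 1 ≤ r ∧ x = toHat N (DY.tPos i j r)}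

/-- The extended double Yangian `DY°(gl_N)`: the subalgebra generated by the completed dual
Yangian, the Yangian and `C`.  Since the defining relations move the elements of the Yangian to
the right, it is the space of finite `ℂ[C]`-linear combinations of products `x y` with `x` in the
completed dual Yangian and `y` in the Yangian. -/
def extendedDY (N : ℕ) [NeZero N] : Subalgebra ℂ (DYHat N) :=
  dualYangianHat N ⊔ yangian N ⊔ Algebra.adjoin ℂ {toHat N DY.central}

variable {N : ℕ} [NeZero N]

/-- The inclusion of the completed dual Yangian in the extended double Yangian. -/
def dualToExtended : dualYangianHat N →ₐ[ℂ] extendedDY N :=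
  Subalgebra.inclusion (le_sup_left.trans le_sup_left)

/-- The element `C` of the extended double Yangian. -/
def extCentral : extendedDY N :=
  ⟨toHat N DY.central,
    (le_sup_right : _ ≤ extendedDY N) (Algebra.subset_adjoin (Set.mem_singleton _))⟩

/-- The element `t_{ij}^{(r)}`, `r ≥ 0`, of the extended double Yangian (equal to `δ_{ij}`
for `r = 0`). -/
def extT (i j : Fin N) (r : ℕ) : extendedDY N :=
  ⟨toHat N (DY.tPos i j r), by
    cases r with
    | zero =>
      simp only [DY.tPos, Free.tPos]
      split_ifs
      · rw [map_one, map_one]; exact one_mem _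
      · rw [map_zero, map_zero]; exact zero_mem _
    | succ r =>
      exact (le_sup_right.trans le_sup_left : yangian N ≤ extendedDY N)
        (Algebra.subset_adjoin ⟨i, j, r + 1, Nat.le_add_left 1 r, rfl⟩)⟩

/-- The element `t_{ij}^{(-r-1)}` of the completed dual Yangian. -/
def dualT (i j : Fin N) (r : ℕ) : dualYangianHat N :=
  ⟨toHat N (DY.tNeg i j r),
    Subalgebra.le_topologicalClosure _ (Algebra.subset_adjoin ⟨i, j, r, rfl⟩)⟩

/-! ### The extended vacuum module -/

/-- The left ideal of the extended double Yangian generated by `C - c` and all `t_{ij}^{(r)}`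
with `r ≥ 1`. -/
def vacuumIdeal (N : ℕ) [NeZero N] (c : ℂ) : Submodule (extendedDY N) (extendedDY N) :=
  Submodule.span (extendedDY N)
    (insert (extCentral - algebraMap ℂ (extendedDY N) c) {x | ∃ i j r, 1 ≤ r ∧ x = extT i j r})

/-- The extended vacuum module at the level `c`. -/
def VacuumModule (N : ℕ) [NeZero N] (c : ℂ) : Type := extendedDY N ⧸ vacuumIdeal N c

instance (c : ℂ) : AddCommGroup (VacuumModule N c) :=
  inferInstanceAs (AddCommGroup (extendedDY N ⧸ vacuumIdeal N c))

instance (c : ℂ) : Module (extendedDY N) (VacuumModule N c) :=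
  Submodule.Quotient.module (vacuumIdeal N c)

instance (c : ℂ) : Module ℂ (VacuumModule N c) :=
  Submodule.Quotient.module' (vacuumIdeal N c)

instance (c : ℂ) : IsScalarTower ℂ (extendedDY N) (VacuumModule N c) :=
  Submodule.Quotient.isScalarTower (vacuumIdeal N c) (extendedDY N)

/-- The vacuum vector, the image of `1`. -/
def vacuum (N : ℕ) [NeZero N] (c : ℂ) : VacuumModule N c := Submodule.Quotient.mk 1

/-- The subspace of vectors `v` with `t_{ij}(u) v = δ_{ij} v` for all `i, j`, that is,
`t_{ij}^{(r)} v = 0` for all `r ≥ 1`. -/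
def invariants (N : ℕ) [NeZero N] (c : ℂ) : Submodule ℂ (VacuumModule N c) where
  carrier := {v | ∀ (i j : Fin N) (r : ℕ), extT i j r • v = if r = 0 ∧ i = j then v else 0}
  zero_mem' i j r := by simp
  add_mem' ha hb i j r := by
    rw [smul_add, ha, hb]
    split_ifs <;> simp
  smul_mem' c v hv i j r := by
    rw [← algebraMap_smul (extendedDY N) c v, smul_smul, ← Algebra.commutes, mul_smul, hv]
    split_ifs <;> simp

/-! ### Standard tableaux and the primitive idempotents of the symmetric group -/

/-- A standard tableau of shape `μ` with `m` entries: a bijective filling of the boxes of `μ`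
by `0, …, m - 1` (that is, by the labels `1, …, m` lowered by one), increasing along the rows and
down the columns; `box a` is the box (row, column) occupied by `a`. -/
@[ext]
structure StandardTableau (μ : YoungDiagram) (m : ℕ) where
  box : Fin m ≃ μ.cells
  row_lt : ∀ a b, (box a).1.1 = (box b).1.1 → (box a).1.2 < (box b).1.2 → a < b
  col_lt : ∀ a b, (box a).1.2 = (box b).1.2 → (box a).1.1 < (box b).1.1 → a < b

namespace StandardTableau

variable {μ : YoungDiagram} {m : ℕ}

instance : Finite (StandardTableau μ m) :=
  Finite.of_injective StandardTableau.box fun _ _ h => StandardTableau.ext h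

instance : Fintype (StandardTableau μ m) := Fintype.ofFinite _

instance : DecidableEq (StandardTableau μ m) := Classical.decEq _

/-- The content `j - i` of the box `(i, j)` occupied by `a`. -/
def content (U : StandardTableau μ m) (a : Fin m) : ℤ := ((U.box a).1.2 : ℤ) - ((U.box a).1.1 : ℤ)

end StandardTableau

/-- The adjacent transposition `s_i` in the symmetric group on `m` letters. -/
def adjSwap (m : ℕ) (i : Fin (m - 1)) : Equiv.Perm (Fin m) :=
  Equiv.swap ⟨i, by omega⟩ ⟨i + 1, by omega⟩

theorem exists_adjWord {m : ℕ} (s : Equiv.Perm (Fin m)) :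
    ∃ w : List (Fin (m - 1)), (w.map (adjSwap m)).prod = s := by
  cases m with
  | zero => exact ⟨[], Subsingleton.elim _ _⟩
  | succ n =>
    have h : s ∈ Submonoid.closure (Set.range fun i : Fin n => Equiv.swap i.castSucc i.succ) := by
      rw [Equiv.Perm.mclosure_swap_castSucc_succ]; trivial
    induction h using Submonoid.closure_induction with
    | mem x hx =>
      obtain ⟨i, rfl⟩ := hx
      exact ⟨[i], by simp [adjSwap, Fin.castSucc, Fin.succ]; rfl⟩
    | one => exact ⟨[], rfl⟩
    | mul x y _ _ hx hy =>
      obtain ⟨w, rfl⟩ := hx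
      obtain ⟨w', rfl⟩ := hy
      exact ⟨w ++ w', by rw [List.map_append, List.prod_append]⟩

/-- A word in the adjacent transpositions with product `s`. -/
def adjWord {m : ℕ} (s : Equiv.Perm (Fin m)) : List (Fin (m - 1)) := (exists_adjWord s).choose

/-- The matrix of `s_i` in the orthonormal Young basis `(v_T)` of the irreducible representation
associated with `μ`: `s_i v_T = d⁻¹ v_T + √(1 - d⁻²) v_{s_i T}` with `d = c_{i+1}(T) - c_i(T)`,
where `s_i T` is obtained from `T` by exchanging the entries `i` and `i + 1`, and `v_{s_i T}`
is read as `0` if `s_i T` is not standard (in which case `d = ±1`). -/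
def youngSwapMatrix (μ : YoungDiagram) {m : ℕ} (i : Fin (m - 1)) :
    Matrix (StandardTableau μ m) (StandardTableau μ m) ℂ :=
  Matrix.of fun T' T =>
    let d : ℝ := (T.content ⟨i + 1, by omega⟩ : ℝ) - (T.content ⟨i, by omega⟩ : ℝ)
    if T' = T then ((1 / d : ℝ) : ℂ)
    else if T'.box = (adjSwap m i).trans T.box then ((Real.sqrt (1 - 1 / d ^ 2) : ℝ) : ℂ)
    else 0

/-- The matrix of a permutation in the orthonormal Young basis of the irreducible representation
associated with `μ`. -/
def youngMatrix (μ : YoungDiagram) {m : ℕ} (s : Equiv.Perm (Fin m)) :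
    Matrix (StandardTableau μ m) (StandardTableau μ m) ℂ :=
  ((adjWord s).map (youngSwapMatrix μ)).prod

/-- The primitive idempotent `e_U` of the group algebra of the symmetric group: the diagonal matrix
unit `(f_μ / m!) ∑ s, ρ_μ(s⁻¹)_{UU} s`, where `ρ_μ` is the irreducible representation
associated with `μ`, written in its orthonormal Young basis, and `f_μ` is its dimension. -/
def youngIdempotent {μ : YoungDiagram} {m : ℕ} (U : StandardTableau μ m) :
    MonoidAlgebra ℂ (Equiv.Perm (Fin m)) :=
  ∑ s : Equiv.Perm (Fin m), MonoidAlgebra.single s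
    ((Fintype.card (StandardTableau μ m) : ℂ) / (m.factorial : ℂ) * youngMatrix μ s⁻¹ U U)

/-! ### The series `𝕋⁺_μ(u)`

The algebra `End(ℂ^N)^{⊗ m} ⊗ A` is identified with the algebra of matrices over `A` whose rows and
columns are indexed by the basis vectors `e_{f(0)} ⊗ ⋯ ⊗ e_{f(m-1)}` of `(ℂ^N)^{⊗ m}`. -/

/-- The operator on `(ℂ^N)^{⊗ m}` permuting the tensor factors:
`s (e_{g(0)} ⊗ ⋯ ⊗ e_{g(m-1)})` has the factor `e_{g(a)}` in the place `s(a)`. -/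
def permTensor (N : ℕ) {m : ℕ} (s : Equiv.Perm (Fin m)) :
    Matrix (Fin m → Fin N) (Fin m → Fin N) ℂ :=
  Matrix.of fun f g => if f = g ∘ s.symm then 1 else 0

/-- The image of an element of the group algebra under the action on `(ℂ^N)^{⊗ m}`. -/
def groupAlgebraTensor (N : ℕ) {m : ℕ} (x : MonoidAlgebra ℂ (Equiv.Perm (Fin m))) :
    Matrix (Fin m → Fin N) (Fin m → Fin N) ℂ :=
  ∑ s : Equiv.Perm (Fin m), x.coeff s • permTensor N s

/-- The copy `M_a = 1 ⊗ ⋯ ⊗ M ⊗ ⋯ ⊗ 1` of a matrix `M`, in the `a`-th of `m` tensor factors. -/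
def inFactor {A : Type*} [Zero A] {m : ℕ} (a : Fin m) (M : Matrix (Fin N) (Fin N) A) :
    Matrix (Fin m → Fin N) (Fin m → Fin N) A :=
  Matrix.of fun f g => open Classical in if ∀ b, b ≠ a → f b = g b then M (f a) (g a) else 0

theorem tendsto_toHat_tNeg (a : ℕ → ℂ) (i j : Fin N) :
    Filter.Tendsto (fun r => toHat N (a r • DY.tNeg i j r)) Filter.atTop (nhds 0) := by
  have h : Filter.Tendsto (fun r => a r • DY.tNeg (N := N) i j r) Filter.atTop (nhds 0) := by
    rw [DY.negFiltration_basis.hasBasis_nhds_zero.tendsto_right_iff]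
    intro p _
    filter_upwards [Filter.eventually_ge_atTop p] with r hr
    have h1 := DY.tNeg_mul_mem (DY.mem_negFiltration_zero (1 : DY N)) i j r
    rw [mul_one] at h1
    have h2 : p ≤ 0 + r + 1 := by omega
    exact Submodule.smul_mem _ _ (DY.negFiltration_anti h2 h1)
  have h' := (UniformSpace.Completion.continuous_coe (DY N)).continuousAt.tendsto.comp h
  rwa [UniformSpace.Completion.coe_zero] at h'

/-- The series giving the coefficients of `t⁺_{ij}(u + c)` converge in the completed dual
Yangian. -/
theorem summable_dualT (a : ℕ → ℂ) (i j : Fin N) : Summable fun r => a r • dualT i j r := by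
  have hs : Summable fun r => toHat N (a r • DY.tNeg i j r) := by
    refine NonarchimedeanAddGroup.summable_of_tendsto_cofinite_zero ?_
    rw [Nat.cofinite_eq_atTop]
    exact tendsto_toHat_tNeg a i j
  have he : ∀ r, ((a r • dualT i j r : dualYangianHat N) : DYHat N) =
      toHat N (a r • DY.tNeg i j r) := fun r => by rw [map_smul]; rfl
  obtain ⟨x, hx⟩ := hs
  have hmem : x ∈ dualYangianHat N := by
    refine (Subalgebra.isClosed_topologicalClosure _).mem_of_tendsto hx
      (Filter.Eventually.of_forall fun t => sum_mem fun r _ => ?_)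
    rw [← he]
    exact (a r • dualT i j r).2
  refine ⟨⟨x, hmem⟩, ?_⟩
  rw [HasSum, tendsto_subtype_rng]
  refine hx.congr fun t => ?_
  rw [AddSubmonoidClass.coe_finsetSum]
  exact Finset.sum_congr rfl fun r _ => (he r).symm

/-- The matrix `T⁺(u + c)` over power series in `u` with coefficients in the completed dual
Yangian: `t⁺_{ij}(u + c) = δ_{ij} - ∑ r ≥ 0, t_{ij}^{(-r-1)} (u + c) ^ r`. -/
def dualSeries (c : ℂ) : Matrix (Fin N) (Fin N) (dualYangianHat N)⟦X⟧ :=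
  Matrix.of fun i j => PowerSeries.mk fun k =>
    (if i = j ∧ k = 0 then 1 else 0) - ∑' r : ℕ, ((r.choose k : ℂ) * c ^ (r - k)) • dualT i j r

/-- The series `𝕋⁺_μ(u) = tr_{1,…,m} E_U T⁺_1(u + c_1) ⋯ T⁺_m(u + c_m)` built from a standard
tableau `U` of shape `μ`. -/
def immanantSeries (N : ℕ) [NeZero N] {μ : YoungDiagram} {m : ℕ} (U : StandardTableau μ m) :
    (dualYangianHat N)⟦X⟧ :=
  Matrix.trace
    ((groupAlgebraTensor N (youngIdempotent U)).map (algebraMap ℂ (dualYangianHat N)⟦X⟧) *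
      (List.ofFn fun a => inFactor a (dualSeries (N := N) (U.content a : ℂ))).prod)

end

end DoubleYangianGL

/-!
Write `p_𝒰` for the projection of the group algebra of the symmetric group onto the vectors `z` with
`z x_a = c_a z`, where the `x_a` are the Jucys–Murphy elements and the `c_a` are the contents of the
standard tableau `𝒰`. Young's orthonormal form shows that the idempotent `e_𝒰` is a multiple of
`p_𝒰` (`exists_youngIdempotent_eq_smul`). This needs that the contents of `𝒰` are a weight of the
group algebra; weight vectors are obtained from a Young symmetrizer by exchanging adjacent letters
(`idem_ne_zero`). So `e_𝒰` may be replaced by `p_𝒰`, acting on `(ℂ^N)^{⊗ m}` as a matrix `P` with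
scalar entries.

Let `X = T⁺_1(u + c_1) ⋯ T⁺_m(u + c_m)`. The fusion procedure gives `P X = P X P`
(`isWeight_mul_fwdProd`). On weight vectors, the ordered product of the `R`-matrices attaching one
strand to the others is linear in a Jucys–Murphy element (`IsWeight.mul_bwdProd`). Hence the last
factor, deformed by a parameter, may be carried through the product by the `RTT` relations, and the
weight condition appears when the parameter is set to zero.

At the critical level `C = -N` the arguments of the two `R`-matrices in the mixed relation differ by
`N`, so that the functional equation of the normalizing series turns this relation into
`T_0(z) T⁺_a(u + c_a) = (1 + y_a P_{0a}) T⁺_a(u + c_a) T_0(z) (1 - y'_a P_{0a})` with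
`y_a = (z - u - c_a - N/2)⁻¹` and `y'_a = (z - u - c_a + N/2)⁻¹` (`vacuum_mixed_relation`).
Consequently `T_0(z) X = A X T_0(z) B`, where `A` and `B` are ordered products of these `R`-matrices
over the auxiliary factor `0`. By the same formula for such products, `A` and `B` are block
triangular: `P A P = P A` and `P B P = P B`. Moreover `A` and `B` are inverse to each other after
transposition in the auxiliary factor (`crossing`), which follows from `y_a - y'_a = N y_a y'_a`.

As `t_{ij}(z)` acts on the vacuum vector by `δ_{ij}`, applying `T_0(z) tr P X` to it gives
`tr P A X B`. By block triangularity and the cyclic property of the trace, valid for matrices with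
central entries, the `(i, j)` entry is the sum over `k` of `tr P B_{kj} A_{ik} P X`, which by the
crossing relation is `δ_{ij} tr P X` (`mul_trace_sub_mem`, `posSeries_mul_trace_sub_mem`).
-/


namespace DoubleYangianGL

noncomputable section

/-! ### The star structure of a group algebra -/

section GroupAlgebraStar

variable {G : Type*} [Group G] [Fintype G]

theorem coeff_mul_eq_sum (a b : MonoidAlgebra ℂ G) (g : G) :
    (a * b).coeff g = ∑ h, a.coeff h * b.coeff (h⁻¹ * g) := by
  classical
  rw [MonoidAlgebra.coeff_mul, Finsupp.sum_fintype _ _ (by simp)]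
  refine Finset.sum_congr rfl fun h _ => ?_
  rw [Finsupp.sum_fintype _ _ (by simp), Finset.sum_eq_single (h⁻¹ * g)]
  · simp
  · intro k _ hk
    rw [if_neg]
    rintro rfl
    simp at hk
  · simp

theorem coeff_mul_comm (a b : MonoidAlgebra ℂ G) : (a * b).coeff 1 = (b * a).coeff 1 := by
  rw [coeff_mul_eq_sum, coeff_mul_eq_sum]
  refine Fintype.sum_equiv (Equiv.inv G) _ _ fun h => ?_
  simp [mul_comm]

/-- The conjugate-linear anti-involution `∑ a_g g ↦ ∑ conj(a_g) g⁻¹` of a group algebra. -/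
def groupStar (a : MonoidAlgebra ℂ G) : MonoidAlgebra ℂ G :=
  .ofCoeff (Finsupp.equivFunOnFinite.symm fun g => starRingEnd ℂ (a.coeff g⁻¹))

theorem coeff_groupStar (a : MonoidAlgebra ℂ G) (g : G) :
    (groupStar a).coeff g = starRingEnd ℂ (a.coeff g⁻¹) := rfl

theorem groupStar_add (a b : MonoidAlgebra ℂ G) :
    groupStar (a + b) = groupStar a + groupStar b := by
  ext g; simp [coeff_groupStar]

theorem groupStar_sub (a b : MonoidAlgebra ℂ G) :
    groupStar (a - b) = groupStar a - groupStar b := by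
  ext g; simp [coeff_groupStar]

theorem groupStar_smul (c : ℂ) (a : MonoidAlgebra ℂ G) :
    groupStar (c • a) = starRingEnd ℂ c • groupStar a := by
  ext g; simp [coeff_groupStar]

theorem groupStar_groupStar (a : MonoidAlgebra ℂ G) : groupStar (groupStar a) = a := by
  ext g; simp [coeff_groupStar]

theorem groupStar_zero : groupStar (0 : MonoidAlgebra ℂ G) = 0 := by
  ext g; simp [coeff_groupStar]

theorem groupStar_mul (a b : MonoidAlgebra ℂ G) :
    groupStar (a * b) = groupStar b * groupStar a := by
  ext g
  rw [coeff_groupStar, coeff_mul_eq_sum, coeff_mul_eq_sum, map_sum]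
  refine Fintype.sum_equiv (Equiv.mulLeft g) _ _ fun h => ?_
  simp [coeff_groupStar, mul_comm]

theorem groupStar_of (g : G) :
    groupStar (MonoidAlgebra.of ℂ G g) = MonoidAlgebra.of ℂ G g⁻¹ := by
  classical
  ext h
  simp only [coeff_groupStar, MonoidAlgebra.of_apply, MonoidAlgebra.coeff_single,
    Finsupp.single_apply]
  by_cases hg : g = h⁻¹
  · simp [hg]
  · rw [if_neg hg, if_neg (fun h' => hg (by rw [← h', inv_inv])), map_zero]

theorem groupStar_sum {ι : Type*} (s : Finset ι) (f : ι → MonoidAlgebra ℂ G) :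
    groupStar (∑ i ∈ s, f i) = ∑ i ∈ s, groupStar (f i) := by
  classical
  induction s using Finset.induction_on with
  | empty => simp [groupStar_zero]
  | insert a s ha ih => rw [Finset.sum_insert ha, Finset.sum_insert ha, groupStar_add, ih]

/-- The squared norm of the coefficient vector of an element of a group algebra. -/
def sqNorm {G : Type*} [Fintype G] (a : MonoidAlgebra ℂ G) : ℝ := ∑ g, ‖a.coeff g‖ ^ 2

theorem sqNorm_nonneg {G : Type*} [Fintype G] (a : MonoidAlgebra ℂ G) : 0 ≤ sqNorm a :=
  Finset.sum_nonneg fun _ _ => by positivity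

theorem coeff_mul_groupStar (a b : MonoidAlgebra ℂ G) :
    (a * groupStar b).coeff 1 = ∑ g, a.coeff g * starRingEnd ℂ (b.coeff g) := by
  rw [coeff_mul_eq_sum]
  simp [coeff_groupStar]

theorem coeff_mul_groupStar_self (a : MonoidAlgebra ℂ G) :
    (a * groupStar a).coeff 1 = (sqNorm a : ℂ) := by
  rw [coeff_mul_groupStar, sqNorm]
  push_cast
  exact Finset.sum_congr rfl fun g _ => Complex.mul_conj' _

theorem eq_zero_of_sqNorm_eq_zero {G : Type*} [Fintype G] {a : MonoidAlgebra ℂ G}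
    (h : sqNorm a = 0) : a = 0 := by
  rw [sqNorm, Finset.sum_eq_zero_iff_of_nonneg fun _ _ => by positivity] at h
  ext g
  simpa using h g (Finset.mem_univ g)

theorem eq_zero_of_mul_groupStar_self {a : MonoidAlgebra ℂ G} (h : a * groupStar a = 0) :
    a = 0 := by
  refine eq_zero_of_sqNorm_eq_zero ?_
  have := coeff_mul_groupStar_self a
  rw [h, MonoidAlgebra.coeff_zero, Finsupp.zero_apply] at this
  exact_mod_cast this.symm

theorem exists_projection (W : Submodule ℂ (MonoidAlgebra ℂ G)) (x : MonoidAlgebra ℂ G) :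
    ∃ p ∈ W, ∀ z ∈ W, (z * groupStar (x - p)).coeff 1 = 0 := by
  let e : MonoidAlgebra ℂ G ≃ₗ[ℂ] EuclideanSpace ℂ G :=
    (MonoidAlgebra.coeffLinearEquiv ℂ).trans
      ((Finsupp.linearEquivFunOnFinite ℂ ℂ G).trans (WithLp.linearEquiv 2 ℂ (G → ℂ)).symm)
  let K : Submodule ℂ (EuclideanSpace ℂ G) := W.map e.toLinearMap
  obtain ⟨p, hp, hpe⟩ : K.starProjection (e x) ∈ K := Submodule.starProjection_apply_mem _ _
  refine ⟨p, hp, fun z hz => ?_⟩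
  have h := K.starProjection_inner_eq_zero (e x) (e z) (Submodule.mem_map_of_mem hz)
  rw [← hpe] at h
  have h1 : e x - e.toLinearMap p = e (x - p) := by simp
  rw [h1, EuclideanSpace.inner_eq_star_dotProduct] at h
  rw [coeff_mul_groupStar, ← h]
  rfl

/-- A left ideal of the group algebra is generated by a self-adjoint idempotent, the orthogonal
projection of the unit. -/
theorem exists_selfAdjoint_idempotent (W : Submodule ℂ (MonoidAlgebra ℂ G))
    (hW : ∀ g, ∀ z ∈ W, MonoidAlgebra.of ℂ G g * z ∈ W) :
    ∃ p ∈ W, groupStar p = p ∧ ∀ z ∈ W, z * p = z := by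
  obtain ⟨p, hp, h⟩ := exists_projection W 1
  have h1 : ∀ z ∈ W, z * groupStar (1 - p) = 0 := by
    intro z hz
    ext g
    have := h _ (hW g⁻¹ z hz)
    rw [mul_assoc, MonoidAlgebra.of_apply, coeff_mul_eq_sum, Finset.sum_eq_single g⁻¹] at this
    · simpa using this
    · intro b _ hb
      simp [Ne.symm hb]
    · simp
  have hone : groupStar (1 : MonoidAlgebra ℂ G) = 1 := by
    rw [← map_one (MonoidAlgebra.of ℂ G), groupStar_of, inv_one]
  have h2 : ∀ z ∈ W, z * groupStar p = z := by
    intro z hz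
    have := h1 z hz
    rw [groupStar_sub, hone, mul_sub, mul_one, sub_eq_zero] at this
    exact this.symm
  have h3 : groupStar p = p := by
    have h4 := h2 p hp
    rw [← h4, groupStar_mul, groupStar_groupStar]
  exact ⟨p, hp, h3, fun z hz => by have := h2 z hz; rwa [h3] at this⟩

end GroupAlgebraStar

/-! ### Jucys–Murphy elements and weight spaces -/

section JucysMurphy

variable {m : ℕ}

open MonoidAlgebra in
/-- The Jucys–Murphy element `x_a = ∑ b < a, (b a)`. -/
def jucysMurphy (a : Fin m) : MonoidAlgebra ℂ (Equiv.Perm (Fin m)) :=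
  ∑ b ∈ Finset.Iio a, of ℂ _ (Equiv.swap b a)

open MonoidAlgebra

theorem of_mul_of_swap (g : Equiv.Perm (Fin m)) (b a : Fin m) :
    of ℂ _ g * of ℂ _ (Equiv.swap b a) = of ℂ _ (Equiv.swap (g b) (g a)) * of ℂ _ g := by
  rw [← map_mul, ← map_mul, Equiv.mul_swap_eq_swap_mul]

theorem groupStar_jucysMurphy (a : Fin m) : groupStar (jucysMurphy a) = jucysMurphy a := by
  rw [jucysMurphy, groupStar_sum]
  exact Finset.sum_congr rfl fun b _ => by rw [groupStar_of, Equiv.swap_inv]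

/-- A permutation fixing `a` and preserving the set of the letters below `a` commutes with `x_a`. -/
theorem of_mul_jucysMurphy_of_fixed {g : Equiv.Perm (Fin m)} {a : Fin m} (hg : g a = a)
    (hlt : ∀ b, b < a ↔ g b < a) : of ℂ _ g * jucysMurphy a = jucysMurphy a * of ℂ _ g := by
  rw [jucysMurphy, Finset.mul_sum, Finset.sum_mul]
  refine Finset.sum_equiv g (fun b => ?_) fun b _ => ?_
  · rw [Finset.mem_Iio, Finset.mem_Iio]; exact hlt b
  · rw [of_mul_of_swap, hg]

/-- The lower one of the two letters exchanged by `s_i`. -/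
def loIdx (i : Fin (m - 1)) : Fin m := ⟨i, by omega⟩

/-- The upper one of the two letters exchanged by `s_i`. -/
def hiIdx (i : Fin (m - 1)) : Fin m := ⟨i + 1, by omega⟩

theorem loIdx_lt_hiIdx (i : Fin (m - 1)) : loIdx i < hiIdx i := by
  simp [loIdx, hiIdx, Fin.lt_def]

theorem lt_hiIdx_iff {i : Fin (m - 1)} {a : Fin m} : a < hiIdx i ↔ a = loIdx i ∨ a < loIdx i := by
  simp only [loIdx, hiIdx, Fin.lt_def, Fin.ext_iff]; omega

theorem adjSwap_eq (i : Fin (m - 1)) : adjSwap m i = Equiv.swap (loIdx i) (hiIdx i) := rfl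

theorem adjSwap_mul_self (i : Fin (m - 1)) : adjSwap m i * adjSwap m i = 1 :=
  Equiv.swap_mul_self _ _

theorem adjSwap_loIdx (i : Fin (m - 1)) : adjSwap m i (loIdx i) = hiIdx i :=
  Equiv.swap_apply_left _ _

theorem adjSwap_hiIdx (i : Fin (m - 1)) : adjSwap m i (hiIdx i) = loIdx i :=
  Equiv.swap_apply_right _ _

theorem adjSwap_of_ne {i : Fin (m - 1)} {a : Fin m} (h1 : a ≠ loIdx i) (h2 : a ≠ hiIdx i) :
    adjSwap m i a = a := Equiv.swap_apply_of_ne_of_ne h1 h2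

theorem adjSwap_adjSwap (i : Fin (m - 1)) (a : Fin m) : adjSwap m i (adjSwap m i a) = a :=
  Equiv.swap_apply_self _ _ _

/-- The adjacent transposition `s_i` as an element of the group algebra. -/
def simpleRefl (i : Fin (m - 1)) : MonoidAlgebra ℂ (Equiv.Perm (Fin m)) := of ℂ _ (adjSwap m i)

theorem simpleRefl_mul_self (i : Fin (m - 1)) :
    simpleRefl i * simpleRefl i = (1 : MonoidAlgebra ℂ (Equiv.Perm (Fin m))) := by
  rw [simpleRefl, ← map_mul, adjSwap_mul_self, map_one]

theorem groupStar_simpleRefl (i : Fin (m - 1)) :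
    groupStar (simpleRefl i : MonoidAlgebra ℂ (Equiv.Perm (Fin m))) = simpleRefl i := by
  rw [simpleRefl, groupStar_of, adjSwap_eq, Equiv.swap_inv]

theorem jucysMurphy_hiIdx_mul (i : Fin (m - 1)) :
    jucysMurphy (hiIdx i) * simpleRefl i = simpleRefl i * jucysMurphy (loIdx i) + 1 := by
  have h1 : Finset.Iio (hiIdx i) = insert (loIdx i) (Finset.Iio (loIdx i)) := by
    ext a; simp [lt_hiIdx_iff, le_iff_eq_or_lt]
  have h2 : simpleRefl i * jucysMurphy (loIdx i) =
      (∑ b ∈ Finset.Iio (loIdx i), of ℂ _ (Equiv.swap b (hiIdx i))) * simpleRefl i := by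
    rw [jucysMurphy, Finset.mul_sum, Finset.sum_mul]
    refine Finset.sum_congr rfl fun b hb => ?_
    rw [Finset.mem_Iio] at hb
    rw [simpleRefl, of_mul_of_swap, adjSwap_loIdx,
      adjSwap_of_ne hb.ne (hb.trans (loIdx_lt_hiIdx i)).ne]
  rw [h2, jucysMurphy, h1, Finset.sum_insert (by simp), add_mul, ← adjSwap_eq, add_comm]
  change _ + simpleRefl i * simpleRefl i = _
  rw [simpleRefl_mul_self]

theorem simpleRefl_mul_jucysMurphy_hiIdx (i : Fin (m - 1)) :
    simpleRefl i * jucysMurphy (hiIdx i) = jucysMurphy (loIdx i) * simpleRefl i + 1 := by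
  have h := congrArg groupStar (jucysMurphy_hiIdx_mul i)
  rwa [groupStar_mul, groupStar_add, groupStar_mul, groupStar_simpleRefl, groupStar_jucysMurphy,
    groupStar_jucysMurphy, ← map_one (of ℂ _), groupStar_of, inv_one, map_one] at h

theorem simpleRefl_mul_jucysMurphy_of_ne {i : Fin (m - 1)} {a : Fin m} (h1 : a ≠ loIdx i)
    (h2 : a ≠ hiIdx i) : simpleRefl i * jucysMurphy a = jucysMurphy a * simpleRefl i := by
  refine of_mul_jucysMurphy_of_fixed (adjSwap_of_ne h1 h2) fun b => ?_
  by_cases hb1 : b = loIdx i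
  · rw [hb1, adjSwap_loIdx]
    simp only [loIdx, hiIdx, Fin.lt_def, Fin.ext_iff, ne_eq] at *; omega
  by_cases hb2 : b = hiIdx i
  · rw [hb2, adjSwap_hiIdx]
    simp only [loIdx, hiIdx, Fin.lt_def, Fin.ext_iff, ne_eq] at *; omega
  rw [adjSwap_of_ne hb1 hb2]

/-- The left ideal of the elements `z` of the group algebra with `z x_a = c_a z` for all
Jucys–Murphy elements `x_a`. -/
def weightSpace (c : Fin m → ℤ) : Submodule ℂ (MonoidAlgebra ℂ (Equiv.Perm (Fin m))) where
  carrier := {z | ∀ a, z * jucysMurphy a = (c a : ℂ) • z}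
  zero_mem' a := by simp
  add_mem' hx hy a := by rw [add_mul, hx, hy, smul_add]
  smul_mem' r x hx a := by rw [smul_mul_assoc, hx, smul_comm]

theorem mul_mem_weightSpace {c : Fin m → ℤ} (g : MonoidAlgebra ℂ (Equiv.Perm (Fin m)))
    {z : MonoidAlgebra ℂ (Equiv.Perm (Fin m))} (hz : z ∈ weightSpace c) :
    g * z ∈ weightSpace c := fun a => by rw [mul_assoc, hz a, mul_smul_comm]

theorem exists_weightIdem (c : Fin m → ℤ) : ∃ p ∈ weightSpace c, groupStar p = p ∧
    ∀ z ∈ weightSpace c, z * p = z :=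
  exists_selfAdjoint_idempotent _ fun _ _ hz => mul_mem_weightSpace _ hz

/-- The self-adjoint idempotent of the group algebra generating the left ideal of the vectors of
weight `c`. -/
def weightIdem (c : Fin m → ℤ) : MonoidAlgebra ℂ (Equiv.Perm (Fin m)) :=
  (exists_weightIdem c).choose

theorem weightIdem_mem (c : Fin m → ℤ) : weightIdem c ∈ weightSpace c :=
  (exists_weightIdem c).choose_spec.1

theorem groupStar_weightIdem (c : Fin m → ℤ) : groupStar (weightIdem c) = weightIdem c :=
  (exists_weightIdem c).choose_spec.2.1

theorem mul_weightIdem {c : Fin m → ℤ} {z : MonoidAlgebra ℂ (Equiv.Perm (Fin m))}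
    (hz : z ∈ weightSpace c) : z * weightIdem c = z :=
  (exists_weightIdem c).choose_spec.2.2 z hz

theorem weightIdem_mul_self (c : Fin m → ℤ) : weightIdem c * weightIdem c = weightIdem c :=
  mul_weightIdem (weightIdem_mem c)

theorem weightIdem_mul_jucysMurphy (c : Fin m → ℤ) (a : Fin m) :
    weightIdem c * jucysMurphy a = (c a : ℂ) • weightIdem c := weightIdem_mem c a

theorem jucysMurphy_mul_weightIdem (c : Fin m → ℤ) (a : Fin m) :
    jucysMurphy a * weightIdem c = (c a : ℂ) • weightIdem c := by
  have h := congrArg groupStar (weightIdem_mul_jucysMurphy c a)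
  rwa [groupStar_mul, groupStar_smul, groupStar_jucysMurphy, groupStar_weightIdem,
    map_intCast] at h

theorem mul_weightIdem_eq_zero {c c' : Fin m → ℤ} (h : c ≠ c')
    {z : MonoidAlgebra ℂ (Equiv.Perm (Fin m))} (hz : z ∈ weightSpace c) :
    z * weightIdem c' = 0 := by
  obtain ⟨a, ha⟩ := Function.ne_iff.1 h
  have h1 : (c a : ℂ) • (z * weightIdem c') = (c' a : ℂ) • (z * weightIdem c') := by
    rw [← smul_mul_assoc, ← hz a, mul_assoc, jucysMurphy_mul_weightIdem, mul_smul_comm]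
  rw [← sub_eq_zero, ← sub_smul, smul_eq_zero, sub_eq_zero] at h1
  exact h1.resolve_left (by exact_mod_cast ha)

/-- The intertwining property of `s_i - (c_{i+1} - c_i)⁻¹`. -/
theorem mul_intertwiner_mem {c : Fin m → ℤ} {z : MonoidAlgebra ℂ (Equiv.Perm (Fin m))}
    (hz : z ∈ weightSpace c) (i : Fin (m - 1)) {d : ℂ} (hd : d ≠ 0)
    (hdc : d = c (hiIdx i) - c (loIdx i)) :
    z * simpleRefl i - d⁻¹ • z ∈ weightSpace (c ∘ adjSwap m i) := by
  intro a
  have hdd : d⁻¹ * d = 1 := inv_mul_cancel₀ hd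
  by_cases h1 : a = loIdx i
  · have e : simpleRefl i * jucysMurphy (loIdx i) = jucysMurphy (hiIdx i) * simpleRefl i - 1 := by
      rw [jucysMurphy_hiIdx_mul, add_sub_cancel_right]
    rw [h1, sub_mul, mul_assoc, e, mul_sub, mul_one, ← mul_assoc, hz, smul_mul_assoc,
      smul_mul_assoc, hz, Function.comp_apply, adjSwap_loIdx]
    have : (c (hiIdx i) : ℂ) = d + c (loIdx i) := by rw [hdc]; ring
    rw [this]
    match_scalars
    · ring
    · linear_combination hdd
  by_cases h2 : a = hiIdx i
  · rw [h2, sub_mul, mul_assoc, simpleRefl_mul_jucysMurphy_hiIdx, mul_add, mul_one, ← mul_assoc,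
      hz, smul_mul_assoc, smul_mul_assoc, hz, Function.comp_apply, adjSwap_hiIdx]
    have : (c (hiIdx i) : ℂ) = d + c (loIdx i) := by rw [hdc]; ring
    rw [this]
    match_scalars
    · ring
    · linear_combination -hdd
  · rw [sub_mul, mul_assoc, simpleRefl_mul_jucysMurphy_of_ne h1 h2, ← mul_assoc, hz,
      smul_mul_assoc, smul_mul_assoc, hz, Function.comp_apply, adjSwap_of_ne h1 h2]
    match_scalars <;> ring

theorem comp_adjSwap_ne {c : Fin m → ℤ} {i : Fin (m - 1)} (h : c (hiIdx i) ≠ c (loIdx i)) :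
    c ≠ c ∘ adjSwap m i := fun h' => h (by
  have := congrFun h' (hiIdx i)
  rwa [Function.comp_apply, adjSwap_hiIdx] at this)

theorem weightIdem_mul_simpleRefl_mul {c : Fin m → ℤ} {i : Fin (m - 1)} {d : ℂ} (hd : d ≠ 0)
    (hdc : d = c (hiIdx i) - c (loIdx i)) :
    weightIdem c * simpleRefl i * weightIdem c = d⁻¹ • weightIdem c := by
  have hc : c (hiIdx i) ≠ c (loIdx i) := by
    rintro h; rw [h, sub_self] at hdc; exact hd hdc
  have h := mul_weightIdem_eq_zero (comp_adjSwap_ne hc).symm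
    (mul_intertwiner_mem (weightIdem_mem c) i hd hdc)
  rwa [sub_mul, smul_mul_assoc, weightIdem_mul_self, sub_eq_zero] at h

/-- If the contents of adjacent letters differ by `±1`, the intertwiner vanishes: it has norm
zero. -/
theorem weightIdem_mul_simpleRefl_of_sq_eq_one {c : Fin m → ℤ} {i : Fin (m - 1)} {d : ℂ}
    (hd : d ^ 2 = 1) (hdr : starRingEnd ℂ d = d) (hdc : d = c (hiIdx i) - c (loIdx i)) :
    weightIdem c * simpleRefl i = d⁻¹ • weightIdem c := by
  have hd0 : d ≠ 0 := by rintro rfl; norm_num at hd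
  have hinv : d⁻¹ = d := inv_eq_of_mul_eq_one_right (by rw [← sq, hd])
  rw [← sub_eq_zero]
  refine eq_zero_of_mul_groupStar_self ?_
  rw [groupStar_sub, groupStar_mul, groupStar_smul, groupStar_simpleRefl, groupStar_weightIdem,
    hinv, hdr]
  have h := weightIdem_mul_simpleRefl_mul hd0 hdc
  rw [hinv] at h
  have h2 : weightIdem c * simpleRefl i * (simpleRefl i * weightIdem c) = weightIdem c := by
    rw [mul_assoc, ← mul_assoc (simpleRefl i), simpleRefl_mul_self, one_mul, weightIdem_mul_self]
  simp only [mul_sub, sub_mul, smul_mul_assoc, mul_smul_comm, h, weightIdem_mul_self,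
    ← mul_assoc]
  rw [← mul_assoc] at h2
  rw [h2, smul_smul, ← sq, hd]
  simp

end JucysMurphy

/-! ### Standard tableaux and adjacent transpositions -/

namespace StandardTableau

variable {μ : YoungDiagram} {m : ℕ}

/-- The row of the box occupied by `a`. -/
def row (T : StandardTableau μ m) (a : Fin m) : ℕ := (T.box a).1.1

/-- The column of the box occupied by `a`. -/
def col (T : StandardTableau μ m) (a : Fin m) : ℕ := (T.box a).1.2

theorem content_eq (T : StandardTableau μ m) (a : Fin m) :
    T.content a = (T.col a : ℤ) - T.row a := rfl

theorem eq_of_row_col {T : StandardTableau μ m} {a b : Fin m} (h1 : T.row a = T.row b)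
    (h2 : T.col a = T.col b) : a = b :=
  T.box.injective (Subtype.ext (Prod.ext h1 h2))

theorem exists_box (T : StandardTableau μ m) {i j : ℕ} (h : (i, j) ∈ μ) :
    ∃ a, T.row a = i ∧ T.col a = j :=
  ⟨T.box.symm ⟨(i, j), (μ.mem_cells _).2 h⟩, by simp [row], by simp [col]⟩

theorem box_mem (T : StandardTableau μ m) (a : Fin m) : (T.row a, T.col a) ∈ μ :=
  (μ.mem_cells _).1 (T.box a).2

theorem exists_box_of_le (T : StandardTableau μ m) {i j : ℕ} (a : Fin m) (hi : i ≤ T.row a)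
    (hj : j ≤ T.col a) : ∃ b, T.row b = i ∧ T.col b = j :=
  T.exists_box (μ.up_left_mem hi hj (T.box_mem a))

theorem le_of_row_le_of_col_le {T : StandardTableau μ m} {a b : Fin m} (h1 : T.row a ≤ T.row b)
    (h2 : T.col a ≤ T.col b) : a ≤ b := by
  obtain ⟨e, he1, he2⟩ := T.exists_box_of_le b h1 le_rfl
  have hae : a ≤ e := by
    rcases (h2.trans_eq he2.symm).eq_or_lt with h | h
    · exact (eq_of_row_col he1.symm h).le
    · exact (T.row_lt _ _ he1.symm h).le
  have heb : e ≤ b := by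
    rcases (he1.trans_le h1).eq_or_lt with h | h
    · exact (eq_of_row_col h he2).le
    · exact (T.col_lt _ _ he2 h).le
  exact hae.trans heb

/-- A standard tableau is determined by the contents of its letters: the letters on a diagonal
increase. -/
theorem content_injective :
    Function.Injective (content : StandardTableau μ m → Fin m → ℤ) := by
  intro T U h
  have key : ∀ n (a : Fin m), a.1 = n → T.box a = U.box a := by
    intro n
    induction n using Nat.strong_induction_on with
    | _ n ih =>
      -- the two boxes of `a` lie on the same diagonal, and the upper one of them would be occupied
      -- by a smaller letter in the other tableau
      have aux : ∀ (T U : StandardTableau μ m), T.content = U.content →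
          (∀ k < n, ∀ a : Fin m, a.1 = k → T.box a = U.box a) → ∀ a : Fin m, a.1 = n →
          ¬ T.row a < U.row a := by
        intro T U h ih a ha hlt
        have hc : T.col a ≤ U.col a := by
          have := congrFun h a
          rw [content_eq, content_eq] at this
          omega
        obtain ⟨b, hb1, hb2⟩ := U.exists_box_of_le a hlt.le hc
        have hba : b ≤ a := le_of_row_le_of_col_le (T := U) (by omega) (by omega)
        have hne : b ≠ a := by rintro rfl; omega
        have hlt' : b.1 < n := by
          have := lt_of_le_of_ne hba hne
          rw [Fin.lt_def] at this
          omega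
        have hbox := ih _ hlt' b rfl
        refine hne (eq_of_row_col (T := T) ?_ ?_)
        · rw [row, hbox]; exact hb1
        · rw [col, hbox]; exact hb2
      intro a ha
      have h1 := aux T U h (fun k hk a ha => ih k hk a ha) a ha
      have h2 := aux U T h.symm (fun k hk a ha => (ih k hk a ha).symm) a ha
      have h3 := congrFun h a
      rw [content_eq, content_eq] at h3
      refine Subtype.ext (Prod.ext ?_ ?_)
      · change T.row a = U.row a
        omega
      · change T.col a = U.col a
        omega
  ext1
  ext a : 1
  exact key _ a rfl

theorem lt_of_adjSwap_lt {i : Fin (m - 1)} {a b : Fin m} (h : adjSwap m i a < adjSwap m i b)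
    (hn : ¬ (adjSwap m i a = loIdx i ∧ adjSwap m i b = hiIdx i)) : a < b := by
  by_cases ha1 : a = loIdx i
  · subst ha1
    rw [adjSwap_loIdx] at h hn
    by_cases hb1 : b = loIdx i
    · subst hb1; rw [adjSwap_loIdx] at h; exact absurd h (lt_irrefl _)
    by_cases hb2 : b = hiIdx i
    · subst hb2; exact loIdx_lt_hiIdx i
    rw [adjSwap_of_ne hb1 hb2] at h
    exact (loIdx_lt_hiIdx i).trans h
  by_cases ha2 : a = hiIdx i
  · subst ha2
    rw [adjSwap_hiIdx] at h hn
    by_cases hb1 : b = loIdx i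
    · subst hb1; exact absurd ⟨rfl, adjSwap_loIdx i⟩ hn
    by_cases hb2 : b = hiIdx i
    · subst hb2; rw [adjSwap_hiIdx] at h; exact absurd h (lt_irrefl _)
    rw [adjSwap_of_ne hb1 hb2] at h
    simp only [loIdx, hiIdx, Fin.lt_def, Fin.ext_iff] at *
    omega
  rw [adjSwap_of_ne ha1 ha2] at h
  by_cases hb1 : b = loIdx i
  · subst hb1
    rw [adjSwap_loIdx] at h
    exact (lt_hiIdx_iff.1 h).resolve_left ha1
  by_cases hb2 : b = hiIdx i
  · subst hb2; rw [adjSwap_hiIdx] at h; exact h.trans (loIdx_lt_hiIdx i)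
  rwa [adjSwap_of_ne hb1 hb2] at h

/-- The difference `c_{i+1} - c_i` of the contents of adjacent letters. -/
def gap (T : StandardTableau μ m) (i : Fin (m - 1)) : ℤ :=
  T.content (hiIdx i) - T.content (loIdx i)

/-- Two adjacent letters which are not in the same row or column may be exchanged. -/
theorem exists_swap (T : StandardTableau μ m) (i : Fin (m - 1))
    (hr : T.row (loIdx i) ≠ T.row (hiIdx i)) (hc : T.col (loIdx i) ≠ T.col (hiIdx i)) :
    ∃ T' : StandardTableau μ m, T'.box = (adjSwap m i).trans T.box := by
  refine ⟨⟨(adjSwap m i).trans T.box, fun a b h1 h2 => ?_, fun a b h1 h2 => ?_⟩, rfl⟩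
  · refine lt_of_adjSwap_lt (T.row_lt _ _ h1 h2) fun h => hr ?_
    rw [← h.1, ← h.2]; exact h1
  · refine lt_of_adjSwap_lt (T.col_lt _ _ h1 h2) fun h => hc ?_
    rw [← h.1, ← h.2]; exact h1

theorem eq_loIdx_or_eq_hiIdx {i : Fin (m - 1)} {e : Fin m} (h1 : loIdx i ≤ e) (h2 : e ≤ hiIdx i) :
    e = loIdx i ∨ e = hiIdx i := by
  simp only [loIdx, hiIdx, Fin.le_def, Fin.ext_iff] at *
  omega

theorem gap_eq_one_of_row_eq {T : StandardTableau μ m} {i : Fin (m - 1)}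
    (hr : T.row (loIdx i) = T.row (hiIdx i)) : T.gap i = 1 := by
  have hlt := loIdx_lt_hiIdx i
  have h1 : T.col (loIdx i) < T.col (hiIdx i) := by
    by_contra h
    exact (le_of_row_le_of_col_le (T := T) hr.ge (not_lt.1 h)).not_gt hlt
  obtain ⟨e, he1, he2⟩ := T.exists_box_of_le (j := T.col (loIdx i) + 1) (hiIdx i) le_rfl
    (by omega)
  rcases eq_loIdx_or_eq_hiIdx (le_of_row_le_of_col_le (T := T) (by omega) (by omega))
    (le_of_row_le_of_col_le (T := T) (a := e) (b := hiIdx i) (by omega) (by omega)) with h | h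
  · rw [h] at he2; omega
  · rw [h] at he2; rw [gap, content_eq, content_eq]; omega

theorem gap_eq_neg_one_of_col_eq {T : StandardTableau μ m} {i : Fin (m - 1)}
    (hc : T.col (loIdx i) = T.col (hiIdx i)) : T.gap i = -1 := by
  have hlt := loIdx_lt_hiIdx i
  have h1 : T.row (loIdx i) < T.row (hiIdx i) := by
    by_contra h
    exact (le_of_row_le_of_col_le (T := T) (not_lt.1 h) hc.ge).not_gt hlt
  obtain ⟨e, he1, he2⟩ := T.exists_box_of_le (i := T.row (loIdx i) + 1) (hiIdx i) (by omega)
    le_rfl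
  rcases eq_loIdx_or_eq_hiIdx (le_of_row_le_of_col_le (T := T) (by omega) (by omega))
    (le_of_row_le_of_col_le (T := T) (a := e) (b := hiIdx i) (by omega) (by omega)) with h | h
  · rw [h] at he1; omega
  · rw [h] at he1; rw [gap, content_eq, content_eq]; omega

theorem two_le_abs_gap {T : StandardTableau μ m} {i : Fin (m - 1)}
    (hr : T.row (loIdx i) ≠ T.row (hiIdx i)) (hc : T.col (loIdx i) ≠ T.col (hiIdx i)) :
    2 ≤ |T.gap i| := by
  have hlt := loIdx_lt_hiIdx i
  have h1 : ¬ (T.row (hiIdx i) ≤ T.row (loIdx i) ∧ T.col (hiIdx i) ≤ T.col (loIdx i)) :=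
    fun h => (le_of_row_le_of_col_le h.1 h.2).not_gt hlt
  -- if the second letter were to the south-east, the box in the corner of the rectangle spanned by
  -- the two boxes would contain a letter between them
  have h2 : ¬ (T.row (loIdx i) < T.row (hiIdx i) ∧ T.col (loIdx i) < T.col (hiIdx i)) := by
    rintro ⟨h, h'⟩
    obtain ⟨e, he1, he2⟩ := T.exists_box_of_le (i := T.row (loIdx i)) (hiIdx i) (by omega) le_rfl
    rcases eq_loIdx_or_eq_hiIdx (le_of_row_le_of_col_le (T := T) (by omega) (by omega))
      (le_of_row_le_of_col_le (T := T) (a := e) (b := hiIdx i) (by omega) (by omega)) with h | h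
    · rw [h] at he2; omega
    · rw [h] at he1; omega
  rw [gap, content_eq, content_eq, le_abs]
  omega

theorem gap_ne_zero (T : StandardTableau μ m) (i : Fin (m - 1)) : T.gap i ≠ 0 := by
  by_cases hr : T.row (loIdx i) = T.row (hiIdx i)
  · rw [gap_eq_one_of_row_eq hr]; decide
  by_cases hc : T.col (loIdx i) = T.col (hiIdx i)
  · rw [gap_eq_neg_one_of_col_eq hc]; decide
  intro h
  have := two_le_abs_gap hr hc
  rw [h] at this
  norm_num at this

/-- Either adjacent letters are neighbours in a row or a column, or they may be exchanged. -/
theorem gap_sq_eq_one_or_exists_swap (T : StandardTableau μ m) (i : Fin (m - 1)) :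
    T.gap i ^ 2 = 1 ∨ 2 ≤ |T.gap i| ∧
      ∃ T' : StandardTableau μ m, T'.box = (adjSwap m i).trans T.box := by
  by_cases hr : T.row (loIdx i) = T.row (hiIdx i)
  · left; rw [gap_eq_one_of_row_eq hr]; rfl
  by_cases hc : T.col (loIdx i) = T.col (hiIdx i)
  · left; rw [gap_eq_neg_one_of_col_eq hc]; rfl
  exact Or.inr ⟨two_le_abs_gap hr hc, T.exists_swap i hr hc⟩

theorem content_of_box_eq {T T' : StandardTableau μ m} {i : Fin (m - 1)}
    (h : T'.box = (adjSwap m i).trans T.box) : T'.content = T.content ∘ adjSwap m i := by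
  ext a
  rw [content, h]
  rfl

theorem box_eq_symm {T T' : StandardTableau μ m} {i : Fin (m - 1)}
    (h : T'.box = (adjSwap m i).trans T.box) : T.box = (adjSwap m i).trans T'.box := by
  ext1 a
  rw [h, Equiv.trans_apply, Equiv.trans_apply, adjSwap_adjSwap]

theorem gap_of_box_eq {T T' : StandardTableau μ m} {i : Fin (m - 1)}
    (h : T'.box = (adjSwap m i).trans T.box) : T'.gap i = -T.gap i := by
  rw [gap, content_of_box_eq h, Function.comp_apply, Function.comp_apply, adjSwap_loIdx,
    adjSwap_hiIdx, gap]
  ring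

/-- The permutation `w` with `T = U ∘ w` as fillings. -/
def relPerm (U T : StandardTableau μ m) : Equiv.Perm (Fin m) := T.box.trans U.box.symm

theorem relPerm_self (U : StandardTableau μ m) : relPerm U U = 1 := Equiv.self_trans_symm _

theorem relPerm_of_box_eq (U : StandardTableau μ m) {T T' : StandardTableau μ m}
    {i : Fin (m - 1)} (h : T'.box = (adjSwap m i).trans T.box) :
    relPerm U T' = relPerm U T * adjSwap m i := by
  rw [relPerm, h]
  rfl

end StandardTableau

/-! ### Word length in the symmetric group -/

section WordLength

variable {m : ℕ}

/-- The least length of a word in the adjacent transpositions with product `s`. -/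
def wordLength (s : Equiv.Perm (Fin m)) : ℕ :=
  sInf {n | ∃ w : List (Fin (m - 1)), w.length = n ∧ (w.map (adjSwap m)).prod = s}

theorem wordLength_le (w : List (Fin (m - 1))) : wordLength (w.map (adjSwap m)).prod ≤ w.length :=
  Nat.sInf_le ⟨w, rfl, rfl⟩

theorem exists_word_length_eq (s : Equiv.Perm (Fin m)) :
    ∃ w : List (Fin (m - 1)), w.length = wordLength s ∧ (w.map (adjSwap m)).prod = s :=
  Nat.sInf_mem (s := {n | ∃ w : List (Fin (m - 1)), w.length = n ∧ (w.map (adjSwap m)).prod = s})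
    (let ⟨w, hw⟩ := exists_adjWord s; ⟨w.length, w, rfl, hw⟩)

theorem wordLength_mul_adjSwap_le (s : Equiv.Perm (Fin m)) (i : Fin (m - 1)) :
    wordLength (s * adjSwap m i) ≤ wordLength s + 1 := by
  obtain ⟨w, h1, h2⟩ := exists_word_length_eq s
  have := wordLength_le (w ++ [i])
  simpa [h1, h2] using this

theorem sign_eq_neg_one_pow_wordLength (s : Equiv.Perm (Fin m)) :
    Equiv.Perm.sign s = (-1) ^ wordLength s := by
  obtain ⟨w, h1, h2⟩ := exists_word_length_eq s
  have h : ∀ w : List (Fin (m - 1)),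
      Equiv.Perm.sign (w.map (adjSwap m)).prod = (-1) ^ w.length := by
    intro w
    induction w with
    | nil => simp
    | cons i w ih =>
      rw [List.map_cons, List.prod_cons, map_mul, ih, adjSwap_eq,
        Equiv.Perm.sign_swap (loIdx_lt_hiIdx i).ne, List.length_cons, pow_succ']
  rw [← h1, ← h w, h2]

theorem wordLength_mul_adjSwap_ne (s : Equiv.Perm (Fin m)) (i : Fin (m - 1)) :
    wordLength (s * adjSwap m i) ≠ wordLength s := by
  intro h
  have h1 := sign_eq_neg_one_pow_wordLength (s * adjSwap m i)
  rw [h, ← sign_eq_neg_one_pow_wordLength, map_mul, adjSwap_eq,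
    Equiv.Perm.sign_swap (loIdx_lt_hiIdx i).ne] at h1
  rcases Int.units_eq_one_or (Equiv.Perm.sign s) with h2 | h2 <;> rw [h2] at h1 <;>
    exact absurd h1 (by decide)

end WordLength

/-! ### Young's orthonormal basis inside the group algebra -/

namespace StandardTableau

variable {μ : YoungDiagram} {m : ℕ}

open MonoidAlgebra

/-- The self-adjoint idempotent generating the left ideal of the vectors whose weight is the
sequence of contents of `T`. -/
def idem (T : StandardTableau μ m) : MonoidAlgebra ℂ (Equiv.Perm (Fin m)) := weightIdem T.content

theorem mul_idem_eq_zero {T T' : StandardTableau μ m} (h : T ≠ T')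
    {z : MonoidAlgebra ℂ (Equiv.Perm (Fin m))} (hz : z ∈ weightSpace T.content) :
    z * T'.idem = 0 :=
  mul_weightIdem_eq_zero (fun h' => h (content_injective h')) hz

theorem idem_mul_idem (T : StandardTableau μ m) : T.idem * T.idem = T.idem :=
  weightIdem_mul_self _

theorem gap_cast (T : StandardTableau μ m) (i : Fin (m - 1)) :
    ((T.gap i : ℤ) : ℂ) = T.content (hiIdx i) - T.content (loIdx i) := by
  rw [gap]; push_cast; rfl

theorem gap_cast_ne_zero (T : StandardTableau μ m) (i : Fin (m - 1)) :
    ((T.gap i : ℤ) : ℂ) ≠ 0 := by exact_mod_cast T.gap_ne_zero i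

theorem ne_of_box_eq {T T' : StandardTableau μ m} {i : Fin (m - 1)}
    (h : T'.box = (adjSwap m i).trans T.box) : T ≠ T' := by
  rintro rfl
  have := gap_of_box_eq h
  have := T.gap_ne_zero i
  omega

theorem idem_mul_simpleRefl_of_sq (T : StandardTableau μ m) {i : Fin (m - 1)}
    (h : T.gap i ^ 2 = 1) : T.idem * simpleRefl i = (T.gap i : ℂ)⁻¹ • T.idem :=
  weightIdem_mul_simpleRefl_of_sq_eq_one (by exact_mod_cast h) (map_intCast _ _) (T.gap_cast i)

theorem simpleRefl_mul_idem_of_sq (T : StandardTableau μ m) {i : Fin (m - 1)}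
    (h : T.gap i ^ 2 = 1) : simpleRefl i * T.idem = (T.gap i : ℂ)⁻¹ • T.idem := by
  have := congrArg groupStar (T.idem_mul_simpleRefl_of_sq h)
  rwa [groupStar_mul, groupStar_simpleRefl, groupStar_smul, idem, groupStar_weightIdem, map_inv₀,
    map_intCast] at this

theorem mul_simpleRefl_sub_mem {T T' : StandardTableau μ m} {i : Fin (m - 1)}
    (h : T'.box = (adjSwap m i).trans T.box) {z : MonoidAlgebra ℂ (Equiv.Perm (Fin m))}
    (hz : z ∈ weightSpace T.content) :
    z * simpleRefl i - (T.gap i : ℂ)⁻¹ • z ∈ weightSpace T'.content := by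
  rw [content_of_box_eq h]
  exact mul_intertwiner_mem hz i (T.gap_cast_ne_zero i) (T.gap_cast i)

theorem simpleRefl_mul_idem {T T' : StandardTableau μ m} {i : Fin (m - 1)}
    (h : T'.box = (adjSwap m i).trans T.box) :
    simpleRefl i * T.idem = (T.gap i : ℂ)⁻¹ • T.idem +
      T'.idem * (simpleRefl i * T.idem - (T.gap i : ℂ)⁻¹ • T.idem) := by
  have h1 := congrArg groupStar
    (mul_weightIdem (mul_simpleRefl_sub_mem h (weightIdem_mem T.content)))
  simp only [groupStar_mul, groupStar_sub, groupStar_smul, groupStar_simpleRefl,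
    groupStar_weightIdem, map_inv₀, map_intCast] at h1
  simp only [idem]
  rw [h1]
  abel

theorem idem_mul_simpleRefl {T T' : StandardTableau μ m} {i : Fin (m - 1)}
    (h : T'.box = (adjSwap m i).trans T.box) :
    T.idem * simpleRefl i = (T.gap i : ℂ)⁻¹ • T.idem +
      (simpleRefl i * T'.idem + (T.gap i : ℂ)⁻¹ • T'.idem) := by
  have h1 := mul_weightIdem (mul_simpleRefl_sub_mem h (weightIdem_mem T.content))
  have h2 := simpleRefl_mul_idem (box_eq_symm h)
  have h3 : T.idem * T'.idem = 0 := mul_idem_eq_zero (ne_of_box_eq h) (weightIdem_mem _)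
  change (T.idem * simpleRefl i - (T.gap i : ℂ)⁻¹ • T.idem) * T'.idem =
    T.idem * simpleRefl i - (T.gap i : ℂ)⁻¹ • T.idem at h1
  rw [gap_of_box_eq h, Int.cast_neg, inv_neg, neg_smul, mul_sub, mul_neg, mul_smul_comm, h3] at h2
  rw [sub_mul, smul_mul_assoc, h3, smul_zero, sub_zero, mul_assoc] at h1
  rw [smul_zero, neg_zero, sub_zero, h1] at h2
  rw [h2]
  abel

/-- A word shorter than the permutation relating `U` and `T` has no component from `U` to `T`. -/
theorem idem_mul_word_mul_idem_eq_zero (U : StandardTableau μ m) (w : List (Fin (m - 1))) :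
    ∀ T : StandardTableau μ m, w.length < wordLength (relPerm U T) →
      U.idem * of ℂ _ (w.map (adjSwap m)).prod * T.idem = 0 := by
  induction w using List.reverseRecOn with
  | nil =>
    intro T hT
    rw [List.map_nil, List.prod_nil, map_one, mul_one]
    refine mul_idem_eq_zero ?_ (weightIdem_mem _)
    rintro rfl
    have := wordLength_le ([] : List (Fin (m - 1)))
    rw [relPerm_self] at hT
    simp at this hT
    omega
  | append_singleton w i ih =>
    intro T hT
    rw [List.length_append, List.length_singleton] at hT
    rw [List.map_append, List.prod_append, List.map_singleton, List.prod_singleton, map_mul]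
    change U.idem * (_ * simpleRefl i) * T.idem = 0
    rw [mul_assoc, mul_assoc, ← mul_assoc]
    rcases T.gap_sq_eq_one_or_exists_swap i with h | ⟨-, T', h⟩
    · rw [simpleRefl_mul_idem_of_sq T h, mul_smul_comm, ih T (by omega), smul_zero]
    · have h' := wordLength_mul_adjSwap_le (relPerm U T') i
      rw [← relPerm_of_box_eq U (box_eq_symm h)] at h'
      rw [simpleRefl_mul_idem h, mul_add, mul_smul_comm, ih T (by omega), ← mul_assoc,
        ih T' (by omega), smul_zero, zero_mul, add_zero]

/-- The vector `p_U w p_T`, where `T = U ∘ w`, of Young's seminormal basis. -/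
def seminormal (U T : StandardTableau μ m) : MonoidAlgebra ℂ (Equiv.Perm (Fin m)) :=
  U.idem * of ℂ _ (relPerm U T) * T.idem

theorem seminormal_mem (U T : StandardTableau μ m) : seminormal U T ∈ weightSpace T.content :=
  mul_mem_weightSpace _ (weightIdem_mem _)

theorem seminormal_self (U : StandardTableau μ m) : seminormal U U = U.idem := by
  rw [seminormal, relPerm_self, map_one, mul_one, idem_mul_idem]

theorem seminormal_mul_of_sq (U T : StandardTableau μ m) {i : Fin (m - 1)}
    (h : T.gap i ^ 2 = 1) :
    seminormal U T * simpleRefl i = (T.gap i : ℂ)⁻¹ • seminormal U T := by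
  rw [seminormal, mul_assoc, idem_mul_simpleRefl_of_sq T h, mul_smul_comm]

theorem seminormal_mul (U : StandardTableau μ m) {T T' : StandardTableau μ m} {i : Fin (m - 1)}
    (h : T'.box = (adjSwap m i).trans T.box)
    (hlt : wordLength (relPerm U T) < wordLength (relPerm U T')) :
    seminormal U T * simpleRefl i = (T.gap i : ℂ)⁻¹ • seminormal U T + seminormal U T' := by
  obtain ⟨w, hw, hw'⟩ := exists_word_length_eq (relPerm U T)
  have h0 := idem_mul_word_mul_idem_eq_zero U w T' (by omega)
  rw [hw'] at h0
  rw [seminormal, mul_assoc, idem_mul_simpleRefl h, mul_add, mul_add, mul_smul_comm,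
    mul_smul_comm, h0, smul_zero, add_zero, seminormal, relPerm_of_box_eq U h, map_mul]
  simp only [mul_assoc]
  rfl

theorem seminormal_mul_down (U : StandardTableau μ m) {T T' : StandardTableau μ m}
    {i : Fin (m - 1)} (h : T'.box = (adjSwap m i).trans T.box)
    (hlt : wordLength (relPerm U T') < wordLength (relPerm U T)) :
    seminormal U T * simpleRefl i = (T.gap i : ℂ)⁻¹ • seminormal U T +
      (1 - ((T.gap i : ℂ) ^ 2)⁻¹) • seminormal U T' := by
  have h1 := seminormal_mul U (box_eq_symm h) hlt
  rw [gap_of_box_eq h, Int.cast_neg, inv_neg, neg_smul] at h1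
  have h2 : seminormal U T = seminormal U T' * simpleRefl i +
      (T.gap i : ℂ)⁻¹ • seminormal U T' := by rw [h1]; abel
  conv_lhs => rw [h2]
  rw [add_mul, mul_assoc, simpleRefl_mul_self, mul_one, smul_mul_assoc, h1]
  match_scalars
  · ring
  · ring

theorem sqNorm_seminormal (U : StandardTableau μ m) {T T' : StandardTableau μ m}
    {i : Fin (m - 1)} (h : T'.box = (adjSwap m i).trans T.box)
    (hlt : wordLength (relPerm U T) < wordLength (relPerm U T')) :
    sqNorm (seminormal U T') = (1 - 1 / (T.gap i : ℝ) ^ 2) * sqNorm (seminormal U T) := by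
  have h1 := seminormal_mul U h hlt
  set y := seminormal U T with hy
  set y' := seminormal U T' with hy'
  have h0 : y' * groupStar y = 0 := by
    have h2 := congrArg groupStar (mul_weightIdem (seminormal_mem U T))
    rw [groupStar_mul, groupStar_weightIdem] at h2
    change T.idem * groupStar y = groupStar y at h2
    rw [← h2, ← mul_assoc, mul_idem_eq_zero (ne_of_box_eq h).symm (seminormal_mem U T'), zero_mul]
  have h2 : y' = y * simpleRefl i - (T.gap i : ℂ)⁻¹ • y := by rw [h1]; abel
  have h3 : y * simpleRefl i * groupStar y = (T.gap i : ℂ)⁻¹ • (y * groupStar y) := by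
    rw [h1, add_mul, h0, add_zero, smul_mul_assoc]
  have h4 : y * simpleRefl i * (simpleRefl i * groupStar y) = y * groupStar y := by
    rw [mul_assoc, ← mul_assoc (simpleRefl i), simpleRefl_mul_self, one_mul]
  have h5 : y' * groupStar y' = (1 - 1 / (T.gap i : ℂ) ^ 2) • (y * groupStar y) := by
    rw [h2, groupStar_sub, groupStar_mul, groupStar_smul, groupStar_simpleRefl, map_inv₀,
      map_intCast]
    simp only [mul_sub, sub_mul, smul_mul_assoc, mul_smul_comm, h3, ← mul_assoc]
    rw [← mul_assoc] at h4
    rw [h4]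
    match_scalars
    ring
  have h6 := congrArg (fun z : MonoidAlgebra ℂ (Equiv.Perm (Fin m)) => z.coeff 1) h5
  simp only [coeff_smul_apply, coeff_mul_groupStar_self, smul_eq_mul] at h6
  exact_mod_cast h6

/-- The vectors of Young's orthonormal basis. They vanish if the seminormal vectors do. -/
def orthonormal (U T : StandardTableau μ m) : MonoidAlgebra ℂ (Equiv.Perm (Fin m)) :=
  (((Real.sqrt (sqNorm (seminormal U T)))⁻¹ : ℝ) : ℂ) • seminormal U T

theorem one_sub_pos {T : StandardTableau μ m} {i : Fin (m - 1)} (h : 2 ≤ |T.gap i|) :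
    0 < 1 - 1 / (T.gap i : ℝ) ^ 2 := by
  have h1 : (2 : ℝ) ≤ |(T.gap i : ℝ)| := by exact_mod_cast h
  have h2 : (1 : ℝ) < (T.gap i : ℝ) ^ 2 := by
    rw [← sq_abs]; nlinarith
  rw [sub_pos, div_lt_one (by positivity)]
  exact h2

theorem orthonormal_mul_of_swap (U : StandardTableau μ m) {T T' : StandardTableau μ m}
    {i : Fin (m - 1)} (h : T'.box = (adjSwap m i).trans T.box) (hg : 2 ≤ |T.gap i|) :
    orthonormal U T * simpleRefl i = (T.gap i : ℂ)⁻¹ • orthonormal U T +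
      ((Real.sqrt (1 - 1 / (T.gap i : ℝ) ^ 2) : ℝ) : ℂ) • orthonormal U T' := by
  have hpos := one_sub_pos hg
  set r := 1 - 1 / (T.gap i : ℝ) ^ 2 with hr
  have hsr : 0 < Real.sqrt r := Real.sqrt_pos.2 hpos
  have hne : wordLength (relPerm U T') ≠ wordLength (relPerm U T) := by
    rw [relPerm_of_box_eq U h]; exact wordLength_mul_adjSwap_ne _ _
  rcases lt_or_gt_of_ne hne with hlt | hlt
  · have h1 := sqNorm_seminormal U (box_eq_symm h) hlt
    rw [gap_of_box_eq h, Int.cast_neg, neg_sq, ← hr] at h1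
    have hrc : (1 - ((T.gap i : ℂ) ^ 2)⁻¹) = ((Real.sqrt r : ℝ) : ℂ) * ((Real.sqrt r : ℝ) : ℂ) := by
      rw [← Complex.ofReal_mul, Real.mul_self_sqrt hpos.le, hr]; push_cast; ring
    have h2 : (Real.sqrt (sqNorm (seminormal U T)))⁻¹ * Real.sqrt r =
        (Real.sqrt (sqNorm (seminormal U T')))⁻¹ := by
      rw [h1, Real.sqrt_mul hpos.le, mul_inv, mul_comm, ← mul_assoc, mul_inv_cancel₀ hsr.ne',
        one_mul]
    rw [orthonormal, smul_mul_assoc, seminormal_mul_down U h hlt, orthonormal, ← h2, hrc]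
    push_cast
    module
  · have h1 := sqNorm_seminormal U h hlt
    rw [← hr] at h1
    have h2 : (Real.sqrt (sqNorm (seminormal U T)))⁻¹ =
        Real.sqrt r * (Real.sqrt (sqNorm (seminormal U T')))⁻¹ := by
      rw [h1, Real.sqrt_mul hpos.le, mul_inv, ← mul_assoc, mul_inv_cancel₀ hsr.ne', one_mul]
    rw [orthonormal, smul_mul_assoc, seminormal_mul U h hlt, smul_add, smul_comm,
      orthonormal, smul_smul, smul_smul, ← Complex.ofReal_mul, ← h2]

theorem youngSwapMatrix_apply (i : Fin (m - 1)) (T T' : StandardTableau μ m) :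
    youngSwapMatrix μ i T T' = if T = T' then (((1 / (T'.gap i : ℝ) : ℝ)) : ℂ)
      else if T.box = (adjSwap m i).trans T'.box then
        ((Real.sqrt (1 - 1 / (T'.gap i : ℝ) ^ 2) : ℝ) : ℂ) else 0 := by
  have h : (T'.gap i : ℝ) =
      (T'.content ⟨i + 1, by omega⟩ : ℝ) - (T'.content ⟨i, by omega⟩ : ℝ) := by
    rw [gap]; push_cast; rfl
  rw [h]
  rfl

/-- Young's orthonormal form. -/
theorem orthonormal_mul (U T : StandardTableau μ m) (i : Fin (m - 1)) :
    orthonormal U T * simpleRefl i =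
      ∑ T' : StandardTableau μ m, youngSwapMatrix μ i T T' • orthonormal U T' := by
  rcases T.gap_sq_eq_one_or_exists_swap i with h | ⟨hg, T', h⟩
  · rw [Finset.sum_eq_single T]
    · rw [youngSwapMatrix_apply, if_pos rfl, orthonormal, smul_mul_assoc,
        seminormal_mul_of_sq U T h, smul_comm]
      push_cast
      rw [one_div]
    · intro T' _ hT'
      rw [youngSwapMatrix_apply, if_neg hT'.symm]
      split_ifs with h'
      · have h1 : (T'.gap i : ℝ) ^ 2 = 1 := by
          rw [gap_of_box_eq h', neg_sq] at h
          exact_mod_cast h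
        rw [h1]
        simp
      · rw [zero_smul]
    · simp
  · have hne := ne_of_box_eq h
    rw [orthonormal_mul_of_swap U h hg, Finset.sum_eq_add T T' hne]
    · rw [youngSwapMatrix_apply, youngSwapMatrix_apply, if_pos rfl, if_neg hne,
        if_pos (box_eq_symm h), gap_of_box_eq h, Int.cast_neg, neg_sq]
      push_cast
      rw [one_div, one_div]
    · rintro T'' - ⟨h1, h2⟩
      rw [youngSwapMatrix_apply, if_neg h1.symm, if_neg, zero_smul]
      intro h3
      refine h2 (StandardTableau.ext ?_)
      rw [h, box_eq_symm h3]
    · simp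
    · simp

theorem orthonormal_mul_word (U T : StandardTableau μ m) (w : List (Fin (m - 1))) :
    orthonormal U T * of ℂ _ (w.map (adjSwap m)).prod =
      ∑ T' : StandardTableau μ m, (w.map (youngSwapMatrix μ)).prod T T' • orthonormal U T' := by
  induction w generalizing T with
  | nil =>
    rw [List.map_nil, List.prod_nil, List.map_nil, List.prod_nil, map_one, mul_one,
      Finset.sum_eq_single T]
    · simp
    · intro T' _ h
      rw [Matrix.one_apply_ne h.symm, zero_smul]
    · simp
  | cons i w ih =>
    rw [List.map_cons, List.prod_cons, List.map_cons, List.prod_cons, map_mul, ← mul_assoc]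
    change orthonormal U T * simpleRefl i * _ = _
    rw [orthonormal_mul, Finset.sum_mul]
    simp only [smul_mul_assoc, ih, Matrix.mul_apply, Finset.sum_smul, Finset.smul_sum, smul_smul]
    rw [Finset.sum_comm]

theorem idem_mul_of_mul_idem (U : StandardTableau μ m) (s : Equiv.Perm (Fin m)) :
    U.idem * of ℂ _ s * U.idem = youngMatrix μ s U U • U.idem := by
  by_cases h0 : U.idem = 0
  · rw [h0]; simp
  have h := congrArg (· * U.idem) (orthonormal_mul_word U U (adjWord s))
  have hs : ((adjWord s).map (adjSwap m)).prod = s := (exists_adjWord s).choose_spec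
  simp only [hs, Finset.sum_mul, smul_mul_assoc] at h
  rw [Finset.sum_eq_single U] at h
  · simp only [orthonormal, seminormal_self, smul_mul_assoc, idem_mul_idem] at h
    rw [smul_comm] at h
    have hn : (((Real.sqrt (sqNorm U.idem))⁻¹ : ℝ) : ℂ) ≠ 0 := by
      rw [Ne, Complex.ofReal_eq_zero, inv_eq_zero, Real.sqrt_eq_zero (sqNorm_nonneg _)]
      exact fun h => h0 (eq_zero_of_sqNorm_eq_zero h)
    exact smul_right_injective _ hn h
  · intro T _ hT
    rw [orthonormal, smul_mul_assoc, mul_idem_eq_zero hT (seminormal_mem U T), smul_zero, smul_zero]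
  · simp

/-- If the content sequence of `U` is a weight of the group algebra, then the primitive idempotent
`e_U` is a multiple of the projection `p_U` onto the vectors of this weight. -/
theorem exists_youngIdempotent_eq_smul (U : StandardTableau μ m) (h0 : U.idem ≠ 0) :
    ∃ κ : ℂ, youngIdempotent U = κ • U.idem := by
  have hτ : U.idem.coeff 1 ≠ 0 := by
    intro h
    refine h0 (eq_zero_of_sqNorm_eq_zero ?_)
    have h1 := coeff_mul_groupStar_self U.idem
    have h2 : groupStar U.idem = U.idem := groupStar_weightIdem _
    rw [h2, idem_mul_idem, h] at h1
    exact_mod_cast h1.symm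
  have key : ∀ s, U.idem.coeff s = youngMatrix μ s⁻¹ U U * U.idem.coeff 1 := by
    intro s
    have h := congrArg (fun z : MonoidAlgebra ℂ (Equiv.Perm (Fin m)) => z.coeff 1)
      (idem_mul_of_mul_idem U s⁻¹)
    simp only [coeff_smul_apply, smul_eq_mul] at h
    rw [← h, coeff_mul_comm, ← mul_assoc, idem_mul_idem, coeff_mul_comm, of_apply,
      coeff_single_mul_apply]
    simp
  refine ⟨(Fintype.card (StandardTableau μ m) : ℂ) / (m.factorial : ℂ) * (U.idem.coeff 1)⁻¹, ?_⟩
  ext s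
  rw [coeff_smul_apply, key s, youngIdempotent, coeff_sum, Finsupp.finsetSum_apply,
    Finset.sum_eq_single s]
  · rw [coeff_single, Finsupp.single_eq_same, smul_eq_mul]
    field_simp
  · intro t _ ht
    rw [coeff_single, Finsupp.single_eq_of_ne ht.symm]
  · simp

end StandardTableau

/-! ### Young symmetrizers are weight vectors -/

namespace StandardTableau

variable {μ : YoungDiagram} {m : ℕ}

open MonoidAlgebra

/-- The permutations preserving the rows of `T`. -/
def rowStab (T : StandardTableau μ m) : Finset (Equiv.Perm (Fin m)) :=
  Finset.univ.filter fun p => ∀ a, T.row (p a) = T.row a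

/-- The permutations preserving the columns of `T`. -/
def colStab (T : StandardTableau μ m) : Finset (Equiv.Perm (Fin m)) :=
  Finset.univ.filter fun p => ∀ a, T.col (p a) = T.col a

theorem mem_rowStab {T : StandardTableau μ m} {p : Equiv.Perm (Fin m)} :
    p ∈ T.rowStab ↔ ∀ a, T.row (p a) = T.row a := by simp [rowStab]

theorem mem_colStab {T : StandardTableau μ m} {p : Equiv.Perm (Fin m)} :
    p ∈ T.colStab ↔ ∀ a, T.col (p a) = T.col a := by simp [colStab]

/-- The antisymmetrizer of the columns of `T`. -/
def colAntisymmetrizer (T : StandardTableau μ m) : MonoidAlgebra ℂ (Equiv.Perm (Fin m)) :=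
  ∑ q ∈ T.colStab, ((Equiv.Perm.sign q : ℤ) : ℂ) • of ℂ _ q

/-- The symmetrizer of the rows of `T`. -/
def rowSymmetrizer (T : StandardTableau μ m) : MonoidAlgebra ℂ (Equiv.Perm (Fin m)) :=
  ∑ p ∈ T.rowStab, of ℂ _ p

/-- The Young symmetrizer of `T`. -/
def youngSymmetrizer (T : StandardTableau μ m) : MonoidAlgebra ℂ (Equiv.Perm (Fin m)) :=
  T.colAntisymmetrizer * T.rowSymmetrizer

theorem swap_mem_rowStab {T : StandardTableau μ m} {a b : Fin m} (h : T.row a = T.row b) :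
    Equiv.swap a b ∈ T.rowStab := by
  refine mem_rowStab.2 fun e => ?_
  rw [Equiv.swap_apply_def]
  split_ifs with h1 h2
  · rw [h1, h]
  · rw [h2, h]
  · rfl

theorem swap_mem_colStab {T : StandardTableau μ m} {a b : Fin m} (h : T.col a = T.col b) :
    Equiv.swap a b ∈ T.colStab := by
  refine mem_colStab.2 fun e => ?_
  rw [Equiv.swap_apply_def]
  split_ifs with h1 h2
  · rw [h1, h]
  · rw [h2, h]
  · rfl

theorem mul_mem_rowStab {T : StandardTableau μ m} {p q : Equiv.Perm (Fin m)}
    (hp : p ∈ T.rowStab) (hq : q ∈ T.rowStab) : p * q ∈ T.rowStab :=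
  mem_rowStab.2 fun a => by rw [Equiv.Perm.mul_apply, mem_rowStab.1 hp, mem_rowStab.1 hq]

theorem mul_mem_colStab {T : StandardTableau μ m} {p q : Equiv.Perm (Fin m)}
    (hp : p ∈ T.colStab) (hq : q ∈ T.colStab) : p * q ∈ T.colStab :=
  mem_colStab.2 fun a => by rw [Equiv.Perm.mul_apply, mem_colStab.1 hp, mem_colStab.1 hq]

theorem rowSymmetrizer_mul_swap {T : StandardTableau μ m} {a b : Fin m}
    (h : T.row a = T.row b) : T.rowSymmetrizer * of ℂ _ (Equiv.swap a b) = T.rowSymmetrizer := by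
  rw [rowSymmetrizer, Finset.sum_mul]
  refine Finset.sum_nbij' (· * Equiv.swap a b) (· * Equiv.swap a b) ?_ ?_ ?_ ?_ ?_
  · exact fun p hp => mul_mem_rowStab hp (swap_mem_rowStab h)
  · exact fun p hp => mul_mem_rowStab hp (swap_mem_rowStab h)
  · exact fun p _ => by simp [mul_assoc]
  · exact fun p _ => by simp [mul_assoc]
  · exact fun p _ => (map_mul _ _ _).symm

theorem colAntisymmetrizer_mul_swap {T : StandardTableau μ m} {a b : Fin m} (hab : a ≠ b)
    (h : T.col a = T.col b) :
    T.colAntisymmetrizer * of ℂ _ (Equiv.swap a b) = -T.colAntisymmetrizer := by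
  rw [colAntisymmetrizer, Finset.sum_mul, ← Finset.sum_neg_distrib]
  refine Finset.sum_nbij' (· * Equiv.swap a b) (· * Equiv.swap a b) ?_ ?_ ?_ ?_ ?_
  · exact fun p hp => mul_mem_colStab hp (swap_mem_colStab h)
  · exact fun p hp => mul_mem_colStab hp (swap_mem_colStab h)
  · exact fun p _ => by simp [mul_assoc]
  · exact fun p _ => by simp [mul_assoc]
  · intro p _
    rw [smul_mul_assoc, ← map_mul, Equiv.Perm.sign_mul, Equiv.Perm.sign_swap hab]
    simp

theorem coeff_sum_smul_of {G : Type*} [Monoid G] [DecidableEq G] (s : Finset G) (f : G → ℂ)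
    (g : G) : (∑ q ∈ s, f q • of ℂ G q).coeff g = if g ∈ s then f g else 0 := by
  rw [coeff_sum, Finsupp.finsetSum_apply]
  simp [Finsupp.single_apply]

theorem youngSymmetrizer_ne_zero (T : StandardTableau μ m) : T.youngSymmetrizer ≠ 0 := by
  intro h
  have h1 : T.youngSymmetrizer.coeff 1 = 1 := by
    have hr : T.rowSymmetrizer = ∑ p ∈ T.rowStab, (1 : ℂ) • of ℂ _ p := by
      simp [rowSymmetrizer]
    rw [youngSymmetrizer, coeff_mul_eq_sum, Finset.sum_eq_single 1]
    · rw [colAntisymmetrizer, hr, coeff_sum_smul_of T.colStab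
        (fun q => ((Equiv.Perm.sign q : ℤ) : ℂ)), coeff_sum_smul_of, if_pos, if_pos]
      · simp
      · simp [mem_rowStab]
      · simp [mem_colStab]
    · intro q _ hq
      rw [colAntisymmetrizer, hr, coeff_sum_smul_of T.colStab
        (fun q => ((Equiv.Perm.sign q : ℤ) : ℂ)), coeff_sum_smul_of]
      by_cases hc : q ∈ T.colStab
      · rw [if_neg (c := q⁻¹ * 1 ∈ T.rowStab), mul_zero]
        intro hr
        refine hq (Equiv.ext fun a => eq_of_row_col (T := T) ?_ (mem_colStab.1 hc a))
        have := mem_rowStab.1 hr (q a)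
        simpa using this.symm
      · rw [if_neg hc, zero_mul]
    · simp
  rw [h] at h1
  simp at h1

/-- The Garnir relation: symmetrizing a whole row together with a letter of a lower row gives
zero. -/
theorem youngSymmetrizer_mul_sum_swap (T : StandardTableau μ m) {a : Fin m} {r : ℕ}
    (hr : r < T.row a) :
    T.youngSymmetrizer * ∑ b ∈ Finset.univ.filter (fun b => T.row b = r),
      of ℂ _ (Equiv.swap b a) = -T.youngSymmetrizer := by
  classical
  have hex : ∀ a', ∃ b, T.row a' = T.row a → T.row b = r ∧ T.col b = T.col a' := by
    intro a'
    by_cases h : T.row a' = T.row a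
    · obtain ⟨b, hb⟩ := T.exists_box_of_le (i := r) (j := T.col a') a' (by omega) le_rfl
      exact ⟨b, fun _ => hb⟩
    · exact ⟨a, fun h' => absurd h' h⟩
  choose β hβ using hex
  -- `γ p` is the letter which `p` moves to the box of the row `r` above the box of `p a`
  let γ : Equiv.Perm (Fin m) → Fin m := fun p => p⁻¹ (β (p a))
  have hpγ : ∀ p : Equiv.Perm (Fin m), p (γ p) = β (p a) := fun p => by simp [γ]
  have hγ : ∀ p ∈ T.rowStab, T.row (γ p) = r := fun p hp => by
    rw [← mem_rowStab.1 hp (γ p), hpγ]; exact (hβ _ (mem_rowStab.1 hp a)).1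
  let f : Equiv.Perm (Fin m) → MonoidAlgebra ℂ (Equiv.Perm (Fin m)) := fun g =>
    T.colAntisymmetrizer * of ℂ _ g
  have hf : ∀ p ∈ T.rowStab, ∀ g, f (p * Equiv.swap (γ p) a * g) = -f (p * g) := by
    intro p hp g
    have h := hβ _ (mem_rowStab.1 hp a)
    have hne : β (p a) ≠ p a := by
      intro h'
      rw [h'] at h
      have := mem_rowStab.1 hp a
      omega
    change T.colAntisymmetrizer * _ = -(T.colAntisymmetrizer * _)
    rw [Equiv.mul_swap_eq_swap_mul, hpγ, mul_assoc, map_mul, ← mul_assoc,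
      colAntisymmetrizer_mul_swap hne h.2, neg_mul]
  have hsum : T.youngSymmetrizer * ∑ b ∈ Finset.univ.filter (fun b => T.row b = r),
      of ℂ _ (Equiv.swap b a) = ∑ p ∈ T.rowStab,
        ∑ b ∈ Finset.univ.filter (fun b => T.row b = r), f (p * Equiv.swap b a) := by
    rw [youngSymmetrizer, rowSymmetrizer, mul_assoc, Finset.sum_mul_sum, Finset.mul_sum]
    refine Finset.sum_congr rfl fun p _ => ?_
    rw [Finset.mul_sum]
    refine Finset.sum_congr rfl fun b _ => ?_
    rw [← map_mul]
  have hsplit : ∀ p ∈ T.rowStab, ∑ b ∈ Finset.univ.filter (fun b => T.row b = r),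
      f (p * Equiv.swap b a) = -f p +
        ∑ b ∈ Finset.univ.filter (fun b => T.row b = r ∧ b ≠ γ p), f (p * Equiv.swap b a) := by
    intro p hp
    have h1 : Finset.univ.filter (fun b => T.row b = r) =
        insert (γ p) (Finset.univ.filter (fun b => T.row b = r ∧ b ≠ γ p)) := by
      ext b
      simp only [Finset.mem_filter, Finset.mem_univ, true_and, Finset.mem_insert]
      have := hγ p hp
      constructor
      · intro h; by_cases hb : b = γ p
        · exact Or.inl hb
        · exact Or.inr ⟨h, hb⟩
      · rintro (h | h)
        · rw [h, this]
        · exact h.1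
    rw [h1, Finset.sum_insert (by simp)]
    have := hf p hp 1
    rw [mul_one, mul_one] at this
    rw [this]
  have hzero : ∑ p ∈ T.rowStab, ∑ b ∈ Finset.univ.filter (fun b => T.row b = r ∧ b ≠ γ p),
      f (p * Equiv.swap b a) = 0 := by
    rw [Finset.sum_sigma']
    have hγ' : ∀ p ∈ T.rowStab, ∀ b, T.row b = r → γ (p * Equiv.swap b (γ p)) = b := by
      intro p hp b hb
      have h1 : Equiv.swap b (γ p) a = a := by
        refine Equiv.swap_apply_of_ne_of_ne ?_ ?_
        · rintro rfl; omega
        · intro h; have := hγ p hp; rw [← h] at this; omega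
      change (p * Equiv.swap b (γ p))⁻¹ (β ((p * Equiv.swap b (γ p)) a)) = b
      rw [Equiv.Perm.mul_apply, h1, mul_inv_rev, Equiv.Perm.mul_apply, Equiv.swap_inv]
      change Equiv.swap b (γ p) (γ p) = b
      exact Equiv.swap_apply_right _ _
    refine Finset.sum_involution
      (fun x _ => ⟨x.1 * Equiv.swap x.2 (γ x.1), γ x.1⟩) ?_ ?_ ?_ ?_
    · rintro ⟨p, b⟩ hx
      simp only [Finset.mem_sigma, Finset.mem_filter, Finset.mem_univ, true_and] at hx
      obtain ⟨hp, hb, hbγ⟩ := hx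
      have hba : b ≠ a := by rintro rfl; omega
      have hca : γ p ≠ a := by intro h; have := hγ p hp; rw [h] at this; omega
      have h1 : Equiv.swap b (γ p) * Equiv.swap (γ p) a =
          Equiv.swap (γ p) a * Equiv.swap b a := by
        rw [Equiv.mul_swap_eq_swap_mul, Equiv.swap_apply_right,
          Equiv.swap_apply_of_ne_of_ne hba.symm hca.symm]
        rw [Equiv.mul_swap_eq_swap_mul, Equiv.swap_apply_left,
          Equiv.swap_apply_of_ne_of_ne hbγ.symm hca, Equiv.swap_comm a]
      change f (p * Equiv.swap b a) + f (p * Equiv.swap b (γ p) * Equiv.swap (γ p) a) = 0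
      rw [mul_assoc, h1, ← mul_assoc, hf p hp, add_neg_cancel]
    · rintro ⟨p, b⟩ hx _ h
      simp only [Finset.mem_sigma, Finset.mem_filter, Finset.mem_univ, true_and] at hx
      exact hx.2.2 (by simpa using (Sigma.mk.inj h).2.symm)
    · rintro ⟨p, b⟩ hx
      simp only [Finset.mem_sigma, Finset.mem_filter, Finset.mem_univ, true_and] at hx ⊢
      obtain ⟨hp, hb, hbγ⟩ := hx
      refine ⟨mul_mem_rowStab hp (swap_mem_rowStab (hb.trans (hγ p hp).symm)), hγ p hp, ?_⟩
      rw [hγ' p hp b hb]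
      exact hbγ.symm
    · rintro ⟨p, b⟩ hx
      simp only [Finset.mem_sigma, Finset.mem_filter, Finset.mem_univ, true_and] at hx
      obtain ⟨hp, hb, hbγ⟩ := hx
      simp only [hγ' p hp b hb]
      rw [Equiv.swap_comm (γ p) b, mul_assoc, Equiv.swap_mul_self, mul_one]
  rw [hsum, Finset.sum_congr rfl hsplit, Finset.sum_add_distrib, hzero, add_zero,
    Finset.sum_neg_distrib, youngSymmetrizer, rowSymmetrizer, Finset.mul_sum]

/-- If the rows of `T` are filled one after the other, then the Young symmetrizer of `T` is a vector
whose weight is the sequence of contents: the letters to the left in the same row contribute `1`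
each, the rows above contribute `-1` each. -/
theorem youngSymmetrizer_mem_weightSpace {T : StandardTableau μ m} (hT : Monotone T.row) :
    T.youngSymmetrizer ∈ weightSpace T.content := by
  intro a
  have hmaps : ∀ b ∈ Finset.Iio a, T.row b ∈ Finset.range (T.row a + 1) := fun b hb => by
    rw [Finset.mem_range, Nat.lt_succ_iff]
    exact hT (Finset.mem_Iio.1 hb).le
  rw [jucysMurphy, ← Finset.sum_fiberwise_of_maps_to hmaps, Finset.sum_range_succ, mul_add,
    Finset.mul_sum]
  have h1 : ∀ r ∈ Finset.range (T.row a), T.youngSymmetrizer *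
      ∑ b ∈ Finset.Iio a with T.row b = r, of ℂ _ (Equiv.swap b a) = -T.youngSymmetrizer := by
    intro r hr
    rw [Finset.mem_range] at hr
    rw [← T.youngSymmetrizer_mul_sum_swap hr]
    congr 2
    ext b
    simp only [Finset.mem_filter, Finset.mem_Iio, Finset.mem_univ, true_and, and_iff_right_iff_imp]
    intro hb
    by_contra h
    have := hT (not_lt.1 h)
    omega
  have h2 : (Finset.Iio a).filter (fun b => T.row b = T.row a) =
      Finset.univ.filter (fun b => T.row b = T.row a ∧ T.col b < T.col a) := by
    ext b
    simp only [Finset.mem_filter, Finset.mem_Iio, Finset.mem_univ, true_and]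
    constructor
    · rintro ⟨h, h'⟩
      refine ⟨h', ?_⟩
      by_contra hc
      exact (le_of_row_le_of_col_le (T := T) h'.ge (not_lt.1 hc)).not_gt h
    · rintro ⟨h, h'⟩
      exact ⟨T.row_lt _ _ h h', h⟩
  have h3 : (Finset.univ.filter (fun b => T.row b = T.row a ∧ T.col b < T.col a)).card =
      T.col a := by
    refine Eq.trans ?_ (Finset.card_range (T.col a))
    refine Finset.card_nbij T.col (fun b hb => ?_) (fun b hb b' hb' h => ?_) fun j hj => ?_
    · exact Finset.mem_coe.2 (Finset.mem_range.2 (Finset.mem_filter.1 hb).2.2)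
    · rw [Finset.mem_coe, Finset.mem_filter] at hb hb'
      exact eq_of_row_col (hb.2.1.trans hb'.2.1.symm) h
    · have hj' : j < T.col a := by simpa using hj
      obtain ⟨b, hb1, hb2⟩ := T.exists_box_of_le (j := j) a le_rfl hj'.le
      exact ⟨b, by simp [hb1, hb2, hj'], hb2⟩
  have h4 : ∀ b ∈ Finset.univ.filter (fun b => T.row b = T.row a ∧ T.col b < T.col a),
      T.youngSymmetrizer * of ℂ _ (Equiv.swap b a) = T.youngSymmetrizer := by
    intro b hb
    simp only [Finset.mem_filter, Finset.mem_univ, true_and] at hb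
    rw [youngSymmetrizer, mul_assoc, rowSymmetrizer_mul_swap hb.1]
  rw [Finset.sum_congr rfl h1, h2, Finset.mul_sum, Finset.sum_congr rfl h4, Finset.sum_const,
    Finset.sum_const, h3, Finset.card_range, content_eq, ← Nat.cast_smul_eq_nsmul ℂ,
    ← Nat.cast_smul_eq_nsmul ℂ]
  push_cast
  module

/-! ### Every standard tableau gives a weight -/

/-- The statistic `∑ a, a · row(a)`, which grows when a letter in a higher row is exchanged with the
preceding letter in a lower row. -/
def rowMoment (T : StandardTableau μ m) : ℕ := ∑ a : Fin m, a.1 * T.row a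

theorem rowMoment_lt {T T' : StandardTableau μ m} {i : Fin (m - 1)}
    (h : T'.box = (adjSwap m i).trans T.box) (hr : T.row (hiIdx i) < T.row (loIdx i)) :
    T.rowMoment < T'.rowMoment := by
  have h1 : T'.rowMoment = ∑ a : Fin m, (adjSwap m i a).1 * T.row a := by
    rw [rowMoment]
    refine Fintype.sum_equiv (adjSwap m i) _ _ fun a => ?_
    rw [adjSwap_adjSwap, row, h]
    rfl
  have h2 : ∀ a : Fin m, ((adjSwap m i a).1 * T.row a : ℤ) = a.1 * T.row a +
      ((if a = loIdx i then (T.row (loIdx i) : ℤ) else 0) -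
        (if a = hiIdx i then (T.row (hiIdx i) : ℤ) else 0)) := by
    intro a
    by_cases h1 : a = loIdx i
    · rw [if_pos h1, if_neg (by rw [h1]; exact (loIdx_lt_hiIdx i).ne), h1, adjSwap_loIdx]
      simp only [hiIdx, loIdx]; push_cast; ring
    by_cases h2 : a = hiIdx i
    · rw [if_neg h1, if_pos h2, h2, adjSwap_hiIdx]
      simp only [hiIdx, loIdx]; push_cast; ring
    rw [if_neg h1, if_neg h2, adjSwap_of_ne h1 h2]
    ring
  have h3 : (T'.rowMoment : ℤ) = T.rowMoment + (T.row (loIdx i) - T.row (hiIdx i)) := by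
    rw [h1, rowMoment]
    push_cast
    rw [Finset.sum_congr rfl fun a _ => h2 a, Finset.sum_add_distrib, Finset.sum_sub_distrib]
    simp
  omega

theorem exists_row_hiIdx_lt {T : StandardTableau μ m} (hT : ¬ Monotone T.row) :
    ∃ i : Fin (m - 1), T.row (hiIdx i) < T.row (loIdx i) := by
  by_contra! hn
  refine hT fun a b hab => ?_
  have key : ∀ n (h : a.1 + n < m), T.row a ≤ T.row ⟨a.1 + n, h⟩ := by
    intro n
    induction n with
    | zero => exact fun _ => le_rfl
    | succ n ih =>
      exact fun h => (ih (by omega)).trans (hn ⟨a.1 + n, by omega⟩)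
  have hb : b.1 = a.1 + (b.1 - a.1) := by rw [Fin.le_def] at hab; omega
  have := key (b.1 - a.1) (by rw [← hb]; exact b.2)
  have hb' : b = ⟨a.1 + (b.1 - a.1), by rw [← hb]; exact b.2⟩ := Fin.ext hb
  rwa [← hb'] at this

theorem exists_weight_vector (T : StandardTableau μ m) :
    ∃ z ∈ weightSpace T.content, z ≠ 0 := by
  have key : ∀ n, ∀ T : StandardTableau μ m,
      (Finset.univ : Finset (StandardTableau μ m)).sup rowMoment - T.rowMoment = n →
      ∃ z ∈ weightSpace T.content, z ≠ 0 := by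
    intro n
    induction n using Nat.strong_induction_on with
    | _ n ih =>
      intro T hn
      by_cases hT : Monotone T.row
      · exact ⟨_, youngSymmetrizer_mem_weightSpace hT, T.youngSymmetrizer_ne_zero⟩
      obtain ⟨i, hi⟩ := exists_row_hiIdx_lt hT
      have hc : T.col (loIdx i) ≠ T.col (hiIdx i) := fun hc =>
        (le_of_row_le_of_col_le hi.le hc.ge).not_gt (loIdx_lt_hiIdx i)
      obtain ⟨T', h⟩ := T.exists_swap i hi.ne' hc
      have hlt := rowMoment_lt h hi
      have hle : T'.rowMoment ≤ (Finset.univ : Finset (StandardTableau μ m)).sup rowMoment :=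
        Finset.le_sup (Finset.mem_univ T')
      obtain ⟨z, hz, hz0⟩ := ih _ (by omega) T' rfl
      refine ⟨_, mul_simpleRefl_sub_mem (box_eq_symm h) hz, fun h0 => hz0 ?_⟩
      rw [gap_of_box_eq h] at h0
      have hgap := one_sub_pos (two_le_abs_gap hi.ne' hc)
      -- the product of the two intertwiners is a nonzero scalar
      have h1 : z = ((T.gap i : ℂ) ^ 2)⁻¹ • z := by
        have h2 : z * simpleRefl i = ((-T.gap i : ℤ) : ℂ)⁻¹ • z := sub_eq_zero.1 h0
        have h3 : z * simpleRefl i * simpleRefl i =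
            (((-T.gap i : ℤ) : ℂ)⁻¹ * ((-T.gap i : ℤ) : ℂ)⁻¹) • z := by
          rw [h2, smul_mul_assoc, h2, smul_smul]
        rw [mul_assoc, simpleRefl_mul_self, mul_one] at h3
        conv_lhs => rw [h3]
        congr 1
        push_cast
        rw [← mul_inv]
        congr 1
        ring
      have h4 : (1 - ((T.gap i : ℂ) ^ 2)⁻¹) • z = 0 := by
        rw [sub_smul, one_smul, ← h1, sub_self]
      refine (smul_eq_zero.1 h4).resolve_left fun h5 => hgap.ne' ?_
      have h6 : ((1 - ((T.gap i : ℝ) ^ 2)⁻¹ : ℝ) : ℂ) = 0 := by push_cast; exact h5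
      rw [one_div]
      exact Complex.ofReal_eq_zero.1 h6
  exact key _ T rfl

theorem idem_ne_zero (T : StandardTableau μ m) : T.idem ≠ 0 := by
  obtain ⟨z, hz, hz0⟩ := T.exists_weight_vector
  intro h
  have := mul_weightIdem hz
  rw [idem] at h
  rw [h, mul_zero] at this
  exact hz0 this.symm

end StandardTableau

/-! ### Ordered products and the fusion identities -/

section OrderedProducts

variable {R : Type*} [Monoid R]

/-- The product `f 0 * f 1 * ⋯ * f (n - 1)`. -/
def fwdProd (f : ℕ → R) : ℕ → R
  | 0 => 1
  | n + 1 => fwdProd f n * f n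

/-- The product `f (n - 1) * ⋯ * f 1 * f 0`. -/
def bwdProd (f : ℕ → R) : ℕ → R
  | 0 => 1
  | n + 1 => f n * bwdProd f n

theorem fwdProd_congr {f g : ℕ → R} {n : ℕ} (h : ∀ a < n, f a = g a) :
    fwdProd f n = fwdProd g n := by
  induction n with
  | zero => rfl
  | succ n ih => rw [fwdProd, fwdProd, ih fun a ha => h a (by omega), h n (by omega)]

theorem bwdProd_congr {f g : ℕ → R} {n : ℕ} (h : ∀ a < n, f a = g a) :
    bwdProd f n = bwdProd g n := by
  induction n with
  | zero => rfl
  | succ n ih => rw [bwdProd, bwdProd, ih fun a ha => h a (by omega), h n (by omega)]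

theorem commute_fwdProd {x : R} {f : ℕ → R} {n : ℕ} (h : ∀ a < n, Commute x (f a)) :
    Commute x (fwdProd f n) := by
  induction n with
  | zero => exact Commute.one_right x
  | succ n ih => exact (ih fun a ha => h a (by omega)).mul_right (h n (by omega))

theorem commute_bwdProd {x : R} {f : ℕ → R} {n : ℕ} (h : ∀ a < n, Commute x (f a)) :
    Commute x (bwdProd f n) := by
  induction n with
  | zero => exact Commute.one_right x
  | succ n ih => exact (h n (by omega)).mul_right (ih fun a ha => h a (by omega))

theorem prod_ofFn_eq_fwdProd {m : ℕ} (f : Fin m → R) (g : ℕ → R) (h : ∀ a : Fin m, g a = f a) :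
    (List.ofFn f).prod = fwdProd g m := by
  induction m with
  | zero => simp [fwdProd]
  | succ m ih =>
    rw [List.ofFn_succ', List.concat_eq_append, List.prod_append, List.prod_singleton,
      ih (fun a => f a.castSucc) fun a => h a.castSucc, fwdProd, ← h (Fin.last m)]
    rfl

theorem map_fwdProd {S F : Type*} [Monoid S] [FunLike F R S] [MonoidHomClass F R S] (φ : F)
    (f : ℕ → R) (n : ℕ) : φ (fwdProd f n) = fwdProd (fun a => φ (f a)) n := by
  induction n with
  | zero => exact map_one φ
  | succ n ih => rw [fwdProd, fwdProd, map_mul, ih]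

end OrderedProducts

section Fusion

variable {K R : Type*} [CommRing K] [Ring R] [Algebra K R] {m : ℕ}
  (π : MonoidAlgebra ℂ (Equiv.Perm (Fin m)) →+* R)

/-- The element `Z` of a ring receiving the group algebra satisfies `Z x_a = c_a Z` for the
first `n` Jucys–Murphy elements. -/
def IsWeight (c : Fin m → ℤ) (n : ℕ) (Z : R) : Prop :=
  ∀ a : Fin m, a.1 < n → Z * π (jucysMurphy a) = c a • Z

variable {π} in
theorem IsWeight.mul_right {c : Fin m → ℤ} {n : ℕ} {Z : R} (hZ : IsWeight π c n Z) {x : R}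
    (hx : ∀ a : Fin m, a.1 < n → Commute x (π (jucysMurphy a))) : IsWeight π c n (Z * x) := by
  intro a ha
  rw [mul_assoc, (hx a ha).eq, ← mul_assoc, hZ a ha, smul_mul_assoc]

theorem isWeight_of_mem_weightSpace {c : Fin m → ℤ}
    {z : MonoidAlgebra ℂ (Equiv.Perm (Fin m))} (hz : z ∈ weightSpace c) (n : ℕ) :
    IsWeight π c n (π z) := by
  intro a _
  rw [← map_mul, hz a, Int.cast_smul_eq_zsmul, map_zsmul]

/-- The transposition `(a b)`, in the ring receiving the group algebra. -/
def swapElt (a b : Fin m) : R := π (MonoidAlgebra.of ℂ _ (Equiv.swap a b))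

theorem map_jucysMurphy (a : Fin m) :
    π (jucysMurphy a) = ∑ b ∈ Finset.Iio a, swapElt π b a := map_sum _ _ _

theorem commute_jucysMurphy_of_swap {x : R} {a : Fin m}
    (h : ∀ b < a, Commute x (swapElt π b a)) : Commute x (π (jucysMurphy a)) := by
  rw [map_jucysMurphy]
  exact Commute.sum_right _ _ _ fun b hb => h b (Finset.mem_Iio.1 hb)

/-- Extension by one of a family indexed by `Fin m`. -/
def extendOne (f : Fin m → R) (n : ℕ) : R := if h : n < m then f ⟨n, h⟩ else 1

theorem extendOne_coe (f : Fin m → R) (a : Fin m) : extendOne f a = f a := dif_pos a.2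

theorem extendOne_of_lt (f : Fin m → R) {n : ℕ} (h : n < m) : extendOne f n = f ⟨n, h⟩ := dif_pos h

/-- The set of the first `n` letters. -/
def firstLetters (m n : ℕ) : Finset (Fin m) := Finset.univ.filter fun a => a.1 < n

theorem mem_firstLetters {n : ℕ} {a : Fin m} : a ∈ firstLetters m n ↔ a.1 < n := by
  simp [firstLetters]

theorem firstLetters_eq_Iio (a : Fin m) : firstLetters m a = Finset.Iio a := by
  ext b; rw [mem_firstLetters, Finset.mem_Iio, Fin.lt_def]

theorem firstLetters_succ {n : ℕ} (h : n < m) :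
    firstLetters m (n + 1) = insert ⟨n, h⟩ (firstLetters m n) := by
  ext b
  simp only [mem_firstLetters, Finset.mem_insert, Fin.ext_iff]
  omega

theorem notMem_firstLetters {n : ℕ} (h : n < m) : (⟨n, h⟩ : Fin m) ∉ firstLetters m n := by
  simp [mem_firstLetters]

/-- The Jucys–Murphy form of the fusion product: on a weight vector, the ordered product of the
`R`-matrices attaching a new strand to the strands `n - 1, …, 0` is linear in the sum of the `q_a`,
the transpositions of the new strand with the old ones. The parameters are written
homogeneously: `β_a / α_a = γ / δ - c_a`. -/
theorem IsWeight.mul_bwdProd {c : Fin m → ℤ} {q : Fin m → R} {γ δ : K} {α β : Fin m → K}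
    (hq1 : ∀ a k : Fin m, a < k → q k * q a = swapElt π a k * q k)
    (hq2 : ∀ a b k : Fin m, a < b → b < k → Commute (q k) (swapElt π a b))
    (hα : ∀ a, α a * (γ - c a * δ) = β a * δ) {n : ℕ} (hn : n ≤ m) :
    ∀ Z : R, IsWeight π c n Z →
      γ • (Z * bwdProd (extendOne fun a => β a • (1 : R) - α a • q a) n) =
        (∏ a ∈ firstLetters m n, β a) • (Z * (γ • (1 : R) - δ • ∑ a ∈ firstLetters m n, q a)) := by
  induction n with
  | zero =>
    intro Z _
    simp [bwdProd, firstLetters]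
  | succ n ih =>
    intro Z hZ
    have hnm : n < m := hn
    set k : Fin m := ⟨n, hnm⟩ with hk
    set S : R := ∑ a ∈ firstLetters m n, q a with hS
    have hcomm : ∀ a : Fin m, a.1 < n →
        Commute (β k • (1 : R) - α k • q k) (π (jucysMurphy a)) := by
      intro a ha
      refine Commute.sub_left ((Commute.one_left _).smul_left _) (Commute.smul_left ?_ _)
      exact commute_jucysMurphy_of_swap π fun b hb =>
        hq2 b a k hb (by simpa [hk, Fin.lt_def] using ha)
    have h1 := ih hnm.le (Z * (β k • (1 : R) - α k • q k))
      (IsWeight.mul_right (fun a ha => hZ a (by omega)) hcomm)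
    have hqS : q k * S = π (jucysMurphy k) * q k := by
      rw [hS, Finset.mul_sum, map_jucysMurphy, Finset.sum_mul, ← firstLetters_eq_Iio]
      refine Finset.sum_congr rfl fun a ha => hq1 a k ?_
      exact mem_firstLetters.1 ha
    have hZk : Z * (q k * S) = (c k : K) • (Z * q k) := by
      rw [hqS, ← mul_assoc, hZ k (Nat.lt_succ_self n), Int.cast_smul_eq_zsmul, smul_mul_assoc]
    rw [bwdProd, extendOne_of_lt _ hnm, ← hk, ← mul_assoc, h1, firstLetters_succ hnm,
      Finset.prod_insert (notMem_firstLetters hnm), Finset.sum_insert (notMem_firstLetters hnm),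
      ← hk, ← hS, mul_comm (β k), mul_smul]
    congr 1
    have hα' := hα k
    simp only [mul_sub, sub_mul, mul_add, mul_smul_comm, smul_mul_assoc, mul_one, smul_sub,
      smul_add, mul_assoc, hZk, smul_smul]
    have e : α k * γ = β k * δ + α k * (c k * δ) := by rw [← hα']; ring
    match_scalars
    · ring
    · linear_combination -e
    · ring

/-- Moving the last factor of an ordered product to the front by means of the relations
`y_a ŷ ρ_a = ρ_a ŷ y_a`. -/
theorem fwdProd_mul_bwdProd {y ρ : ℕ → R} {y' : R} {n : ℕ}
    (hρ : ∀ a < n, y a * y' * ρ a = ρ a * y' * y a)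
    (hc : ∀ a < n, ∀ b < n, a ≠ b → Commute (y a) (ρ b)) :
    fwdProd y n * y' * bwdProd ρ n = bwdProd ρ n * y' * fwdProd y n := by
  induction n with
  | zero => simp [fwdProd, bwdProd]
  | succ n ih =>
    have ih' := ih (fun a ha => hρ a (by omega)) fun a ha b hb => hc a (by omega) b (by omega)
    have h1 : Commute (ρ n) (fwdProd y n) := commute_fwdProd fun a ha =>
      (hc a (by omega) n (by omega) (by omega)).symm
    have h2 : Commute (y n) (bwdProd ρ n) := commute_bwdProd fun a ha =>
      hc n (by omega) a (by omega) (by omega)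
    calc fwdProd y n * y n * y' * (ρ n * bwdProd ρ n)
        = fwdProd y n * (y n * y' * ρ n) * bwdProd ρ n := by simp only [mul_assoc]
      _ = (fwdProd y n * ρ n) * y' * (y n * bwdProd ρ n) := by
          rw [hρ n (by omega)]; simp only [mul_assoc]
      _ = ρ n * (fwdProd y n * y' * bwdProd ρ n) * y n := by
          rw [← h1.eq, h2.eq]; simp only [mul_assoc]
      _ = ρ n * bwdProd ρ n * y' * (fwdProd y n * y n) := by
          rw [ih']; simp only [mul_assoc]

/-- The last factor of an ordered product of solutions of the `RTT` relations may be deformed by a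
regular parameter `τ`. Then the product satisfies the last weight condition modulo `τ`. -/
theorem exists_eq_smul_of_rtt {c : Fin m → ℤ} (k : Fin m) {y : ℕ → R} {y' : R} {τ : K}
    (hτ : ∀ (e : ℤ) (x : R), (τ + e) • x = 0 → x = 0)
    (hρ : ∀ a : Fin m, a < k →
      y a * y' * ((τ + (c k - c a : ℤ)) • (1 : R) - swapElt π a k) =
        ((τ + (c k - c a : ℤ)) • (1 : R) - swapElt π a k) * y' * y a)
    (hc : ∀ a b : Fin m, a < k → b < k → a ≠ b → Commute (y a) (swapElt π b k))
    (hc' : ∀ a b : Fin m, a < k → b < k → Commute y' (swapElt π a b))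
    {Z : R} (hZ : IsWeight π c (k.1 + 1) Z) (hW : IsWeight π c k.1 (Z * fwdProd y k)) :
    ∃ H : R, Z * fwdProd y k * y' * (c k • (1 : R) - π (jucysMurphy k)) = τ • H := by
  set v : K := τ + c k with hv
  set ρ : ℕ → R := extendOne fun a : Fin m =>
    (v - c a) • (1 : R) - (1 : K) • swapElt π a k with hρdef
  have hρa : ∀ a : Fin m, ρ a = (τ + (c k - c a : ℤ)) • (1 : R) - swapElt π a k := by
    intro a
    rw [hρdef, extendOne_coe, one_smul, hv]
    congr 2
    push_cast
    ring
  have hlemma : ∀ Z : R, IsWeight π c k.1 Z → v • (Z * bwdProd ρ k) =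
      (∏ a ∈ firstLetters m k, (v - c a)) • (Z * (v • (1 : R) - π (jucysMurphy k))) := by
    intro Z hZ
    -- only the letters below `k` matter, so the exchange relations are completed arbitrarily
    have h := IsWeight.mul_bwdProd (K := K) π (c := c)
      (q := fun a => if a < k then swapElt π a k else 0) (γ := v) (δ := 1) (α := fun _ => 1)
      (β := fun a => v - c a) ?_ ?_ ?_ k.2.le Z hZ
    · have e1 : bwdProd ρ k = bwdProd (extendOne fun a : Fin m =>
          (v - c a) • (1 : R) - (1 : K) • if a < k then swapElt π a k else 0) k := by
        refine bwdProd_congr fun a ha => ?_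
        have ham : a < m := ha.trans k.2
        rw [hρdef, extendOne_of_lt _ ham, extendOne_of_lt _ ham, if_pos (Fin.lt_def.2 ha)]
      have e2 : (∑ a ∈ firstLetters m k, if a < k then swapElt π a k else 0) =
          π (jucysMurphy k) := by
        rw [map_jucysMurphy, firstLetters_eq_Iio]
        exact Finset.sum_congr rfl fun a ha => if_pos (Finset.mem_Iio.1 ha)
      rw [e1, h, e2, one_smul]
    · intro a b hab
      split_ifs with hb ha ha
      · rw [swapElt, swapElt, swapElt, ← map_mul, ← map_mul, ← map_mul, ← map_mul]
        congr 2
        rw [Equiv.mul_swap_eq_swap_mul, Equiv.swap_apply_of_ne_of_ne hab.ne ha.ne,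
          Equiv.swap_apply_right]
      · exact absurd (hab.trans hb) ha
      · simp
      · simp
    · intro a b e hab hbe
      split_ifs with he
      · rw [swapElt, swapElt, commute_iff_eq, ← map_mul, ← map_mul, ← map_mul, ← map_mul]
        congr 2
        rw [Equiv.mul_swap_eq_swap_mul, Equiv.swap_apply_of_ne_of_ne (hab.trans hbe).ne
          ((hab.trans hbe).trans he).ne, Equiv.swap_apply_of_ne_of_ne hbe.ne (hbe.trans he).ne]
      · exact Commute.zero_left _
    · intro a; ring
  have h1 := hlemma _ (hW.mul_right (x := y') fun a ha =>
    commute_jucysMurphy_of_swap π fun b hb =>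
      hc' b a (hb.trans (Fin.lt_def.2 ha)) (Fin.lt_def.2 ha))
  have h2 := hlemma Z fun a ha => hZ a (by omega)
  have h3 : Z * (v • (1 : R) - π (jucysMurphy k)) = τ • Z := by
    rw [mul_sub, hZ k (Nat.lt_succ_self _), mul_smul_comm, mul_one, ← Int.cast_smul_eq_zsmul K,
      ← sub_smul, hv, add_sub_cancel_right]
  have h4 : fwdProd y k * y' * bwdProd ρ k = bwdProd ρ k * y' * fwdProd y k := by
    refine fwdProd_mul_bwdProd (fun a ha => ?_) fun a ha b hb hab => ?_
    · have := hρ ⟨a, ha.trans k.2⟩ (Fin.lt_def.2 ha)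
      rwa [← hρa] at this
    · have := hρa ⟨b, hb.trans k.2⟩
      change ρ b = _ at this
      rw [this]
      refine Commute.sub_right ((Commute.one_right _).smul_right _) ?_
      exact hc ⟨a, ha.trans k.2⟩ ⟨b, hb.trans k.2⟩ (Fin.lt_def.2 ha) (Fin.lt_def.2 hb)
        (by simpa [Fin.ext_iff] using hab)
  have hcancel : ∀ (s : Finset (Fin m)) (x : R), (∏ a ∈ s, (v - (c a : K))) • x = 0 → x = 0 := by
    intro s x
    induction s using Finset.induction_on with
    | empty => simp
    | insert a s ha ih =>
      intro h
      rw [Finset.prod_insert ha, mul_smul] at h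
      refine ih (hτ (c k - c a) _ ?_)
      rw [← h, hv]
      congr 1
      push_cast
      ring
  refine ⟨Z * y' * fwdProd y k - Z * fwdProd y k * y', ?_⟩
  rw [← sub_eq_zero]
  refine hcancel (firstLetters m k) _ ?_
  have h5 : (∏ a ∈ firstLetters m k, (v - (c a : K))) •
      (Z * fwdProd y k * y' * (v • (1 : R) - π (jucysMurphy k))) =
      (∏ a ∈ firstLetters m k, (v - (c a : K))) • τ • (Z * y' * fwdProd y k) := by
    have e : Z * fwdProd y k * y' * bwdProd ρ k = Z * bwdProd ρ k * (y' * fwdProd y k) := by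
      rw [mul_assoc Z, mul_assoc Z, h4]; simp only [mul_assoc]
    rw [← h1, e, ← smul_mul_assoc, h2, h3]
    simp only [smul_mul_assoc, mul_assoc]
  have h6 : Z * fwdProd y k * y' * (v • (1 : R) - π (jucysMurphy k)) =
      Z * fwdProd y k * y' * (c k • (1 : R) - π (jucysMurphy k)) +
        τ • (Z * fwdProd y k * y') := by
    rw [hv, ← Int.cast_smul_eq_zsmul K, add_smul]
    simp only [mul_sub, mul_add, mul_smul_comm, mul_one]
    abel
  rw [h6, smul_add] at h5
  rw [smul_sub, smul_sub, smul_sub, ← h5]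
  abel

end Fusion

/-! ### Matrices over a tensor power -/

section Tensor

variable {N m : ℕ} {S : Type*} [Ring S] [Algebra ℂ S]

/-- The action of the symmetric group on `(ℂ^N)^{⊗ m}`, as a homomorphism of monoids. -/
def permTensorHom (N m : ℕ) :
    Equiv.Perm (Fin m) →* Matrix (Fin m → Fin N) (Fin m → Fin N) ℂ where
  toFun := permTensor N
  map_one' := by
    ext f g
    rw [permTensor, Matrix.of_apply, Matrix.one_apply]
    rfl
  map_mul' s t := by
    ext f g
    simp only [permTensor, Matrix.mul_apply, Matrix.of_apply, mul_ite, mul_one, mul_zero]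
    rw [Finset.sum_eq_single (g ∘ t.symm)]
    · rw [if_pos rfl]; rfl
    · intro h _ hh; rw [if_neg hh]
    · simp

variable (N m S) in
/-- The action of the group algebra on `(ℂ^N)^{⊗ m}`, as matrices over a `ℂ`-algebra. -/
def tensorRep : MonoidAlgebra ℂ (Equiv.Perm (Fin m)) →+*
    Matrix (Fin m → Fin N) (Fin m → Fin N) S :=
  (algebraMap ℂ S).mapMatrix.comp
    (MonoidAlgebra.lift ℂ _ (Equiv.Perm (Fin m)) (permTensorHom N m)).toRingHom

theorem tensorRep_eq (x : MonoidAlgebra ℂ (Equiv.Perm (Fin m))) :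
    tensorRep N m S x = (groupAlgebraTensor N x).map (algebraMap ℂ S) := by
  have : MonoidAlgebra.lift ℂ _ (Equiv.Perm (Fin m)) (permTensorHom N m) x =
      groupAlgebraTensor N x := by
    rw [MonoidAlgebra.lift_apply, Finsupp.sum_fintype _ _ (by simp)]
    rfl
  rw [← this]
  rfl

theorem tensorRep_of (s : Equiv.Perm (Fin m)) :
    tensorRep N m S (MonoidAlgebra.of ℂ _ s) = (permTensor N s).map (algebraMap ℂ S) := by
  change (algebraMap ℂ S).mapMatrix (MonoidAlgebra.lift ℂ _ _ (permTensorHom N m) _) = _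
  rw [MonoidAlgebra.lift_of]
  rfl

theorem tensorRep_map {S' : Type*} [Ring S'] [Algebra ℂ S'] (φ : S →+* S')
    (hφ : ∀ c, φ (algebraMap ℂ S c) = algebraMap ℂ S' c)
    (x : MonoidAlgebra ℂ (Equiv.Perm (Fin m))) :
    φ.mapMatrix (tensorRep N m S x) = tensorRep N m S' x := by
  rw [tensorRep_eq, tensorRep_eq]
  ext f g
  exact hφ _

theorem tensorRep_of_mul_apply (s : Equiv.Perm (Fin m))
    (M : Matrix (Fin m → Fin N) (Fin m → Fin N) S) (f g : Fin m → Fin N) :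
    (tensorRep N m S (MonoidAlgebra.of ℂ _ s) * M) f g = M (f ∘ s) g := by
  rw [tensorRep_of, Matrix.mul_apply, Finset.sum_eq_single (f ∘ s)]
  · have : f = (f ∘ s) ∘ s.symm := by ext a; simp
    rw [Matrix.map_apply, permTensor, Matrix.of_apply, if_pos this, map_one, one_mul]
  · intro h _ hh
    rw [Matrix.map_apply, permTensor, Matrix.of_apply, if_neg, map_zero, zero_mul]
    rintro rfl
    exact hh (by ext a; simp)
  · simp

theorem mul_tensorRep_of_apply (s : Equiv.Perm (Fin m))
    (M : Matrix (Fin m → Fin N) (Fin m → Fin N) S) (f g : Fin m → Fin N) :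
    (M * tensorRep N m S (MonoidAlgebra.of ℂ _ s)) f g = M f (g ∘ s.symm) := by
  rw [tensorRep_of, Matrix.mul_apply, Finset.sum_eq_single (g ∘ s.symm)]
  · rw [Matrix.map_apply, permTensor, Matrix.of_apply, if_pos rfl, map_one, mul_one]
  · intro h _ hh
    rw [Matrix.map_apply, permTensor, Matrix.of_apply, if_neg hh, map_zero, mul_zero]
  · simp

theorem inFactor_apply {S : Type*} [Zero S] (a : Fin m) (M : Matrix (Fin N) (Fin N) S)
    (f g : Fin m → Fin N) [Decidable (∀ b, b ≠ a → f b = g b)] :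
    inFactor a M f g = if ∀ b, b ≠ a → f b = g b then M (f a) (g a) else 0 := by
  rw [inFactor, Matrix.of_apply]
  congr

theorem inFactor_map {S S' : Type*} [Ring S] [Ring S'] (φ : S →+* S') (a : Fin m)
    (M : Matrix (Fin N) (Fin N) S) : φ.mapMatrix (inFactor a M) = inFactor a (M.map φ) := by
  classical
  ext f g
  rw [RingHom.mapMatrix_apply, Matrix.map_apply, inFactor_apply, inFactor_apply, Matrix.map_apply]
  split_ifs <;> simp

theorem tensorRep_of_mul_inFactor (s : Equiv.Perm (Fin m)) (a : Fin m)
    (M : Matrix (Fin N) (Fin N) S) :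
    tensorRep N m S (MonoidAlgebra.of ℂ _ s) * inFactor a M =
      inFactor (s a) M * tensorRep N m S (MonoidAlgebra.of ℂ _ s) := by
  classical
  ext f g
  rw [tensorRep_of_mul_apply, mul_tensorRep_of_apply, inFactor_apply, inFactor_apply]
  simp only [Function.comp_apply, Equiv.symm_apply_apply]
  refine if_congr ⟨fun h b hb => ?_, fun h b hb => ?_⟩ rfl rfl
  · have := h (s.symm b) fun h' => hb (by rw [← h', Equiv.apply_symm_apply])
    rwa [Equiv.apply_symm_apply] at this
  · have := h (s b) fun h' => hb (s.injective h')
    rwa [Equiv.symm_apply_apply] at this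

theorem commute_inFactor_swapElt {a b e : Fin m} (hb : e ≠ b) (he : e ≠ a)
    (M : Matrix (Fin N) (Fin N) S) :
    Commute (inFactor e M) (swapElt (tensorRep N m S) a b) := by
  rw [swapElt, commute_iff_eq, tensorRep_of_mul_inFactor, Equiv.swap_apply_of_ne_of_ne he hb]

theorem inFactor_mul_inFactor_apply {S : Type*} [Ring S] {a b : Fin m} (hab : a ≠ b)
    (M M' : Matrix (Fin N) (Fin N) S) (f g : Fin m → Fin N)
    [Decidable (∀ e, e ≠ a → e ≠ b → f e = g e)] :
    (inFactor a M * inFactor b M') f g =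
      if ∀ e, e ≠ a → e ≠ b → f e = g e then M (f a) (g a) * M' (f b) (g b) else 0 := by
  classical
  rw [Matrix.mul_apply, Finset.sum_eq_single (Function.update f a (g a))]
  · rw [inFactor_apply, inFactor_apply, if_pos, Function.update_self,
      Function.update_of_ne hab.symm, mul_ite, mul_zero]
    · refine if_congr ⟨fun h e he1 he2 => ?_, fun h e he => ?_⟩ rfl rfl
      · have := h e he2
        rwa [Function.update_of_ne he1] at this
      · by_cases hea : e = a
        · rw [hea, Function.update_self]
        · rw [Function.update_of_ne hea]; exact h e hea he
    · intro e he
      rw [Function.update_of_ne he]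
  · intro h _ hh
    rw [inFactor_apply, inFactor_apply]
    split_ifs with h1 h2
    · refine absurd (funext fun e => ?_) hh
      by_cases hea : e = a
      · rw [hea, Function.update_self, h2 a hab]
      · rw [Function.update_of_ne hea, h1 e hea]
    · rw [mul_zero]
    · rw [zero_mul]
    · rw [zero_mul]
  · simp

theorem inFactor_mul_inFactor_same {S : Type*} [Ring S] (a : Fin m)
    (M M' : Matrix (Fin N) (Fin N) S) :
    inFactor a M * inFactor a M' = inFactor a (M * M') := by
  classical
  ext f g
  rw [Matrix.mul_apply, inFactor_apply]
  split_ifs with h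
  · rw [Matrix.mul_apply]
    refine (Finset.sum_of_injOn (fun i => Function.update f a i) ?_ ?_ ?_ ?_).symm
    · intro i _ j _ hij
      simpa using congrFun hij a
    · intro i _; simp
    · intro e _ he
      rw [inFactor_apply, if_neg, zero_mul]
      intro h'
      refine he ⟨e a, by simp, funext fun b => ?_⟩
      change Function.update f a (e a) b = e b
      by_cases hb : b = a
      · rw [hb, Function.update_self]
      · rw [Function.update_of_ne hb, h' b hb]
    · intro i _
      rw [inFactor_apply, inFactor_apply, if_pos, if_pos, Function.update_self]
      · intro b hb; rw [Function.update_of_ne hb]; exact h b hb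
      · intro b hb; rw [Function.update_of_ne hb]
  · refine Finset.sum_eq_zero fun e _ => ?_
    rw [inFactor_apply, inFactor_apply]
    split_ifs with h1 h2
    · exact absurd (fun b hb => (h1 b hb).trans (h2 b hb)) h
    · rw [mul_zero]
    · rw [zero_mul]
    · rw [zero_mul]

/-- Matrices with commuting entries, in different factors, commute. -/
theorem commute_inFactor {S : Type*} [Ring S] {a b : Fin m} (hab : a ≠ b)
    {M M' : Matrix (Fin N) (Fin N) S}
    (h : ∀ i j k l, Commute (M i j) (M' k l)) : Commute (inFactor a M) (inFactor b M') := by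
  classical
  rw [commute_iff_eq]
  ext f g
  rw [inFactor_mul_inFactor_apply hab, inFactor_mul_inFactor_apply hab.symm]
  have : (∀ e, e ≠ a → e ≠ b → f e = g e) ↔ (∀ e, e ≠ b → e ≠ a → f e = g e) :=
    ⟨fun h e h1 h2 => h e h2 h1, fun h e h1 h2 => h e h2 h1⟩
  rw [if_congr this (h _ _ _ _).eq rfl]

theorem inFactor_add {S : Type*} [Ring S] (a : Fin m) (M M' : Matrix (Fin N) (Fin N) S) :
    inFactor a (M + M') = inFactor a M + inFactor a M' := by
  classical
  ext f g
  rw [Matrix.add_apply, inFactor_apply, inFactor_apply, inFactor_apply]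
  split_ifs <;> simp

theorem inFactor_zero {S : Type*} [Ring S] (a : Fin m) :
    inFactor a (0 : Matrix (Fin N) (Fin N) S) = 0 := by
  classical
  ext f g
  rw [inFactor_apply]
  simp

theorem inFactor_one {S : Type*} [Ring S] (a : Fin m) :
    inFactor a (1 : Matrix (Fin N) (Fin N) S) = 1 := by
  classical
  ext f g
  rw [inFactor_apply, Matrix.one_apply, Matrix.one_apply]
  by_cases h : f = g
  · subst h; simp
  · rw [if_neg h]
    split_ifs with h1 h2
    · refine absurd (funext fun b => ?_) h
      by_cases hb : b = a
      · rw [hb, h2]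
      · exact h1 b hb
    · rfl
    · rfl

/-- The `RTT` relation in components gives the relation for two factors of a tensor power. -/
theorem inFactor_rtt {K : Type*} [CommRing K] [Algebra K S] {a k : Fin m} (hak : a ≠ k)
    {Y Y' : Matrix (Fin N) (Fin N) S} {θ : K}
    (h : ∀ i j r l, θ • (Y i j * Y' r l - Y' r l * Y i j) = Y i l * Y' r j - Y' i l * Y r j) :
    inFactor a Y * inFactor k Y' * (θ • 1 - swapElt (tensorRep N m S) a k) =
      (θ • 1 - swapElt (tensorRep N m S) a k) * inFactor k Y' * inFactor a Y := by
  classical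
  rw [mul_assoc (θ • 1 - _)]
  set A := inFactor a Y * inFactor k Y' with hA
  set B := inFactor k Y' * inFactor a Y with hB
  rw [mul_sub, sub_mul, mul_smul_comm, mul_one, smul_mul_assoc, one_mul, sub_eq_sub_iff_sub_eq_sub,
    ← smul_sub]
  ext f g
  have hs : (Equiv.swap a k).symm = Equiv.swap a k := Equiv.symm_swap a k
  rw [Matrix.sub_apply, swapElt, mul_tensorRep_of_apply, tensorRep_of_mul_apply, hs,
    Matrix.smul_apply, Matrix.sub_apply, hA, hB, inFactor_mul_inFactor_apply hak,
    inFactor_mul_inFactor_apply hak, inFactor_mul_inFactor_apply hak.symm,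
    inFactor_mul_inFactor_apply hak.symm]
  have e1 : ∀ e, e ≠ a → e ≠ k → Equiv.swap a k e = e := fun e h1 h2 =>
    Equiv.swap_apply_of_ne_of_ne h1 h2
  by_cases hfg : ∀ e, e ≠ a → e ≠ k → f e = g e
  · rw [if_pos hfg, if_pos fun e h1 h2 => hfg e h2 h1, if_pos, if_pos]
    · simp only [Function.comp_apply, Equiv.swap_apply_left, Equiv.swap_apply_right]
      exact h _ _ _ _
    · intro e h1 h2
      rw [Function.comp_apply, e1 e h2 h1]; exact hfg e h2 h1
    · intro e h1 h2
      rw [Function.comp_apply, e1 e h1 h2]; exact hfg e h1 h2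
  · rw [if_neg hfg, if_neg fun h' => hfg fun e h1 h2 => h' e h2 h1, if_neg, if_neg]
    · simp
    · intro h'
      refine hfg fun e h1 h2 => ?_
      have := h' e h2 h1
      rwa [Function.comp_apply, e1 e h1 h2] at this
    · intro h'
      refine hfg fun e h1 h2 => ?_
      have := h' e h1 h2
      rwa [Function.comp_apply, e1 e h1 h2] at this

end Tensor

/-! ### Series in two variables and the fusion of solutions of the `RTT` relations -/

section Central

variable {K S : Type*} [CommRing K] [Ring S] [Algebra K S]

/-- Power series over an algebra form an algebra over the power series over the base ring. -/
abbrev seriesAlgebra (K S : Type*) [CommRing K] [Ring S] [Algebra K S] : Algebra K⟦X⟧ S⟦X⟧ :=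
  (PowerSeries.map (algebraMap K S)).toAlgebra' fun c x => by
    ext n
    rw [PowerSeries.coeff_mul, PowerSeries.coeff_mul]
    refine (Finset.Nat.sum_antidiagonal_swap (f := fun p : ℕ × ℕ =>
      PowerSeries.coeff p.1 (PowerSeries.map (algebraMap K S) c) *
        PowerSeries.coeff p.2 x)).symm.trans (Finset.sum_congr rfl fun p _ => ?_)
    rw [PowerSeries.coeff_map]
    exact Algebra.commutes _ _

attribute [local instance] seriesAlgebra

theorem series_smul_def (c : K⟦X⟧) (x : S⟦X⟧) :
    c • x = PowerSeries.map (algebraMap K S) c * x := rfl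

theorem coeff_series_smul (c : K⟦X⟧) (x : S⟦X⟧) (n : ℕ) : PowerSeries.coeff n (c • x) =
    ∑ p ∈ Finset.HasAntidiagonal.antidiagonal n,
      PowerSeries.coeff p.1 c • PowerSeries.coeff p.2 x := by
  rw [series_smul_def, PowerSeries.coeff_mul]
  exact Finset.sum_congr rfl fun p _ => by rw [PowerSeries.coeff_map, Algebra.smul_def]

theorem coeff_zero_X_smul (x : S⟦X⟧) : PowerSeries.coeff 0 ((PowerSeries.X : K⟦X⟧) • x) = 0 := by
  rw [series_smul_def, PowerSeries.map_X]
  simp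

theorem coeff_succ_X_smul (x : S⟦X⟧) (n : ℕ) :
    PowerSeries.coeff (n + 1) ((PowerSeries.X : K⟦X⟧) • x) = PowerSeries.coeff n x := by
  rw [series_smul_def, PowerSeries.map_X, PowerSeries.coeff_succ_X_mul]

theorem coeff_C_smul (c : K) (x : S⟦X⟧) (n : ℕ) :
    PowerSeries.coeff n ((PowerSeries.C c : K⟦X⟧) • x) = c • PowerSeries.coeff n x := by
  rw [series_smul_def, PowerSeries.map_C, PowerSeries.coeff_C_mul, Algebra.smul_def]

end Central

section TwoVariables

variable {S : Type*} [Ring S] [Algebra ℂ S]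

attribute [local instance] seriesAlgebra

/-- The difference `q - p` of the outer variable `q` and the inner variable `p`. -/
def varDiff : ℂ⟦X⟧⟦X⟧ := PowerSeries.X - PowerSeries.C PowerSeries.X

theorem eq_zero_of_int_sub_X_smul {e : ℤ} {x : S⟦X⟧}
    (h : (PowerSeries.X : ℂ⟦X⟧) • x = e • x) : x = 0 := by
  ext n
  rw [map_zero]
  by_cases he : e = 0
  · rw [he, zero_smul] at h
    rw [← coeff_succ_X_smul (K := ℂ), h, map_zero]
  · have hreg : ∀ s : S, e • s = 0 → s = 0 := fun s hs => by
      rw [← Int.cast_smul_eq_zsmul ℂ] at hs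
      have := congrArg (((e : ℂ)⁻¹) • ·) hs
      simpa [smul_smul, inv_mul_cancel₀ (Int.cast_ne_zero.2 he : (e : ℂ) ≠ 0)] using this
    induction n with
    | zero =>
      have := congrArg (PowerSeries.coeff 0) h
      rw [coeff_zero_X_smul, map_zsmul] at this
      exact hreg _ this.symm
    | succ n ih =>
      have := congrArg (PowerSeries.coeff (n + 1)) h
      rw [coeff_succ_X_smul, map_zsmul, ih] at this
      exact hreg _ this.symm

theorem varDiff_smul (x : S⟦X⟧⟦X⟧) : varDiff • x =
    (PowerSeries.X : ℂ⟦X⟧⟦X⟧) • x - (PowerSeries.C PowerSeries.X : ℂ⟦X⟧⟦X⟧) • x := sub_smul _ _ _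

theorem eq_zero_of_varDiff_smul (e : ℤ) (x : S⟦X⟧⟦X⟧) (h : (varDiff + e) • x = 0) : x = 0 := by
  rw [add_smul, varDiff_smul, Int.cast_smul_eq_zsmul] at h
  ext1 n
  rw [map_zero]
  induction n with
  | zero =>
    have := congrArg (PowerSeries.coeff 0) h
    rw [map_add, map_sub, coeff_zero_X_smul, coeff_C_smul, map_zsmul, map_zero, zero_sub,
      neg_add_eq_zero] at this
    exact eq_zero_of_int_sub_X_smul this
  | succ n ih =>
    have := congrArg (PowerSeries.coeff (n + 1)) h
    rw [map_add, map_sub, coeff_succ_X_smul, ih, coeff_C_smul, map_zsmul, map_zero, zero_sub,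
      neg_add_eq_zero] at this
    exact eq_zero_of_int_sub_X_smul this

theorem eq_zero_of_varDiff_smul_matrix {n : Type*} [Fintype n] [DecidableEq n] (e : ℤ)
    (x : Matrix n n S⟦X⟧⟦X⟧) (h : (varDiff + e) • x = 0) : x = 0 := by
  ext1 i j
  exact eq_zero_of_varDiff_smul e _ (congrFun (congrFun h i) j)

/-- The restriction `H(p, q) ↦ H(u, u)` of a series in two variables to the diagonal. -/
def diagSeries : S⟦X⟧⟦X⟧ →+ S⟦X⟧ where
  toFun H := PowerSeries.mk fun n =>
    ∑ p ∈ Finset.HasAntidiagonal.antidiagonal n, PowerSeries.coeff p.1 (PowerSeries.coeff p.2 H)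
  map_zero' := by ext; simp
  map_add' H H' := by ext; simp [Finset.sum_add_distrib]

theorem coeff_diagSeries {S : Type*} [Ring S] (H : S⟦X⟧⟦X⟧) (n : ℕ) :
    PowerSeries.coeff n (diagSeries H) = ∑ p ∈ Finset.HasAntidiagonal.antidiagonal n,
      PowerSeries.coeff p.1 (PowerSeries.coeff p.2 H) := by
  simp only [diagSeries, AddMonoidHom.coe_mk, ZeroHom.coe_mk, PowerSeries.coeff_mk]

theorem diagSeries_varDiff_smul (H : S⟦X⟧⟦X⟧) : diagSeries (varDiff • H) = 0 := by
  rw [varDiff_smul, map_sub, sub_eq_zero]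
  ext n
  rw [coeff_diagSeries, coeff_diagSeries]
  cases n with
  | zero =>
    rw [Finset.Nat.antidiagonal_zero, Finset.sum_singleton, Finset.sum_singleton, coeff_zero_X_smul,
      coeff_C_smul, coeff_zero_X_smul, map_zero]
  | succ n =>
    rw [Finset.Nat.sum_antidiagonal_succ', Finset.Nat.sum_antidiagonal_succ, coeff_zero_X_smul,
      coeff_C_smul, coeff_zero_X_smul, map_zero, zero_add, zero_add]
    refine Finset.sum_congr rfl fun p _ => ?_
    rw [coeff_succ_X_smul, coeff_C_smul, coeff_succ_X_smul]

theorem diagSeries_mul {S : Type*} [Ring S] (F G : S⟦X⟧) :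
    diagSeries (PowerSeries.C F * PowerSeries.map PowerSeries.C G) = F * G := by
  ext n
  rw [coeff_diagSeries, PowerSeries.coeff_mul]
  refine Finset.sum_congr rfl fun p _ => ?_
  rw [PowerSeries.coeff_C_mul, PowerSeries.coeff_map, PowerSeries.coeff_mul_C]

theorem coeff_mul_algebraMap (H : S⟦X⟧) (c : ℂ) (n : ℕ) :
    PowerSeries.coeff n (H * algebraMap ℂ S⟦X⟧ c) = PowerSeries.coeff n H * algebraMap ℂ S c := by
  rw [← Algebra.commutes, ← Algebra.smul_def, PowerSeries.coeff_smul, Algebra.smul_def,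
    Algebra.commutes]

theorem diagSeries_mul_algebraMap (H : S⟦X⟧⟦X⟧) (c : ℂ) :
    diagSeries (H * algebraMap ℂ S⟦X⟧⟦X⟧ c) = diagSeries H * algebraMap ℂ S⟦X⟧ c := by
  ext n
  rw [coeff_diagSeries, coeff_mul_algebraMap, coeff_diagSeries, Finset.sum_mul]
  exact Finset.sum_congr rfl fun p _ => by rw [coeff_mul_algebraMap, coeff_mul_algebraMap]

variable {N m : ℕ}

theorem diagSeries_matrix_mul {S : Type*} [Ring S] {n : Type*} [Fintype n] (A B : Matrix n n S⟦X⟧) :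
    (A.map PowerSeries.C * B.map (PowerSeries.map (PowerSeries.C (R := S)))).map diagSeries =
      A * B := by
  ext1 i j
  rw [Matrix.map_apply, Matrix.mul_apply, Matrix.mul_apply, map_sum]
  exact Finset.sum_congr rfl fun e _ => diagSeries_mul _ _

theorem diagSeries_matrix_mul_tensorRep (A : Matrix (Fin m → Fin N) (Fin m → Fin N) S⟦X⟧⟦X⟧)
    (x : MonoidAlgebra ℂ (Equiv.Perm (Fin m))) :
    (A * tensorRep N m S⟦X⟧⟦X⟧ x).map diagSeries =
      A.map diagSeries * tensorRep N m S⟦X⟧ x := by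
  ext1 i j
  rw [Matrix.map_apply, Matrix.mul_apply, Matrix.mul_apply, map_sum]
  refine Finset.sum_congr rfl fun e _ => ?_
  rw [tensorRep_eq, tensorRep_eq, Matrix.map_apply, Matrix.map_apply, Matrix.map_apply]
  exact diagSeries_mul_algebraMap _ _

theorem C_algebraMap (c : ℂ) :
    PowerSeries.C (algebraMap ℂ S c) = algebraMap ℂ S⟦X⟧ c := by
  ext n
  rw [PowerSeries.algebraMap_apply]

/-- The fusion procedure: an ordered product of solutions of the `RTT` relations, evaluated at
arguments shifted by the contents, preserves the weight vectors. -/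
theorem isWeight_mul_fwdProd {c : Fin m → ℤ} {Y : Fin m → Matrix (Fin N) (Fin N) S⟦X⟧}
    (hY : ∀ a k : Fin m, a < k → ∀ i j r l,
      (varDiff + ((c k - c a : ℤ) : ℂ⟦X⟧⟦X⟧)) •
        (PowerSeries.C (Y a i j) * PowerSeries.map PowerSeries.C (Y k r l) -
          PowerSeries.map PowerSeries.C (Y k r l) * PowerSeries.C (Y a i j)) =
      PowerSeries.C (Y a i l) * PowerSeries.map PowerSeries.C (Y k r j) -
          PowerSeries.map PowerSeries.C (Y k i l) * PowerSeries.C (Y a r j))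
    {Z : Matrix (Fin m → Fin N) (Fin m → Fin N) S⟦X⟧}
    (hZ : IsWeight (tensorRep N m S⟦X⟧) c m Z) {n : ℕ} (hn : n ≤ m) :
    IsWeight (tensorRep N m S⟦X⟧) c n
      (Z * fwdProd (extendOne fun a => inFactor a (Y a)) n) := by
  induction n with
  | zero => exact fun a ha => absurd ha (Nat.not_lt_zero _)
  | succ n ih =>
    have hnm : n < m := hn
    have ih' := ih hnm.le
    have hfix : ∀ a b e : Fin m, e ≠ a → e ≠ b →
        Commute (inFactor e (Y e)) (swapElt (tensorRep N m S⟦X⟧) a b) :=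
      fun a b e h1 h2 => commute_inFactor_swapElt h2 h1 _
    intro a ha
    rw [fwdProd, extendOne_of_lt _ hnm, ← mul_assoc]
    rcases Nat.lt_succ_iff_lt_or_eq.1 ha with ha' | ha'
    · refine ih'.mul_right (fun b hb => ?_) a ha'
      exact commute_jucysMurphy_of_swap _ fun e he =>
        hfix _ _ _ (by rw [ne_eq, Fin.ext_iff]; rw [Fin.lt_def] at he; simp; omega)
          (by rw [ne_eq, Fin.ext_iff]; simp; omega)
    · obtain rfl : a = ⟨n, hnm⟩ := Fin.ext ha'
      set k : Fin m := ⟨n, hnm⟩ with hk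
      set ι : Matrix (Fin m → Fin N) (Fin m → Fin N) S⟦X⟧ →+*
        Matrix (Fin m → Fin N) (Fin m → Fin N) S⟦X⟧⟦X⟧ := PowerSeries.C.mapMatrix with hι
      have hιπ : ∀ x, ι (tensorRep N m S⟦X⟧ x) = tensorRep N m S⟦X⟧⟦X⟧ x := fun x =>
        tensorRep_map _ (fun c => C_algebraMap c) x
      have hιw : ∀ {n : ℕ} {W}, IsWeight (tensorRep N m S⟦X⟧) c n W →
          IsWeight (tensorRep N m S⟦X⟧⟦X⟧) c n (ι W) := fun h a ha => by
        rw [← hιπ, ← map_mul, h a ha, map_zsmul]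
      have hprod : ι (fwdProd (extendOne fun a => inFactor a (Y a)) n) =
          fwdProd (extendOne fun a => inFactor a ((Y a).map PowerSeries.C)) n := by
        rw [map_fwdProd]
        refine fwdProd_congr fun b hb => ?_
        rw [extendOne_of_lt _ (hb.trans hnm), extendOne_of_lt _ (hb.trans hnm), hι, inFactor_map]
      obtain ⟨H, hH⟩ := exists_eq_smul_of_rtt (K := ℂ⟦X⟧⟦X⟧) (tensorRep N m S⟦X⟧⟦X⟧) (c := c) k
        (y := extendOne fun a => inFactor a ((Y a).map PowerSeries.C))
        (y' := inFactor k ((Y k).map (PowerSeries.map PowerSeries.C))) (τ := varDiff)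
        (fun e x => eq_zero_of_varDiff_smul_matrix e x)
        (fun a ha => by
          rw [extendOne_coe]
          exact inFactor_rtt ha.ne fun i j r l => hY a k ha i j r l)
        (fun a b ha hb hab => by
          rw [extendOne_coe]
          exact commute_inFactor_swapElt ha.ne hab _)
        (fun a b ha hb => commute_inFactor_swapElt hb.ne' ha.ne' _)
        (Z := ι Z) (hιw fun a ha => hZ a a.2)
        (by
          change IsWeight _ _ n (_ * fwdProd _ n)
          rw [← hprod, ← map_mul]
          exact hιw ih')
      have hd := congrArg (fun M => Matrix.map M diagSeries) hH
      change Matrix.map (_ * fwdProd _ n * _ * _) _ = _ at hd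
      have h0 : (varDiff • H).map diagSeries = 0 := by
        ext1 i j
        exact diagSeries_varDiff_smul _
      have hcs : (c k • (1 : Matrix (Fin m → Fin N) (Fin m → Fin N) S⟦X⟧⟦X⟧) -
          tensorRep N m S⟦X⟧⟦X⟧ (jucysMurphy k)) =
          tensorRep N m S⟦X⟧⟦X⟧ (c k • 1 - jucysMurphy k) := by
        rw [map_sub, map_zsmul, map_one]
      rw [h0, ← hprod, ← map_mul, hcs, diagSeries_matrix_mul_tensorRep] at hd
      have h1 : inFactor k ((Y k).map (PowerSeries.map (PowerSeries.C (R := S)))) =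
          (inFactor k (Y k)).map (PowerSeries.map (PowerSeries.C (R := S))) :=
        (inFactor_map (PowerSeries.map (PowerSeries.C (R := S))) k (Y k)).symm
      rw [h1] at hd
      erw [diagSeries_matrix_mul] at hd
      rw [map_sub, map_zsmul, map_one, mul_sub, mul_smul_comm, mul_one, sub_eq_zero] at hd
      exact hd.symm

end TwoVariables

/-! ### The normalizing series -/

section Functoriality

variable {S S' : Type*} [Ring S] [Algebra ℂ S] [Ring S'] [Algebra ℂ S']

theorem coeff_zero_invSub {S : Type*} [Ring S] (w : S) : PowerSeries.coeff 0 (invSub w) = 0 := by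
  rw [invSub, PowerSeries.coeff_mk]

theorem coeff_succ_invSub {S : Type*} [Ring S] (w : S) (p : ℕ) :
    PowerSeries.coeff (p + 1) (invSub w) = w ^ p := by
  rw [invSub, PowerSeries.coeff_mk]

theorem map_invSub {S S' : Type*} [Ring S] [Ring S'] (φ : S →+* S') (w : S) :
    PowerSeries.map φ (invSub w) = invSub (φ w) := by
  ext p
  rw [PowerSeries.coeff_map]
  cases p with
  | zero => rw [coeff_zero_invSub, coeff_zero_invSub, map_zero]
  | succ p => rw [coeff_succ_invSub, coeff_succ_invSub, map_pow]

theorem map_evalSub (φ : S →ₐ[ℂ] S') (g : ℂ⟦X⟧) (w : S) :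
    PowerSeries.map (φ : S →+* S') (evalSub g w) = evalSub g (φ w) := by
  ext p
  rw [PowerSeries.coeff_map, evalSub, evalSub, PowerSeries.coeff_mk, PowerSeries.coeff_mk, map_sum]
  refine Finset.sum_congr rfl fun k _ => ?_
  have h : invSub (φ w) ^ k = PowerSeries.map (φ : S →+* S') (invSub w ^ k) := by
    rw [map_pow, map_invSub]
    rfl
  rw [h, PowerSeries.coeff_map]
  exact map_smul φ _ _

/-- The map of power series induced by a homomorphism of algebras. -/
def seriesMap (φ : S →ₐ[ℂ] S') : S⟦X⟧ →ₐ[ℂ] S'⟦X⟧ := PowerSeries.mapAlgHom φ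

theorem coeff_seriesMap (φ : S →ₐ[ℂ] S') (f : S⟦X⟧) (n : ℕ) :
    PowerSeries.coeff n (seriesMap φ f) = φ (PowerSeries.coeff n f) := rfl

theorem seriesMap_X (φ : S →ₐ[ℂ] S') : seriesMap φ PowerSeries.X = PowerSeries.X :=
  PowerSeries.map_X (φ : S →+* S')

theorem seriesMap_C (φ : S →ₐ[ℂ] S') (x : S) :
    seriesMap φ (PowerSeries.C x) = PowerSeries.C (φ x) :=
  PowerSeries.map_C (φ : S →+* S') x

theorem seriesMap_invSub (φ : S →ₐ[ℂ] S') (w : S) : seriesMap φ (invSub w) = invSub (φ w) :=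
  map_invSub (φ : S →+* S') w

theorem seriesMap_evalSub (φ : S →ₐ[ℂ] S') (g : ℂ⟦X⟧) (w : S) :
    seriesMap φ (evalSub g w) = evalSub g (φ w) := map_evalSub φ g w

theorem seriesMap_injective {φ : S →ₐ[ℂ] S'} (h : Function.Injective φ) :
    Function.Injective (seriesMap φ) := fun f f' hf => by
  ext n
  have := congrArg (PowerSeries.coeff n) hf
  exact h this

end Functoriality

section Substitution

variable {S : Type*} [CommRing S] [Algebra ℂ S]

theorem hasSubst_invSub {S : Type*} [CommRing S] (w : S) : PowerSeries.HasSubst (invSub w) := by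
  refine PowerSeries.HasSubst.of_constantCoeff_zero' ?_
  rw [← PowerSeries.coeff_zero_eq_constantCoeff_apply, coeff_zero_invSub]

theorem evalSub_eq_subst (φ : ℂ⟦X⟧) (w : S) : evalSub φ w = PowerSeries.subst (invSub w) φ := by
  ext p
  rw [PowerSeries.coeff_subst' (hasSubst_invSub w), evalSub, PowerSeries.coeff_mk]
  refine (finsum_eq_sum_of_support_subset _ fun k hk => ?_).symm
  rw [Finset.coe_range, Set.mem_Iio]
  by_contra hkp
  refine hk ?_
  change _ • _ = _
  have hX : (PowerSeries.X : S⟦X⟧) ∣ invSub w := by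
    rw [PowerSeries.X_dvd_iff, ← PowerSeries.coeff_zero_eq_constantCoeff_apply, coeff_zero_invSub]
  rw [PowerSeries.X_pow_dvd_iff.1 (pow_dvd_pow_of_dvd hX k) p (by omega), smul_zero]

theorem invSub_mul_one_sub {S : Type*} [CommRing S] (w : S) :
    invSub w * (1 - PowerSeries.C w * PowerSeries.X) = PowerSeries.X := by
  rw [mul_sub, mul_one, mul_left_comm, ← mul_assoc]
  ext p
  rw [map_sub]
  match p with
  | 0 => rw [coeff_zero_invSub]; simp
  | 1 =>
    rw [coeff_succ_invSub, PowerSeries.coeff_succ_mul_X, PowerSeries.coeff_C_mul,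
      coeff_zero_invSub]
    simp
  | p + 2 =>
    rw [coeff_succ_invSub, PowerSeries.coeff_succ_mul_X, PowerSeries.coeff_C_mul,
      coeff_succ_invSub, PowerSeries.coeff_X, if_neg (by omega), pow_succ']
    ring

theorem isUnit_of_constantCoeff_eq_one {S : Type*} [CommRing S] {f : S⟦X⟧}
    (h : PowerSeries.coeff 0 f = 1) : IsUnit f := by
  rw [PowerSeries.isUnit_iff_constantCoeff, ← PowerSeries.coeff_zero_eq_constantCoeff_apply, h]
  exact isUnit_one

theorem isUnit_one_sub_C_mul_X {S : Type*} [CommRing S] (w : S) :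
    IsUnit (1 - PowerSeries.C w * PowerSeries.X : S⟦X⟧) := by
  rw [PowerSeries.isUnit_iff_constantCoeff]
  simp

theorem invSub_sub_invSub {S : Type*} [CommRing S] (w w' : S) :
    invSub w - invSub w' = PowerSeries.C (w - w') * (invSub w * invSub w') := by
  refine (isUnit_one_sub_C_mul_X w).mul_right_cancel
    ((isUnit_one_sub_C_mul_X w').mul_right_cancel ?_)
  have h := invSub_mul_one_sub w
  have h' := invSub_mul_one_sub w'
  rw [map_sub]
  linear_combination (1 - PowerSeries.C w' * PowerSeries.X) * h -
    (1 - PowerSeries.C w * PowerSeries.X) * h' -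
    (PowerSeries.C w - PowerSeries.C w') * invSub w' * (1 - PowerSeries.C w' * PowerSeries.X) * h -
    (PowerSeries.C w - PowerSeries.C w') * PowerSeries.X * h'

theorem subst_invSub (w : S) (a : ℂ) :
    PowerSeries.subst (invSub w) (invSub a) = invSub (w + algebraMap ℂ S a) := by
  have hs := hasSubst_invSub w
  have h1 := congrArg (PowerSeries.subst (invSub w)) (invSub_mul_one_sub a)
  rw [PowerSeries.subst_mul hs, PowerSeries.subst_sub hs, PowerSeries.subst_mul hs,
    PowerSeries.subst_X hs, ← PowerSeries.coe_substAlgHom hs, map_one,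
    PowerSeries.coe_substAlgHom hs] at h1
  have hC : PowerSeries.subst (invSub w) (PowerSeries.C a) =
      PowerSeries.C (algebraMap ℂ S a) := by
    have h := (PowerSeries.substAlgHom (R := ℂ) hs).commutes a
    rw [PowerSeries.coe_substAlgHom hs, PowerSeries.algebraMap_apply] at h
    exact h.trans PowerSeries.algebraMap_apply
  rw [hC] at h1
  have h2 : invSub (w + algebraMap ℂ S a) * (1 - PowerSeries.C (algebraMap ℂ S a) * invSub w) =
      invSub w := by
    have h := invSub_sub_invSub (w + algebraMap ℂ S a) w
    rw [add_sub_cancel_left] at h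
    linear_combination h
  have hu : IsUnit (1 - PowerSeries.C (algebraMap ℂ S a) * invSub w) :=
    isUnit_of_constantCoeff_eq_one (by
      rw [map_sub, PowerSeries.coeff_C_mul, coeff_zero_invSub]
      simp)
  exact hu.mul_right_cancel (h1.trans h2.symm)

theorem evalSub_add (φ : ℂ⟦X⟧) (w : S) (a : ℂ) :
    evalSub φ (w + algebraMap ℂ S a) = evalSub (evalSub φ a) w := by
  have hs := hasSubst_invSub w
  rw [evalSub_eq_subst, evalSub_eq_subst φ a, evalSub_eq_subst, ← subst_invSub]
  exact (PowerSeries.subst_comp_subst_apply (hasSubst_invSub a) hs φ).symm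

variable (N : ℕ) [NeZero N]

/-- The functional equation of the normalizing series at an arbitrary argument. -/
theorem evalSub_normSeries (w : S) : evalSub (normSeries N) (w + algebraMap ℂ S (-(N : ℂ))) =
    evalSub (normSeries N) w * (1 - invSub w ^ 2) := by
  have hs := hasSubst_invSub w
  have hg : evalSub (normSeries N) (-(N : ℂ)) = normSeries N * (1 - PowerSeries.X ^ 2) :=
    (existsUnique_normSeries N).choose_spec.1.2
  rw [evalSub_add, hg, evalSub_eq_subst, evalSub_eq_subst, PowerSeries.subst_mul hs,
    PowerSeries.subst_sub hs, PowerSeries.subst_pow hs, PowerSeries.subst_X hs, ← PowerSeries.coe_substAlgHom hs, map_one]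

theorem isUnit_evalSub_normSeries (w : S) : IsUnit (evalSub (normSeries N) w) := by
  refine isUnit_of_constantCoeff_eq_one ?_
  rw [evalSub, PowerSeries.coeff_mk, Finset.sum_range_one,
    PowerSeries.coeff_zero_eq_constantCoeff_apply]
  have : PowerSeries.constantCoeff (normSeries N) = 1 :=
    (existsUnique_normSeries N).choose_spec.1.1
  rw [this]
  simp

end Substitution

/-! ### Shifts of the argument of a convergent series -/

section Shift

variable {D : Type*} [Ring D] [Algebra ℂ D] [TopologicalSpace D]

/-- The series `f'(u) = f(u + c)` is the re-expansion in powers of `u` of the series `f`: its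
coefficients are the sums of the binomial expansions, which are required to converge. -/
def IsShift (c : ℂ) (f f' : D⟦X⟧) : Prop :=
  ∀ k, HasSum (fun s => ((s.choose k : ℂ) * c ^ (s - k)) • PowerSeries.coeff s f)
    (PowerSeries.coeff k f')

theorem IsShift.unique [T2Space D] {c : ℂ} {f f₁ f₂ : D⟦X⟧} (h₁ : IsShift c f f₁)
    (h₂ : IsShift c f f₂) : f₁ = f₂ := by
  ext k
  exact (h₁ k).unique (h₂ k)

variable [IsTopologicalRing D] {c : ℂ}

theorem IsShift.zero {D : Type*} [Ring D] [Algebra ℂ D] [TopologicalSpace D] {c : ℂ} :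
    IsShift c (0 : D⟦X⟧) 0 := fun k => by
  simp only [map_zero, smul_zero]
  exact hasSum_zero

theorem IsShift.add {f f' g g' : D⟦X⟧} (hf : IsShift c f f') (hg : IsShift c g g') :
    IsShift c (f + g) (f' + g') := fun k => by
  simp only [map_add, smul_add]
  exact (hf k).add (hg k)

theorem IsShift.sub {f f' g g' : D⟦X⟧} (hf : IsShift c f f') (hg : IsShift c g g') :
    IsShift c (f - g) (f' - g') := fun k => by
  simp only [map_sub, smul_sub]
  exact (hf k).sub (hg k)

theorem IsShift.sum {ι : Type*} (s : Finset ι) {f f' : ι → D⟦X⟧}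
    (h : ∀ i ∈ s, IsShift c (f i) (f' i)) : IsShift c (∑ i ∈ s, f i) (∑ i ∈ s, f' i) := fun k => by
  simp only [map_sum, Finset.smul_sum]
  exact hasSum_sum fun i hi => h i hi k

theorem IsShift.C_mul {f f' : D⟦X⟧} (hf : IsShift c f f') (a : D) :
    IsShift c (PowerSeries.C a * f) (PowerSeries.C a * f') := fun k => by
  simp only [PowerSeries.coeff_C_mul, ← mul_smul_comm]
  exact (hf k).mul_left a

theorem IsShift.mul_C {f f' : D⟦X⟧} (hf : IsShift c f f') (a : D) :
    IsShift c (f * PowerSeries.C a) (f' * PowerSeries.C a) := fun k => by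
  simp only [PowerSeries.coeff_mul_C, ← smul_mul_assoc]
  exact (hf k).mul_right a

theorem IsShift.X_mul {f f' : D⟦X⟧} (hf : IsShift c f f') :
    IsShift c (PowerSeries.X * f)
      ((PowerSeries.X + PowerSeries.C (algebraMap ℂ D c)) * f') := fun k => by
  rw [add_mul, map_add, PowerSeries.coeff_C_mul, ← hasSum_nat_add_iff' 1]
  simp only [PowerSeries.coeff_succ_X_mul, Finset.sum_range_one, PowerSeries.coeff_zero_X_mul,
    smul_zero, sub_zero]
  cases k with
  | zero =>
    rw [PowerSeries.coeff_zero_X_mul, zero_add]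
    refine ((hf 0).mul_left (algebraMap ℂ D c)).congr_fun fun s => ?_
    rw [← Algebra.smul_def, smul_smul]
    congr 1
    simp [pow_succ']
  | succ k =>
    rw [PowerSeries.coeff_succ_X_mul]
    refine ((hf k).add ((hf (k + 1)).mul_left (algebraMap ℂ D c))).congr_fun fun s => ?_
    rw [← Algebra.smul_def, smul_smul, ← add_smul]
    congr 1
    rw [Nat.choose_succ_succ, Nat.add_sub_add_right]
    rcases le_or_gt s k with h | h
    · rw [Nat.choose_eq_zero_of_lt (Nat.lt_succ_of_le h)]
      simp
    · obtain ⟨d, rfl⟩ := Nat.exists_eq_add_of_lt h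
      have e1 : k + d + 1 - k = d + 1 := by omega
      have e2 : k + d + 1 - (k + 1) = d := by omega
      rw [e1, e2]
      push_cast
      ring

variable (D c) in
/-- The pairs `(m(v), m(v + c))` of series which multiply the pairs `(f(v), f(v + c))`. -/
def shiftMultipliers : Subalgebra ℂ (D⟦X⟧ × D⟦X⟧) where
  carrier := {m | ∀ f f', IsShift c f f' → IsShift c (m.1 * f) (m.2 * f')}
  mul_mem' := fun {a b} ha hb f f' h => by
    rw [Prod.fst_mul, Prod.snd_mul, mul_assoc, mul_assoc]
    exact ha _ _ (hb _ _ h)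
  add_mem' := fun {a b} ha hb f f' h => by
    rw [Prod.fst_add, Prod.snd_add, add_mul, add_mul]
    exact (ha _ _ h).add (hb _ _ h)
  algebraMap_mem' := fun r f f' h => by
    have := h.C_mul (algebraMap ℂ D r)
    rw [← PowerSeries.algebraMap_apply] at this
    exact this

theorem C_mem_shiftMultipliers (a : D) :
    (PowerSeries.C a, PowerSeries.C a) ∈ shiftMultipliers D c := fun _ _ h => h.C_mul a

theorem X_mem_shiftMultipliers :
    (PowerSeries.X, PowerSeries.X + PowerSeries.C (algebraMap ℂ D c)) ∈ shiftMultipliers D c :=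
  fun _ _ h => h.X_mul

variable (D c) in
/-- The projection of `(m(v), m(v + c))` to `m(v)`. -/
def multiplier : shiftMultipliers D c →ₐ[ℂ] D⟦X⟧ :=
  (AlgHom.fst ℂ _ _).comp (shiftMultipliers D c).val

variable (D c) in
/-- The projection of `(m(v), m(v + c))` to `m(v + c)`. -/
def shiftedMultiplier : shiftMultipliers D c →ₐ[ℂ] D⟦X⟧ :=
  (AlgHom.snd ℂ _ _).comp (shiftMultipliers D c).val

/-- The shift of the inner variable of a series in two variables. -/
def IsInnerShift (c : ℂ) (G G' : D⟦X⟧⟦X⟧) : Prop :=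
  ∀ p, IsShift c (PowerSeries.coeff p G) (PowerSeries.coeff p G')

theorem IsInnerShift.unique {D : Type*} [Ring D] [Algebra ℂ D] [TopologicalSpace D] {c : ℂ}
    [T2Space D] {G G₁ G₂ : D⟦X⟧⟦X⟧} (h₁ : IsInnerShift c G G₁)
    (h₂ : IsInnerShift c G G₂) : G₁ = G₂ := by
  ext1 p
  exact (h₁ p).unique (h₂ p)

theorem IsInnerShift.sub {F F' G G' : D⟦X⟧⟦X⟧} (hF : IsInnerShift c F F')
    (hG : IsInnerShift c G G') : IsInnerShift c (F - G) (F' - G') := fun p => by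
  rw [map_sub, map_sub]
  exact (hF p).sub (hG p)

theorem IsShift.isInnerShift_C {D : Type*} [Ring D] [Algebra ℂ D] [TopologicalSpace D] {c : ℂ}
    {f f' : D⟦X⟧} (h : IsShift c f f') :
    IsInnerShift c (PowerSeries.C f) (PowerSeries.C f') := fun p => by
  rw [PowerSeries.coeff_C, PowerSeries.coeff_C]
  split_ifs
  · exact h
  · exact IsShift.zero

theorem IsInnerShift.mul_left {G G' : D⟦X⟧⟦X⟧} (hG : IsInnerShift c G G')
    (M : (shiftMultipliers D c)⟦X⟧) :
    IsInnerShift c (seriesMap (multiplier D c) M * G) (seriesMap (shiftedMultiplier D c) M * G') :=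
  fun p => by
    rw [PowerSeries.coeff_mul, PowerSeries.coeff_mul]
    exact IsShift.sum _ fun q _ => (PowerSeries.coeff q.1 M).2 _ _ (hG q.2)

theorem IsInnerShift.mk_C_mul {G G' : D⟦X⟧⟦X⟧} (hG : IsInnerShift c G G') (t : ℕ → D) :
    IsInnerShift c (PowerSeries.mk (fun r => PowerSeries.C (t r)) * G)
      (PowerSeries.mk (fun r => PowerSeries.C (t r)) * G') := fun p => by
  rw [PowerSeries.coeff_mul, PowerSeries.coeff_mul]
  refine IsShift.sum _ fun q _ => ?_
  rw [PowerSeries.coeff_mk]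
  exact (hG q.2).C_mul _

theorem IsInnerShift.mul_mk_C {G G' : D⟦X⟧⟦X⟧} (hG : IsInnerShift c G G') (t : ℕ → D) :
    IsInnerShift c (G * PowerSeries.mk fun r => PowerSeries.C (t r))
      (G' * PowerSeries.mk fun r => PowerSeries.C (t r)) := fun p => by
  rw [PowerSeries.coeff_mul, PowerSeries.coeff_mul]
  refine IsShift.sum _ fun q _ => ?_
  rw [PowerSeries.coeff_mk]
  exact (hG q.1).mul_C _

theorem IsInnerShift.invSub_mul {G G' : D⟦X⟧⟦X⟧} (hG : IsInnerShift c G G')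
    {w w' : D⟦X⟧} (hw : (w, w') ∈ shiftMultipliers D c) :
    IsInnerShift c (invSub w * G) (invSub w' * G') := by
  have h := hG.mul_left (invSub ⟨(w, w'), hw⟩)
  rwa [seriesMap_invSub, seriesMap_invSub] at h

theorem IsInnerShift.evalSub_mul {G G' : D⟦X⟧⟦X⟧} (hG : IsInnerShift c G G') (φ : ℂ⟦X⟧)
    {w w' : D⟦X⟧} (hw : (w, w') ∈ shiftMultipliers D c) :
    IsInnerShift c (evalSub φ w * G) (evalSub φ w' * G') := by
  have h := hG.mul_left (evalSub φ ⟨(w, w'), hw⟩)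
  rwa [seriesMap_evalSub, seriesMap_evalSub] at h

/-- A mixed `R`-matrix relation remains true under a shift of the inner variable. -/
theorem mixed_relation_shift [T2Space D] (φ : ℂ⟦X⟧) (z : D) {t₁ t₂ t₃ t₄ : ℕ → D}
    {f₁ f₁' f₂ f₂' f₃ f₃' f₄ f₄' : D⟦X⟧} (h₁ : IsShift c f₁ f₁') (h₂ : IsShift c f₂ f₂')
    (h₃ : IsShift c f₃ f₃') (h₄ : IsShift c f₄ f₄')
    (h : evalSub φ (PowerSeries.X - PowerSeries.C z) *
        (PowerSeries.mk (fun r => PowerSeries.C (t₁ r)) * PowerSeries.C f₁ -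
          invSub (PowerSeries.X - PowerSeries.C z) *
            (PowerSeries.mk (fun r => PowerSeries.C (t₂ r)) * PowerSeries.C f₂)) =
      evalSub φ (PowerSeries.X + PowerSeries.C z) *
        (PowerSeries.C f₃ * PowerSeries.mk (fun r => PowerSeries.C (t₃ r)) -
          invSub (PowerSeries.X + PowerSeries.C z) *
            (PowerSeries.C f₄ * PowerSeries.mk (fun r => PowerSeries.C (t₄ r))))) :
    evalSub φ (PowerSeries.X + PowerSeries.C (algebraMap ℂ D c) - PowerSeries.C z) *
        (PowerSeries.mk (fun r => PowerSeries.C (t₁ r)) * PowerSeries.C f₁' -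
          invSub (PowerSeries.X + PowerSeries.C (algebraMap ℂ D c) - PowerSeries.C z) *
            (PowerSeries.mk (fun r => PowerSeries.C (t₂ r)) * PowerSeries.C f₂')) =
      evalSub φ (PowerSeries.X + PowerSeries.C (algebraMap ℂ D c) + PowerSeries.C z) *
        (PowerSeries.C f₃' * PowerSeries.mk (fun r => PowerSeries.C (t₃ r)) -
          invSub (PowerSeries.X + PowerSeries.C (algebraMap ℂ D c) + PowerSeries.C z) *
            (PowerSeries.C f₄' * PowerSeries.mk (fun r => PowerSeries.C (t₄ r)))) := by
  have hL := sub_mem (X_mem_shiftMultipliers (D := D) (c := c)) (C_mem_shiftMultipliers z)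
  have hR := add_mem (X_mem_shiftMultipliers (D := D) (c := c)) (C_mem_shiftMultipliers z)
  have e1 := ((h₁.isInnerShift_C.mk_C_mul t₁).sub
    ((h₂.isInnerShift_C.mk_C_mul t₂).invSub_mul hL)).evalSub_mul φ hL
  have e2 := ((h₃.isInnerShift_C.mul_mk_C t₃).sub
    ((h₄.isInnerShift_C.mul_mk_C t₄).invSub_mul hR)).evalSub_mul φ hR
  rw [h] at e1
  exact e1.unique e2

theorem map_C_eq_mk {D : Type*} [Ring D] (f : D⟦X⟧) : PowerSeries.map PowerSeries.C f =
    PowerSeries.mk fun r => PowerSeries.C (PowerSeries.coeff r f) := by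
  ext1 r
  rw [PowerSeries.coeff_map, PowerSeries.coeff_mk]

/-- A relation quadratic in series remains true under a shift of the inner variable. -/
theorem quadratic_relation_shift [T2Space D] {f f' g h h' l h₁ l₁ l₁' : D⟦X⟧}
    (hf : IsShift c f f') (hh : IsShift c h h') (hl₁ : IsShift c l₁ l₁')
    (M : (shiftMultipliers D c)⟦X⟧)
    (H : seriesMap (multiplier D c) M * (PowerSeries.C f * PowerSeries.map PowerSeries.C g -
          PowerSeries.map PowerSeries.C g * PowerSeries.C f) =
      PowerSeries.C h * PowerSeries.map PowerSeries.C l -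
        PowerSeries.map PowerSeries.C h₁ * PowerSeries.C l₁) :
    seriesMap (shiftedMultiplier D c) M * (PowerSeries.C f' * PowerSeries.map PowerSeries.C g -
          PowerSeries.map PowerSeries.C g * PowerSeries.C f') =
      PowerSeries.C h' * PowerSeries.map PowerSeries.C l -
        PowerSeries.map PowerSeries.C h₁ * PowerSeries.C l₁' := by
  rw [map_C_eq_mk g, map_C_eq_mk l, map_C_eq_mk h₁] at *
  have e1 := ((hf.isInnerShift_C.mul_mk_C fun r => PowerSeries.coeff r g).sub
    (hf.isInnerShift_C.mk_C_mul fun r => PowerSeries.coeff r g)).mul_left M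
  have e2 := (hh.isInnerShift_C.mul_mk_C fun r => PowerSeries.coeff r l).sub
    (hl₁.isInnerShift_C.mk_C_mul fun r => PowerSeries.coeff r h₁)
  rw [H] at e1
  exact e1.unique e2

/-- The exchange of the two variables. -/
def swapVars (D : Type*) [Ring D] : D⟦X⟧⟦X⟧ →+* D⟦X⟧⟦X⟧ where
  toFun G := PowerSeries.mk fun q => PowerSeries.mk fun p =>
    PowerSeries.coeff q (PowerSeries.coeff p G)
  map_one' := by
    ext q p
    simp only [PowerSeries.coeff_mk, PowerSeries.coeff_one]
    split_ifs <;> simp [PowerSeries.coeff_one, *]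
  map_zero' := by ext; simp
  map_add' G G' := by ext; simp
  map_mul' G G' := by
    ext q p
    simp only [PowerSeries.coeff_mk, PowerSeries.coeff_mul, map_sum]
    exact Finset.sum_comm

theorem coeff_swapVars {D : Type*} [Ring D] (G : D⟦X⟧⟦X⟧) (q p : ℕ) :
    PowerSeries.coeff p (PowerSeries.coeff q (swapVars D G)) =
      PowerSeries.coeff q (PowerSeries.coeff p G) := by
  simp [swapVars]

theorem swapVars_map_C {D : Type*} [Ring D] (f : D⟦X⟧) :
    swapVars D (PowerSeries.map PowerSeries.C f) = PowerSeries.C f := by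
  ext q p
  rw [coeff_swapVars, PowerSeries.coeff_map, PowerSeries.coeff_C, PowerSeries.coeff_C]
  split_ifs <;> simp

theorem swapVars_C {D : Type*} [Ring D] (f : D⟦X⟧) :
    swapVars D (PowerSeries.C f) = PowerSeries.map PowerSeries.C f := by
  ext q p
  rw [coeff_swapVars, PowerSeries.coeff_map, PowerSeries.coeff_C, PowerSeries.coeff_C]
  split_ifs <;> simp

/-- The relation of the dual Yangian remains true under shifts of both variables. -/
theorem dual_relation_shift [T2Space D] {a b : ℂ} {f f' g g' h h' l l' h₁ h₁' l₁ l₁' : D⟦X⟧}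
    (hf : IsShift a f f') (hg : IsShift b g g') (hh : IsShift a h h') (hl : IsShift b l l')
    (hh₁ : IsShift b h₁ h₁') (hl₁ : IsShift a l₁ l₁')
    (H : (PowerSeries.X - PowerSeries.C PowerSeries.X) *
        (PowerSeries.C f * PowerSeries.map PowerSeries.C g -
          PowerSeries.map PowerSeries.C g * PowerSeries.C f) =
      PowerSeries.C h * PowerSeries.map PowerSeries.C l -
        PowerSeries.map PowerSeries.C h₁ * PowerSeries.C l₁) :
    (PowerSeries.X - PowerSeries.C PowerSeries.X +
          PowerSeries.C (PowerSeries.C (algebraMap ℂ D (b - a)))) *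
        (PowerSeries.C f' * PowerSeries.map PowerSeries.C g' -
          PowerSeries.map PowerSeries.C g' * PowerSeries.C f') =
      PowerSeries.C h' * PowerSeries.map PowerSeries.C l' -
        PowerSeries.map PowerSeries.C h₁' * PowerSeries.C l₁' := by
  have e1 := quadratic_relation_shift (c := a) hf hh hl₁
    (PowerSeries.X - PowerSeries.C ⟨_, X_mem_shiftMultipliers⟩) (by
      rw [map_sub, seriesMap_X, seriesMap_C]
      exact H)
  have e2 := congrArg (swapVars D) e1
  have hX : swapVars D PowerSeries.X = PowerSeries.C PowerSeries.X := by
    rw [← swapVars_map_C, PowerSeries.map_X]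
  have hX' : swapVars D (PowerSeries.C PowerSeries.X) = PowerSeries.X := by
    rw [swapVars_C, PowerSeries.map_X]
  have hC : ∀ x : D, swapVars D (PowerSeries.C (PowerSeries.C x)) =
      PowerSeries.C (PowerSeries.C x) := fun x => by
    rw [swapVars_C, PowerSeries.map_C]
  have e3 : seriesMap (shiftedMultiplier D a)
      (PowerSeries.X - PowerSeries.C ⟨_, X_mem_shiftMultipliers⟩) = PowerSeries.X -
        (PowerSeries.C PowerSeries.X + PowerSeries.C (PowerSeries.C (algebraMap ℂ D a))) := by
    rw [map_sub, seriesMap_X, seriesMap_C, ← map_add]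
    rfl
  rw [e3] at e2
  simp only [map_sub, map_add, map_mul, hX, hX', hC, swapVars_C, swapVars_map_C] at e2
  have e4 := quadratic_relation_shift (c := b) (f := g) (g := f') (h := h₁) (l := l₁') (h₁ := h')
    (l₁ := l) hg hh₁ hl
    (PowerSeries.C ⟨_, X_mem_shiftMultipliers⟩ -
      (PowerSeries.X + PowerSeries.C ⟨_, C_mem_shiftMultipliers (algebraMap ℂ D a)⟩)) (by
      rw [map_sub, map_add, seriesMap_X, seriesMap_C, seriesMap_C]
      change (PowerSeries.C PowerSeries.X -
        (_ + PowerSeries.C (PowerSeries.C (algebraMap ℂ D a)))) * _ = _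
      rw [← neg_sub (PowerSeries.map PowerSeries.C f' * PowerSeries.C g), mul_neg, e2, neg_sub])
  have e5 := congrArg (swapVars D) e4
  have e6 : seriesMap (shiftedMultiplier D b) (PowerSeries.C ⟨_, X_mem_shiftMultipliers⟩ -
      (PowerSeries.X + PowerSeries.C ⟨_, C_mem_shiftMultipliers (algebraMap ℂ D a)⟩)) =
        PowerSeries.C PowerSeries.X + PowerSeries.C (PowerSeries.C (algebraMap ℂ D b)) -
          (PowerSeries.X + PowerSeries.C (PowerSeries.C (algebraMap ℂ D a))) := by
    rw [map_sub, map_add, seriesMap_X, seriesMap_C, seriesMap_C, ← map_add PowerSeries.C]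
    rfl
  rw [e6] at e5
  simp only [map_sub, map_add, map_mul, hX, hX', hC, swapVars_C, swapVars_map_C] at e5
  rw [← neg_sub (PowerSeries.map PowerSeries.C g' * PowerSeries.C f'), mul_neg, map_sub, map_sub,
    map_sub, ← neg_sub (PowerSeries.map PowerSeries.C h₁' * PowerSeries.C l₁'), ← e5]
  congr 2
  abel

end Shift

/-! ### The defining relations in terms of series -/

section Relations

variable {N : ℕ} [NeZero N]

/-- The canonical map from the free algebra to the completion. -/
def freeToHat (N : ℕ) [NeZero N] : Free N →ₐ[ℂ] DYHat N := (toHat N).comp DY.proj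

/-- The series `t⁺_{ij}(v)` over the completion. -/
def plusHat (i j : Fin N) : (DYHat N)⟦X⟧ :=
  PowerSeries.mk fun s => freeToHat N (Free.tPlusCoeff i j s)

theorem freeToHat_rel {x y : Free N} (h : Rel N x y) : freeToHat N x = freeToHat N y :=
  congrArg (toHat N) (DY.proj_rel h)

theorem coeff_plusHat (i j : Fin N) (s : ℕ) : PowerSeries.coeff s (plusHat i j) =
    (if i = j ∧ s = 0 then 1 else 0) - freeToHat N (Free.tNeg i j s) := by
  rw [plusHat, PowerSeries.coeff_mk, Free.tPlusCoeff, map_sub]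
  split_ifs
  · rw [map_one]
  · rw [map_zero]

theorem isShift_dualSeries (c : ℂ) (i j : Fin N) :
    IsShift c (plusHat i j) (seriesMap (dualYangianHat N).val (dualSeries c i j)) := by
  intro k
  have h1 := (summable_dualT (N := N) (fun r => (r.choose k : ℂ) * c ^ (r - k)) i j).hasSum.map
    (dualYangianHat N).val.toLinearMap.toAddMonoidHom continuous_subtype_val
  have h2 : HasSum (fun s : ℕ => ((s.choose k : ℂ) * c ^ (s - k)) •
      (if i = j ∧ s = 0 then (1 : DYHat N) else 0)) (if i = j ∧ k = 0 then 1 else 0) := by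
    have h := hasSum_single (f := fun s : ℕ => ((s.choose k : ℂ) * c ^ (s - k)) •
      (if i = j ∧ s = 0 then (1 : DYHat N) else 0)) 0 fun s hs => by
        rw [if_neg fun h => hs h.2, smul_zero]
    convert h using 1
    cases k with
    | zero => simp
    | succ k => simp
  have h3 := h2.sub h1
  rw [coeff_seriesMap, dualSeries, Matrix.of_apply, PowerSeries.coeff_mk, map_sub]
  have e1 : (fun s : ℕ => ((s.choose k : ℂ) * c ^ (s - k)) • PowerSeries.coeff s (plusHat i j)) =
      fun s : ℕ => ((s.choose k : ℂ) * c ^ (s - k)) • (if i = j ∧ s = 0 then (1 : DYHat N) else 0) -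
        ((dualYangianHat N).val.toLinearMap.toAddMonoidHom ∘
          fun r => ((r.choose k : ℂ) * c ^ (r - k)) • dualT i j r) s := by
    funext s
    rw [coeff_plusHat, smul_sub]
    rfl
  have e2 : (dualYangianHat N).val (if i = j ∧ k = 0 then 1 else 0) =
      if i = j ∧ k = 0 then (1 : DYHat N) else 0 := by
    split_ifs <;> simp
  rw [e1, e2]
  exact h3

theorem coeff_plusHat_commutator (i j k l : Fin N) (r s : ℕ) :
    PowerSeries.coeff r (plusHat i j) * PowerSeries.coeff s (plusHat k l) -
        PowerSeries.coeff s (plusHat k l) * PowerSeries.coeff r (plusHat i j) =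
      ∑ a ∈ Finset.range (min r s + 1),
        (PowerSeries.coeff (r + s + 1 - a) (plusHat k j) * PowerSeries.coeff a (plusHat i l) -
          PowerSeries.coeff a (plusHat k j) *
            PowerSeries.coeff (r + s + 1 - a) (plusHat i l)) := by
  have h := freeToHat_rel (Rel.dual i j k l r s)
  have e1 : ∀ (p : Prop) [Decidable p] (x : Free N),
      freeToHat N (if p then x else 0) = if p then freeToHat N x else 0 := fun p _ x => by
    split_ifs
    · rfl
    · rw [map_zero]
  simp only [map_sub, map_mul, map_add, map_sum, e1] at h
  rw [Finset.sum_range_succ'] at h ⊢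
  have e2 : ∀ a ∈ Finset.range (min r s),
      PowerSeries.coeff (r + s + 1 - (a + 1)) (plusHat k j) *
            PowerSeries.coeff (a + 1) (plusHat i l) -
          PowerSeries.coeff (a + 1) (plusHat k j) *
            PowerSeries.coeff (r + s + 1 - (a + 1)) (plusHat i l) =
        freeToHat N (Free.tNeg k j (r + s + 1 - (a + 1))) * freeToHat N (Free.tNeg i l (a + 1)) -
          freeToHat N (Free.tNeg k j (a + 1)) *
            freeToHat N (Free.tNeg i l (r + s + 1 - (a + 1))) := by
    intro a ha
    rw [Finset.mem_range] at ha
    have h1 : r + s + 1 - (a + 1) ≠ 0 := by omega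
    simp only [coeff_plusHat, h1, and_false, if_false, zero_sub, neg_mul_neg, Nat.succ_ne_zero]
  rw [Finset.sum_congr rfl e2]
  simp only [coeff_plusHat, Nat.sub_zero, Nat.succ_ne_zero, and_false, if_false, zero_sub,
    and_true]
  have e3 : ∀ (p q : Prop) [Decidable p] [Decidable q] (x y : DYHat N),
      ((if p then 1 else 0) - x) * ((if q then 1 else 0) - y) -
        ((if q then 1 else 0) - y) * ((if p then 1 else 0) - x) = x * y - y * x := by
    intro p q _ _ x y
    split_ifs <;> noncomm_ring
  rw [e3, h]
  have e4 : ∀ (p : Prop) [Decidable p] (x : DYHat N), (if p then x else 0) =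
      (if p then 1 else 0) * x := fun p _ x => by split_ifs <;> simp
  have e5 : ∀ (p : Prop) [Decidable p] (x : DYHat N), 
      (if p then (1 : DYHat N) else 0) * x = x * (if p then 1 else 0) :=
    fun p _ x => by split_ifs <;> simp
  rw [e4 (k = j), e4 (i = l), e5 (i = l)]
  noncomm_ring

/-- The defining relation of the dual Yangian in terms of series. -/
theorem plusHat_relation (i j k l : Fin N) :
    (PowerSeries.X - PowerSeries.C PowerSeries.X) *
        (PowerSeries.C (plusHat i j) * PowerSeries.map PowerSeries.C (plusHat k l) -
          PowerSeries.map PowerSeries.C (plusHat k l) * PowerSeries.C (plusHat i j)) =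
      PowerSeries.C (plusHat i l) * PowerSeries.map PowerSeries.C (plusHat k j) -
        PowerSeries.map PowerSeries.C (plusHat i l) * PowerSeries.C (plusHat k j) := by
  set S : ℕ → ℕ → DYHat N := fun p q =>
    PowerSeries.coeff p (plusHat i j) * PowerSeries.coeff q (plusHat k l) -
        PowerSeries.coeff q (plusHat k l) * PowerSeries.coeff p (plusHat i j) with hS
  set f : ℕ → DYHat N := fun a => PowerSeries.coeff a (plusHat k j) with hf
  set g : ℕ → DYHat N := fun a => PowerSeries.coeff a (plusHat i l) with hg
  have hSf : ∀ p q, S p q = ∑ a ∈ Finset.range (min p q + 1),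
      (f (p + q + 1 - a) * g a - f a * g (p + q + 1 - a)) :=
    fun p q => coeff_plusHat_commutator i j k l p q
  have hgf : ∀ p q, g p * f q - f q * g p = g q * f p - f p * g q := fun p q => by
    have h1 := coeff_plusHat_commutator i l k j p q
    have h2 := coeff_plusHat_commutator i l k j q p
    rw [add_comm q p, min_comm q p] at h2
    exact h1.trans h2.symm
  have main : ∀ p q, (match q with | 0 => 0 | q + 1 => S p q) -
      (match p with | 0 => 0 | p + 1 => S p q) = f q * g p - f p * g q := by
    intro p q
    match p, q with
    | 0, 0 => simp
    | 0, q + 1 =>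
      change S 0 q - 0 = _
      rw [hSf]
      simp
    | p + 1, 0 =>
      change 0 - S p 0 = _
      rw [hSf]
      simp
    | p + 1, q + 1 =>
      change S (p + 1) q - S p (q + 1) = _
      rw [hSf, hSf]
      have e : p + 1 + q + 1 = p + (q + 1) + 1 := by omega
      rcases lt_trichotomy p q with h | h | h
      · rw [min_eq_left (by omega), min_eq_left (by omega), Finset.sum_range_succ _ (p + 1), e,
          add_sub_cancel_left]
        congr 3 <;> omega
      · subst h
        rw [min_eq_right (by omega), min_eq_left (by omega), e, sub_self, sub_self]
      · rw [min_eq_right (by omega), min_eq_right (by omega), Finset.sum_range_succ _ (q + 1), e,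
          sub_add_cancel_left, neg_sub]
        congr 3 <;> omega
  ext q p
  have hU : ∀ q p, PowerSeries.coeff p (PowerSeries.coeff q (PowerSeries.C (plusHat i j) *
        PowerSeries.map PowerSeries.C (plusHat k l) -
          PowerSeries.map PowerSeries.C (plusHat k l) * PowerSeries.C (plusHat i j))) = S p q := by
    intro q p
    rw [map_sub, PowerSeries.coeff_C_mul, PowerSeries.coeff_mul_C, PowerSeries.coeff_map, map_sub,
      PowerSeries.coeff_C_mul, PowerSeries.coeff_mul_C]
  have hR : PowerSeries.coeff p (PowerSeries.coeff q (PowerSeries.C (plusHat i l) *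
        PowerSeries.map PowerSeries.C (plusHat k j) -
          PowerSeries.map PowerSeries.C (plusHat i l) * PowerSeries.C (plusHat k j))) =
      g p * f q - g q * f p := by
    rw [map_sub, PowerSeries.coeff_C_mul, PowerSeries.coeff_mul_C, PowerSeries.coeff_map, map_sub,
      PowerSeries.coeff_map, PowerSeries.coeff_C_mul, PowerSeries.coeff_mul_C]
  rw [hR, sub_mul, map_sub, map_sub, PowerSeries.coeff_C_mul]
  have h3 : g p * f q - g q * f p = f q * g p - f p * g q := by
    have := hgf p q
    rw [sub_eq_sub_iff_add_eq_add] at this ⊢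
    rw [this]; abel
  rw [h3, ← main]
  congr 1
  · cases q with
    | zero => rw [PowerSeries.coeff_zero_X_mul, map_zero]
    | succ q => rw [PowerSeries.coeff_succ_X_mul, hU]
  · cases p with
    | zero => rw [PowerSeries.coeff_zero_X_mul]
    | succ p => rw [PowerSeries.coeff_succ_X_mul, hU]

theorem seriesMap_tSeries (i j : Fin N) :
    seriesMap (seriesMap (freeToHat N)) (Free.tSeries i j) =
      PowerSeries.mk fun r => PowerSeries.C (extT i j r : DYHat N) := by
  ext1 r
  rw [coeff_seriesMap, Free.tSeries, PowerSeries.coeff_mk, PowerSeries.coeff_mk, seriesMap_C]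
  exact congrArg PowerSeries.C rfl

theorem seriesMap_tPlusSeries (i j : Fin N) :
    seriesMap (seriesMap (freeToHat N)) (Free.tPlusSeries i j) = PowerSeries.C (plusHat i j) := by
  rw [Free.tPlusSeries, seriesMap_C]
  rfl

theorem mixed_relation_hat (i j k l : Fin N) :
    let z : DYHat N := freeToHat N ((1 / 2 : ℂ) • Free.central)
    let t : Fin N → Fin N → (DYHat N)⟦X⟧⟦X⟧ := fun i j =>
      PowerSeries.mk fun r => PowerSeries.C (extT i j r : DYHat N)
    evalSub (normSeries N) (PowerSeries.X - PowerSeries.C z) *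
        (t i j * PowerSeries.C (plusHat k l) -
          invSub (PowerSeries.X - PowerSeries.C z) * (t k j * PowerSeries.C (plusHat i l))) =
      evalSub (normSeries N) (PowerSeries.X + PowerSeries.C z) *
        (PowerSeries.C (plusHat k l) * t i j -
          invSub (PowerSeries.X + PowerSeries.C z) * (PowerSeries.C (plusHat k j) * t i l)) := by
  intro z t
  have h : seriesMap (seriesMap (freeToHat N)) (Free.mixedL i j k l) =
      seriesMap (seriesMap (freeToHat N)) (Free.mixedR i j k l) := by
    ext r s
    rw [coeff_seriesMap, coeff_seriesMap, coeff_seriesMap, coeff_seriesMap]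
    exact freeToHat_rel (Rel.mixed i j k l r s)
  simpa only [Free.mixedL, Free.mixedR, map_mul, map_sub, map_add, seriesMap_evalSub,
    seriesMap_invSub, seriesMap_tSeries, seriesMap_tPlusSeries, Free.argL, Free.argR,
    seriesMap_X, seriesMap_C] using h

end Relations

/-! ### The action on the vacuum module at the critical level -/

section Poles

/-- The scalar series `(z - u - c - N/2)⁻¹`. -/
def leftPole (N : ℕ) (c : ℂ) : ℂ⟦X⟧⟦X⟧ := invSub (PowerSeries.X + PowerSeries.C (c + N / 2))

/-- The scalar series `(z - u - c + N/2)⁻¹`. -/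
def rightPole (N : ℕ) (c : ℂ) : ℂ⟦X⟧⟦X⟧ := invSub (PowerSeries.X + PowerSeries.C (c - N / 2))

theorem coeff_zero_leftPole (N : ℕ) (c : ℂ) : PowerSeries.coeff 0 (leftPole N c) = 0 :=
  coeff_zero_invSub _

theorem isUnit_one_sub_leftPole_sq (N : ℕ) (c : ℂ) : IsUnit (1 - leftPole N c ^ 2) := by
  refine isUnit_of_constantCoeff_eq_one ?_
  rw [map_sub, pow_two, PowerSeries.coeff_mul, Finset.Nat.antidiagonal_zero,
    Finset.sum_singleton, coeff_zero_leftPole, zero_mul, sub_zero, PowerSeries.coeff_one,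
    if_pos rfl]

end Poles

section Vacuum

variable (N : ℕ) [NeZero N]

attribute [local instance] seriesAlgebra

/-- The algebra of endomorphisms of the vacuum module at the critical level. -/
abbrev VacuumEnd : Type := Module.End ℂ (VacuumModule N (-(N : ℂ)))

/-- The action of the extended double Yangian on the vacuum module at the critical level. -/
def vacuumAction : extendedDY N →ₐ[ℂ] VacuumEnd N := Algebra.lsmul ℂ ℂ _

theorem vacuumAction_apply (x : extendedDY N) (v : VacuumModule N (-(N : ℂ))) :
    vacuumAction N x v = x • v := rfl

theorem toHat_central_commute (x : DYHat N) :
    toHat N DY.central * x = x * toHat N DY.central := by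
  induction x using UniformSpace.Completion.induction_on with
  | hp =>
    exact isClosed_eq (continuous_const.mul continuous_id)
      (continuous_id.mul continuous_const)
  | ih x =>
    change toHat N DY.central * toHat N x = toHat N x * toHat N DY.central
    rw [← map_mul, ← map_mul, DY.central_mul]

theorem vacuumAction_central :
    vacuumAction N extCentral = algebraMap ℂ (VacuumEnd N) (-(N : ℂ)) := by
  ext v
  obtain ⟨x, rfl⟩ := Submodule.Quotient.mk_surjective (vacuumIdeal N (-(N : ℂ))) v
  change Submodule.Quotient.mk (extCentral * x) = Submodule.Quotient.mk (-(N : ℂ) • x)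
  rw [Submodule.Quotient.eq]
  have h : extCentral * x - -(N : ℂ) • x =
      x • (extCentral - algebraMap ℂ (extendedDY N) (-(N : ℂ))) := by
    have hc : extCentral * x = x * extCentral := Subtype.ext (toHat_central_commute N x)
    rw [smul_eq_mul, mul_sub, hc, Algebra.smul_def, Algebra.commutes]
  rw [h]
  exact Submodule.smul_mem _ _ (Submodule.subset_span (Set.mem_insert _ _))

variable {N}

/-- The series `t_{ij}(z)` acting on the vacuum module, as a series in `z⁻¹` (outer variable)
over series in `u`. -/
def posSeries (i j : Fin N) : (VacuumEnd N)⟦X⟧⟦X⟧ :=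
  PowerSeries.mk fun r => PowerSeries.C (vacuumAction N (extT i j r))

/-- The matrix `T⁺(u + c)` acting on the vacuum module. -/
def plusSeries (c : ℂ) : Matrix (Fin N) (Fin N) (VacuumEnd N)⟦X⟧ :=
  (dualSeries c).map (seriesMap ((vacuumAction N).comp dualToExtended))

theorem seriesMap_map_C {S S' : Type*} [Ring S] [Algebra ℂ S] [Ring S'] [Algebra ℂ S']
    (φ : S →ₐ[ℂ] S') (f : S⟦X⟧) : seriesMap (seriesMap φ) (PowerSeries.map PowerSeries.C f) =
      PowerSeries.map PowerSeries.C (seriesMap φ f) := by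
  ext1 n
  rw [coeff_seriesMap, PowerSeries.coeff_map, PowerSeries.coeff_map, seriesMap_C, coeff_seriesMap]

theorem seriesMap_map_extendedDY (f : (dualYangianHat N)⟦X⟧) :
    seriesMap (extendedDY N).val (seriesMap dualToExtended f) =
      seriesMap (dualYangianHat N).val f := rfl

theorem varDiff_add_smul {S : Type*} [Ring S] [Algebra ℂ S] (e : ℤ) (x : S⟦X⟧⟦X⟧) :
    (varDiff + (e : ℂ⟦X⟧⟦X⟧)) • x = (PowerSeries.X - PowerSeries.C PowerSeries.X +
      PowerSeries.C (PowerSeries.C (algebraMap ℂ S e))) * x := by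
  rw [series_smul_def, varDiff, map_add, map_sub, PowerSeries.map_X, PowerSeries.map_C, map_intCast]
  congr 3
  · congr 1
    exact PowerSeries.map_X _
  · rw [map_intCast, map_intCast, map_intCast]

theorem plusSeries_relation {m : ℕ} (c : Fin m → ℤ) (a k : Fin m) (i j r l : Fin N) :
    (varDiff + ((c k - c a : ℤ) : ℂ⟦X⟧⟦X⟧)) •
        (PowerSeries.C (plusSeries (c a : ℂ) i j) *
            PowerSeries.map PowerSeries.C (plusSeries (c k : ℂ) r l) -
          PowerSeries.map PowerSeries.C (plusSeries (c k : ℂ) r l) *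
            PowerSeries.C (plusSeries (c a : ℂ) i j)) =
      PowerSeries.C (plusSeries (c a : ℂ) i l) *
          PowerSeries.map PowerSeries.C (plusSeries (c k : ℂ) r j) -
        PowerSeries.map PowerSeries.C (plusSeries (c k : ℂ) i l) *
          PowerSeries.C (plusSeries (c a : ℂ) r j) := by
  have h := dual_relation_shift (isShift_dualSeries (c a : ℂ) i j)
    (isShift_dualSeries (c k : ℂ) r l) (isShift_dualSeries (c a : ℂ) i l)
    (isShift_dualSeries (c k : ℂ) r j) (isShift_dualSeries (c k : ℂ) i l)
    (isShift_dualSeries (c a : ℂ) r j) (plusHat_relation i j r l)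
  set d : Fin m → Matrix (Fin N) (Fin N) (dualYangianHat N)⟦X⟧ :=
    fun a => dualSeries (c a : ℂ) with hd
  have h' : (PowerSeries.X - PowerSeries.C PowerSeries.X + PowerSeries.C (PowerSeries.C
        (algebraMap ℂ (dualYangianHat N) ((c k - c a : ℤ) : ℂ)))) *
          (PowerSeries.C (d a i j) * PowerSeries.map PowerSeries.C (d k r l) -
            PowerSeries.map PowerSeries.C (d k r l) * PowerSeries.C (d a i j)) =
      PowerSeries.C (d a i l) * PowerSeries.map PowerSeries.C (d k r j) -
        PowerSeries.map PowerSeries.C (d k i l) * PowerSeries.C (d a r j) := by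
    refine seriesMap_injective (seriesMap_injective
      (φ := (dualYangianHat N).val) Subtype.val_injective) ?_
    simp only [map_mul, map_sub, map_add, seriesMap_map_C, seriesMap_C, seriesMap_X,
      AlgHom.commutes, Int.cast_sub] at h ⊢
    exact h
  have h2 := congrArg (seriesMap (seriesMap ((vacuumAction N).comp dualToExtended))) h'
  have hp : ∀ (a : Fin m) (i j : Fin N),
      seriesMap ((vacuumAction N).comp dualToExtended) (d a i j) =
      plusSeries (c a : ℂ) i j := fun _ _ _ => rfl
  rw [varDiff_add_smul]
  simpa only [hp, map_mul, map_sub, map_add, seriesMap_map_C, seriesMap_C, seriesMap_X,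
    AlgHom.commutes] using h2

theorem evalSub_normSeries_sub (c : ℂ) :
    evalSub (normSeries N) (PowerSeries.X + PowerSeries.C (c - N / 2) : ℂ⟦X⟧) =
      evalSub (normSeries N) (PowerSeries.X + PowerSeries.C (c + N / 2) : ℂ⟦X⟧) *
        (1 - leftPole N c ^ 2) := by
  have h : (PowerSeries.X + PowerSeries.C (c - N / 2) : ℂ⟦X⟧) =
      PowerSeries.X + PowerSeries.C (c + N / 2) + algebraMap ℂ ℂ⟦X⟧ (-(N : ℂ)) := by
    rw [add_assoc, PowerSeries.algebraMap_apply, ← map_add, Algebra.algebraMap_self_apply]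
    congr 2
    ring
  rw [h, evalSub_normSeries, leftPole]

/-- The mixed relation on the vacuum module at the critical level, before the cancellation of the
normalizing series. -/
theorem vacuum_mixed_relation_aux (c : ℂ) (i j k l : Fin N) :
    evalSub (normSeries N) (PowerSeries.X + PowerSeries.C (c + N / 2) : ℂ⟦X⟧) •
        (posSeries i j * PowerSeries.C (plusSeries c k l) -
          leftPole N c • (posSeries k j * PowerSeries.C (plusSeries c i l))) =
      evalSub (normSeries N) (PowerSeries.X + PowerSeries.C (c - N / 2) : ℂ⟦X⟧) •
        (PowerSeries.C (plusSeries c k l) * posSeries i j -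
          rightPole N c • (PowerSeries.C (plusSeries c k j) * posSeries i l)) := by
  have h := mixed_relation_shift (c := c) (normSeries N) _ (isShift_dualSeries c k l)
    (isShift_dualSeries c i l) (isShift_dualSeries c k l) (isShift_dualSeries c k j)
    (mixed_relation_hat i j k l)
  have hz : freeToHat N ((1 / 2 : ℂ) • Free.central) =
      (extendedDY N).val ((1 / 2 : ℂ) • extCentral) := by
    rw [map_smul, map_smul]
    rfl
  rw [hz] at h
  set e : Fin N → Fin N → (extendedDY N)⟦X⟧ := fun i j =>
    seriesMap dualToExtended (dualSeries c i j)
    with he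
  have h' : evalSub (normSeries N) (PowerSeries.X + PowerSeries.C (algebraMap ℂ (extendedDY N) c) -
          PowerSeries.C ((1 / 2 : ℂ) • extCentral)) *
        (PowerSeries.mk (fun r => PowerSeries.C (extT i j r)) * PowerSeries.C (e k l) -
          invSub (PowerSeries.X + PowerSeries.C (algebraMap ℂ (extendedDY N) c) -
            PowerSeries.C ((1 / 2 : ℂ) • extCentral)) *
              (PowerSeries.mk (fun r => PowerSeries.C (extT k j r)) * PowerSeries.C (e i l))) =
      evalSub (normSeries N) (PowerSeries.X + PowerSeries.C (algebraMap ℂ (extendedDY N) c) +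
          PowerSeries.C ((1 / 2 : ℂ) • extCentral)) *
        (PowerSeries.C (e k l) * PowerSeries.mk (fun r => PowerSeries.C (extT i j r)) -
          invSub (PowerSeries.X + PowerSeries.C (algebraMap ℂ (extendedDY N) c) +
            PowerSeries.C ((1 / 2 : ℂ) • extCentral)) *
              (PowerSeries.C (e k j) * PowerSeries.mk (fun r => PowerSeries.C (extT i l r)))) := by
    refine seriesMap_injective (seriesMap_injective
      (φ := (extendedDY N).val) Subtype.val_injective) ?_
    have ht : ∀ i j, seriesMap (seriesMap (extendedDY N).val)
        (PowerSeries.mk fun r => PowerSeries.C (extT i j r)) =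
          PowerSeries.mk fun r => PowerSeries.C (extT i j r : DYHat N) := fun i j => by
      ext1 r
      rw [coeff_seriesMap, PowerSeries.coeff_mk, PowerSeries.coeff_mk, seriesMap_C]
      rfl
    simp only [map_mul, map_sub, map_add, seriesMap_evalSub, seriesMap_invSub, seriesMap_C,
      seriesMap_X, AlgHom.commutes, ht, he, seriesMap_map_extendedDY] at h ⊢
    exact h
  have h2 := congrArg (seriesMap (seriesMap (vacuumAction N))) h'
  have ht : ∀ i j, seriesMap (seriesMap (vacuumAction N))
      (PowerSeries.mk fun r => PowerSeries.C (extT i j r)) = posSeries i j := fun i j => by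
    ext1 r
    rw [coeff_seriesMap, posSeries, PowerSeries.coeff_mk, PowerSeries.coeff_mk, seriesMap_C]
  have he' : ∀ i j, seriesMap (vacuumAction N) (e i j) = plusSeries c i j := fun i j => rfl
  simp only [map_mul, map_sub, map_add, seriesMap_evalSub, seriesMap_invSub, seriesMap_C,
      seriesMap_X, AlgHom.commutes, ht, he', map_smul, vacuumAction_central] at h2
  have map_smul_end : ∀ a b : ℂ, algebraMap ℂ (VacuumEnd N) (a • b) =
      a • algebraMap ℂ (VacuumEnd N) b := fun a b => by
    rw [smul_eq_mul, map_mul, Algebra.smul_def]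
  have hL : (PowerSeries.X + PowerSeries.C (algebraMap ℂ (VacuumEnd N) c) -
      PowerSeries.C ((1 / 2 : ℂ) • algebraMap ℂ (VacuumEnd N) (-(N : ℂ)))) =
        seriesMap (Algebra.ofId ℂ (VacuumEnd N)) (PowerSeries.X + PowerSeries.C (c + N / 2)) := by
    rw [map_add, seriesMap_X, seriesMap_C, add_sub_assoc, ← map_sub PowerSeries.C, ← map_smul_end,
      ← map_sub, Algebra.ofId_apply]
    congr 3
    rw [smul_eq_mul]
    ring
  have hR : (PowerSeries.X + PowerSeries.C (algebraMap ℂ (VacuumEnd N) c) +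
      PowerSeries.C ((1 / 2 : ℂ) • algebraMap ℂ (VacuumEnd N) (-(N : ℂ)))) =
        seriesMap (Algebra.ofId ℂ (VacuumEnd N)) (PowerSeries.X + PowerSeries.C (c - N / 2)) := by
    rw [map_add, seriesMap_X, seriesMap_C, add_assoc, ← map_add PowerSeries.C, ← map_smul_end,
      ← map_add, Algebra.ofId_apply]
    congr 3
    rw [smul_eq_mul]
    ring
  rw [hL, hR, ← seriesMap_evalSub, ← seriesMap_evalSub, ← seriesMap_invSub,
    ← seriesMap_invSub] at h2
  exact h2

theorem eq_of_reflection {K M : Type*} [CommRing K] [Ring M] [Algebra K M] {y y' : K}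
    {a b p q r s : M} (hu : IsUnit (1 - y ^ 2)) (h₁ : a - y • b = (1 - y ^ 2) • (p - y' • q))
    (h₂ : b - y • a = (1 - y ^ 2) • (r - y' • s)) :
    a = p + y • r - y' • q - (y * y') • s := by
  refine hu.smul_left_cancel.1 ?_
  have h₃ : (1 - y ^ 2) • a = (a - y • b) + y • (b - y • a) := by module
  rw [h₃, h₁, h₂]
  module

/-- The mixed relation on the vacuum module at the critical level. The normalizing series cancels,
because the arguments of the two `R`-matrices differ by `N`. -/
theorem vacuum_mixed_relation (c : ℂ) (i j k l : Fin N) :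
    posSeries i j * PowerSeries.C (plusSeries c k l) =
      PowerSeries.C (plusSeries c k l) * posSeries i j +
        leftPole N c • (PowerSeries.C (plusSeries c i l) * posSeries k j) -
        rightPole N c • (PowerSeries.C (plusSeries c k j) * posSeries i l) -
        (leftPole N c * rightPole N c) • (PowerSeries.C (plusSeries c i j) * posSeries k l) := by
  have hu := isUnit_evalSub_normSeries N (PowerSeries.X + PowerSeries.C (c + N / 2) : ℂ⟦X⟧)
  have key : ∀ i k, posSeries i j * PowerSeries.C (plusSeries c k l) -
          leftPole N c • (posSeries k j * PowerSeries.C (plusSeries c i l)) =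
        (1 - leftPole N c ^ 2) • (PowerSeries.C (plusSeries c k l) * posSeries i j -
          rightPole N c • (PowerSeries.C (plusSeries c k j) * posSeries i l)) := by
    intro i k
    have h := vacuum_mixed_relation_aux c i j k l
    rw [evalSub_normSeries_sub, mul_smul] at h
    exact hu.smul_left_cancel.1 h
  exact eq_of_reflection (K := ℂ⟦X⟧⟦X⟧) (M := (VacuumEnd N)⟦X⟧⟦X⟧)
    (isUnit_one_sub_leftPole_sq N c) (key i k) (key k i)

end Vacuum

/-! ### Weight vectors and ordered products of `R`-matrices -/

section Weights

variable {K R : Type*} [CommRing K] [Ring R] [Algebra K R] {m : ℕ}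
  {π : MonoidAlgebra ℂ (Equiv.Perm (Fin m)) →+* R} {c : Fin m → ℤ}

/-- An element of weight `c` is fixed by the idempotent generating the weight space. The elements
`z` of the group algebra with `Z π(z) = 0` form a right ideal, generated by a self-adjoint
idempotent `e`. It contains all `x_a - c_a`, so that `1 - e` has weight `c`, and
`Z = Z π(1 - e)`. -/
theorem IsWeight.mul_weightIdem {Z : R} (hZ : IsWeight π c m Z) : Z * π (weightIdem c) = Z := by
  -- the left ideal corresponding to the right ideal of these `z` under the star
  let L : Submodule ℂ (MonoidAlgebra ℂ (Equiv.Perm (Fin m))) :=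
    { carrier := {z | Z * π (groupStar z) = 0}
      zero_mem' := by simp [groupStar_zero]
      add_mem' := fun {x y} hx hy => by
        simp only [Set.mem_ofPred_eq] at hx hy ⊢
        rw [groupStar_add, map_add, mul_add, hx, hy, add_zero]
      smul_mem' := fun r x hx => by
        simp only [Set.mem_ofPred_eq] at hx ⊢
        rw [groupStar_smul, ← mul_one (groupStar x), ← mul_smul_comm, map_mul, ← mul_assoc, hx,
          zero_mul] }
  obtain ⟨e, heL, hes, he⟩ := exists_selfAdjoint_idempotent L fun g z hz => by
    change Z * π (groupStar z) = 0 at hz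
    change Z * π (groupStar _) = 0
    rw [groupStar_mul, map_mul, ← mul_assoc, hz, zero_mul]
  have hstar : ∀ a, groupStar (jucysMurphy a - (c a : ℂ) • 1) = jucysMurphy a - (c a : ℂ) • 1 := by
    intro a
    have h1 : groupStar (1 : MonoidAlgebra ℂ (Equiv.Perm (Fin m))) = 1 := by
      rw [← map_one (MonoidAlgebra.of ℂ _), groupStar_of, inv_one]
    rw [groupStar_sub, groupStar_smul, groupStar_jucysMurphy, h1, map_intCast]
  have hmem : ∀ a, jucysMurphy a - (c a : ℂ) • 1 ∈ L := by
    intro a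
    change Z * π (groupStar _) = 0
    rw [hstar, map_sub, mul_sub, hZ a a.2, Int.cast_smul_eq_zsmul, map_zsmul, map_one,
      mul_smul_comm, mul_one, sub_self]
  have hweight : 1 - e ∈ weightSpace c := by
    intro a
    have h := congrArg groupStar (he _ (hmem a))
    rw [groupStar_mul, hes, hstar] at h
    have h2 : (1 - e) * (jucysMurphy a - (c a : ℂ) • 1) = 0 := by rw [sub_mul, one_mul, h, sub_self]
    rwa [mul_sub, mul_smul_comm, mul_one, sub_eq_zero] at h2
  have h1 : Z * π (1 - e) = Z := by
    have h2 : Z * π (groupStar e) = 0 := heL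
    rw [map_sub, map_one, mul_sub, mul_one, ← hes, h2, sub_zero]
  have h3 := congrArg π (DoubleYangianGL.mul_weightIdem hweight)
  rw [map_mul] at h3
  calc Z * π (weightIdem c) = Z * π (1 - e) * π (weightIdem c) := by rw [h1]
    _ = Z := by rw [mul_assoc, h3, h1]

theorem isWeight_weightIdem (n : ℕ) : IsWeight π c n (π (weightIdem c)) :=
  isWeight_of_mem_weightSpace π (weightIdem_mem c) n

variable {q : Fin m → R}
  (hswap : ∀ a b e : Fin m, swapElt π a b * q e = q (Equiv.swap a b e) * swapElt π a b)
  (hmul : ∀ a k : Fin m, a < k → q k * q a = swapElt π a k * q k)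

include hswap in
theorem commute_sum_jucysMurphy (a : Fin m) : Commute (∑ e, q e) (π (jucysMurphy a)) := by
  refine commute_jucysMurphy_of_swap π fun b _ => ?_
  rw [commute_iff_eq, Finset.mul_sum, Finset.sum_mul]
  simp only [hswap]
  exact (Equiv.sum_comp (Equiv.swap b a) fun e => q e * swapElt π b a).symm

include hswap hmul in
/-- The ordered product of the `R`-matrices `1 - α_a q_a` is linear in `∑ q_a` on the weight
space. -/
theorem weightIdem_mul_bwdProd {ξ : K} {α : Fin m → K} (hα : ∀ a, α a * (1 - c a * ξ) = ξ) :
    π (weightIdem c) * bwdProd (extendOne fun a => 1 - α a • q a) m =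
      π (weightIdem c) * (1 - ξ • ∑ a, q a) := by
  have h := IsWeight.mul_bwdProd (K := K) π (c := c) (q := q) (γ := 1) (δ := ξ) (α := α)
    (β := fun _ => 1) hmul (fun a b k hab hbk => ?_) (fun a => by rw [hα, one_mul]) le_rfl
    _ (isWeight_weightIdem m)
  · simpa [firstLetters] using h
  · rw [commute_iff_eq, hswap, Equiv.swap_apply_of_ne_of_ne (hab.trans hbk).ne' hbk.ne']

include hswap hmul in
/-- The ordered product of the `R`-matrices `1 - α_a q_a` is block triangular with respect to the
weight space, because `∑ q_a` commutes with the Jucys–Murphy elements. -/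
theorem weightIdem_mul_bwdProd_mul_weightIdem {ξ : K} {α : Fin m → K}
    (hα : ∀ a, α a * (1 - c a * ξ) = ξ) :
    π (weightIdem c) * bwdProd (extendOne fun a => 1 - α a • q a) m * π (weightIdem c) =
      π (weightIdem c) * bwdProd (extendOne fun a => 1 - α a • q a) m := by
  refine IsWeight.mul_weightIdem ?_
  rw [weightIdem_mul_bwdProd hswap hmul hα]
  refine (isWeight_weightIdem m).mul_right fun a _ => ?_
  exact (Commute.one_left _).sub_left ((commute_sum_jucysMurphy hswap a).smul_left _)

theorem bwdProd_mul_fwdProd {f g : ℕ → R} {κ : ℕ → K} (h : ∀ a, f a * g a = κ a • 1) (n : ℕ) :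
    bwdProd f n * fwdProd g n = (∏ a ∈ Finset.range n, κ a) • 1 := by
  induction n with
  | zero => simp [bwdProd, fwdProd]
  | succ n ih =>
    rw [bwdProd, fwdProd, mul_assoc, ← mul_assoc (bwdProd f n), ih, smul_mul_assoc, one_mul,
      mul_smul_comm, h, smul_smul, Finset.prod_range_succ]

include hswap hmul in
/-- The ordered product of the `R`-matrices `1 + α_a q_a` is block triangular with respect to the
weight space: up to a scalar it is inverse to the product of the `1 - α_a q_a`, which is
injective on the weight space by `hreg`. -/
theorem weightIdem_mul_fwdProd_mul_weightIdem (hsq : ∀ a, q a * q a = 1) {ξ : K} {α : Fin m → K}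
    (hα : ∀ a, α a * (1 - c a * ξ) = ξ) (hreg : ∀ x z : R, z = ξ • (x * z) → z = 0) :
    π (weightIdem c) * fwdProd (extendOne fun a => 1 + α a • q a) m * π (weightIdem c) =
      π (weightIdem c) * fwdProd (extendOne fun a => 1 + α a • q a) m := by
  set P := π (weightIdem c) with hP
  set A := fwdProd (extendOne fun a => 1 + α a • q a) m with hA
  set D := bwdProd (extendOne fun a => 1 - α a • q a) m with hD
  have hPP : P * P = P := by rw [hP, ← map_mul, weightIdem_mul_self]
  have hPD : P * D = P * (1 - ξ • ∑ a, q a) := weightIdem_mul_bwdProd hswap hmul hα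
  have hPDP : P * D * P = P * D := weightIdem_mul_bwdProd_mul_weightIdem hswap hmul hα
  obtain ⟨κ, hκ⟩ : ∃ κ : K, D * A = κ • 1 := by
    refine ⟨_, bwdProd_mul_fwdProd (κ := extendOne fun a : Fin m => 1 - α a * α a) (fun a => ?_) m⟩
    by_cases ha : a < m
    · rw [extendOne_of_lt _ ha, extendOne_of_lt _ ha, extendOne_of_lt _ ha, sub_mul, one_mul,
        mul_add, mul_one, smul_mul_smul_comm, hsq, sub_smul, one_smul]
      abel
    · rw [extendOne, extendOne, extendOne, dif_neg ha, dif_neg ha, dif_neg ha, one_smul, mul_one]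
  have h1 : P * D * (P * A * (1 - P)) = 0 := by
    calc P * D * (P * A * (1 - P)) = P * D * P * (A * (1 - P)) := by simp only [mul_assoc]
      _ = P * (D * A) * (1 - P) := by rw [hPDP]; simp only [mul_assoc]
      _ = 0 := by
        rw [hκ, mul_smul_comm, mul_one, smul_mul_assoc, mul_sub, mul_one, hPP, sub_self, smul_zero]
  rw [hPD, mul_sub, mul_one, sub_mul, sub_eq_zero, ← mul_assoc, ← mul_assoc, hPP] at h1
  rw [mul_smul_comm, smul_mul_assoc] at h1
  have h2 := hreg (P * ∑ a, q a) (P * A * (1 - P)) h1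
  rw [mul_sub, mul_one, sub_eq_zero] at h2
  exact h2.symm

end Weights

section Exchange

variable {R : Type*} [Monoid R]

/-- Moving an element to the right of an ordered product by means of exchange relations
`t f_a = α_a f_a t β_a`. -/
theorem mul_fwdProd_of_exchange {t : R} {f α β : ℕ → R} {n : ℕ}
    (h : ∀ a < n, t * f a = α a * f a * t * β a)
    (hα : ∀ a < n, ∀ b < n, a ≠ b → Commute (f a) (α b))
    (hβ : ∀ a < n, ∀ b < n, a ≠ b → Commute (f a) (β b)) :
    t * fwdProd f n = fwdProd α n * fwdProd f n * t * bwdProd β n := by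
  induction n with
  | zero => simp [fwdProd, bwdProd]
  | succ n ih =>
    have h1 : Commute (f n) (bwdProd β n) :=
      commute_bwdProd fun a ha => hβ n (by omega) a (by omega) (by omega)
    have h2 : Commute (α n) (fwdProd f n) :=
      commute_fwdProd fun a ha => (hα a (by omega) n (by omega) (by omega)).symm
    calc t * (fwdProd f n * f n) = t * fwdProd f n * f n := (mul_assoc _ _ _).symm
      _ = fwdProd α n * fwdProd f n * (t * (bwdProd β n * f n)) := by
          rw [ih (fun a ha => h a (by omega)) (fun a ha b hb => hα a (by omega) b (by omega))
            fun a ha b hb => hβ a (by omega) b (by omega)]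
          simp only [mul_assoc]
      _ = fwdProd α n * fwdProd f n * (t * f n * bwdProd β n) := by
          rw [← h1.eq]; simp only [mul_assoc]
      _ = fwdProd α n * (fwdProd f n * α n) * f n * t * β n * bwdProd β n := by
          rw [h n (by omega)]; simp only [mul_assoc]
      _ = fwdProd α n * α n * (fwdProd f n * f n) * t * (β n * bwdProd β n) := by
          rw [← h2.eq]; simp only [mul_assoc]

end Exchange

/-! ### An auxiliary tensor factor -/

section CentralEntries

variable {S : Type*} [Ring S] {n : Type*}

/-- The entries of the matrix lie in the centre. -/
def HasCentralEntries (Q : Matrix n n S) : Prop := ∀ i j s, Commute (Q i j) s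

theorem HasCentralEntries.sub {Q Q' : Matrix n n S} (h : HasCentralEntries Q)
    (h' : HasCentralEntries Q') : HasCentralEntries (Q - Q') := fun i j s =>
  (h i j s).sub_left (h' i j s)

theorem HasCentralEntries.mul [Fintype n] {Q Q' : Matrix n n S} (h : HasCentralEntries Q)
    (h' : HasCentralEntries Q') : HasCentralEntries (Q * Q') := fun i j s => by
  rw [Matrix.mul_apply]
  exact Commute.sum_left _ _ _ fun k _ => (h i k s).mul_left (h' k j s)

theorem HasCentralEntries.sum {ι : Type*} (s : Finset ι) {Q : ι → Matrix n n S}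
    (h : ∀ i ∈ s, HasCentralEntries (Q i)) : HasCentralEntries (∑ i ∈ s, Q i) := fun i j x => by
  rw [Matrix.sum_apply]
  exact Commute.sum_left _ _ _ fun k hk => h k hk i j x

theorem HasCentralEntries.one [DecidableEq n] : HasCentralEntries (1 : Matrix n n S) :=
  fun i j s => by
    rw [Matrix.one_apply]
    split_ifs
    · exact Commute.one_left s
    · exact Commute.zero_left s

theorem HasCentralEntries.zero : HasCentralEntries (0 : Matrix n n S) :=
  fun _ _ s => Commute.zero_left s

theorem HasCentralEntries.smul {K : Type*} [CommRing K] [Algebra K S] {Q : Matrix n n S}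
    (h : HasCentralEntries Q) (c : K) : HasCentralEntries (c • Q) :=
  fun i j s => (h i j s).smul_left c

variable [Fintype n]

theorem HasCentralEntries.trace_mul_comm {Q : Matrix n n S} (h : HasCentralEntries Q)
    (X : Matrix n n S) : Matrix.trace (X * Q) = Matrix.trace (Q * X) := by
  simp only [Matrix.trace, Matrix.diag_apply, Matrix.mul_apply]
  rw [Finset.sum_comm]
  exact Finset.sum_congr rfl fun i _ => Finset.sum_congr rfl fun j _ => ((h i j _).eq).symm

theorem HasCentralEntries.mul_scalar [DecidableEq n] {Q : Matrix n n S} (h : HasCentralEntries Q)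
    (s : S) : Matrix.scalar n s * Q = Q * Matrix.scalar n s := by
  ext i j
  rw [Matrix.scalar_apply, Matrix.diagonal_mul, Matrix.mul_diagonal]
  exact (h i j s).eq.symm

theorem trace_mul_scalar [DecidableEq n] (X : Matrix n n S) (s : S) :
    Matrix.trace (X * Matrix.scalar n s) = Matrix.trace X * s := by
  simp only [Matrix.trace, Matrix.diag_apply, Matrix.scalar_apply, Matrix.mul_diagonal,
    Finset.sum_mul]

theorem trace_scalar_mul [DecidableEq n] (X : Matrix n n S) (s : S) :
    Matrix.trace (Matrix.scalar n s * X) = s * Matrix.trace X := by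
  simp only [Matrix.trace, Matrix.diag_apply, Matrix.scalar_apply, Matrix.diagonal_mul,
    Finset.mul_sum]

variable [DecidableEq n]

/-- If `T X = A X T B`, with `A` and `B` block triangular with respect to the idempotent `P`
and inverse to each other in the crossed sense, then the trace of `P X` is invariant under `T`, up
to the left ideal generated by the entries of `T - 1`. -/
theorem mul_trace_sub_mem {p : Type*} [Fintype p] [DecidableEq p] {J : Ideal S} {t : p → p → S}
    (ht : ∀ k l, t k l - (if k = l then 1 else 0) ∈ J) {P X : Matrix n n S}
    {A B : Matrix p p (Matrix n n S)} (hP : HasCentralEntries P)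
    (hB : ∀ i j, HasCentralEntries (B i j))
    (hTX : (Matrix.of fun i j => Matrix.scalar n (t i j)) * Matrix.scalar p X =
      A * Matrix.scalar p X * (Matrix.of fun i j => Matrix.scalar n (t i j)) * B)
    (hPP : P * P = P) (hPX : P * X * P = P * X)
    (hPA : Matrix.scalar p P * A * Matrix.scalar p P = Matrix.scalar p P * A)
    (hPB : Matrix.scalar p P * B * Matrix.scalar p P = Matrix.scalar p P * B)
    (hAB : ∀ i j, ∑ k, B k j * A i k = if i = j then 1 else 0) (i j : p) :
    t i j * Matrix.trace (P * X) - (if i = j then Matrix.trace (P * X) else 0) ∈ J := by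
  have hPA' : ∀ i j, P * A i j * P = P * A i j := fun i j => by
    have h := congrFun (congrFun hPA i) j
    rwa [Matrix.scalar_apply, Matrix.mul_diagonal, Matrix.diagonal_mul] at h
  have hPB' : ∀ i j, P * B i j * P = P * B i j := fun i j => by
    have h := congrFun (congrFun hPB i) j
    rwa [Matrix.scalar_apply, Matrix.mul_diagonal, Matrix.diagonal_mul] at h
  have hs : ∀ Y : Matrix n n S, Matrix.scalar p Y = Matrix.diagonal fun _ => Y :=
    fun Y => Matrix.scalar_apply Y
  have h1 : t i j * Matrix.trace (P * X) =
      ∑ l, ∑ k, Matrix.trace (P * A i k * X * B l j) * t k l := by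
    rw [← trace_scalar_mul, ← mul_assoc, hP.mul_scalar, mul_assoc]
    have h2 : Matrix.scalar n (t i j) * X =
        ∑ l, ∑ k, A i k * X * Matrix.scalar n (t k l) * B l j := by
      have e1 : ((Matrix.of fun i j => Matrix.scalar n (t i j)) * Matrix.scalar p X) i j =
          Matrix.scalar n (t i j) * X := by
        rw [hs, Matrix.mul_diagonal, Matrix.of_apply]
      rw [← e1, hTX, Matrix.mul_apply]
      refine Finset.sum_congr rfl fun l _ => ?_
      rw [Matrix.mul_apply, Finset.sum_mul]
      refine Finset.sum_congr rfl fun k _ => ?_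
      rw [hs, Matrix.mul_diagonal, Matrix.of_apply]
    rw [h2, Finset.mul_sum, Matrix.trace_sum]
    refine Finset.sum_congr rfl fun l _ => ?_
    rw [Finset.mul_sum, Matrix.trace_sum]
    refine Finset.sum_congr rfl fun k _ => ?_
    rw [← trace_mul_scalar, mul_assoc (P * A i k * X), ← (hB l j).mul_scalar]
    simp only [mul_assoc]
  have h2 : ∑ k, Matrix.trace (P * A i k * X * B k j) =
      if i = j then Matrix.trace (P * X) else 0 := by
    have e1 : ∀ k, Matrix.trace (P * A i k * X * B k j) =
        Matrix.trace (P * (B k j * A i k) * (P * X)) := fun k => by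
      have e2 : P * A i k * X * B k j = P * A i k * (P * X) * (P * B k j * P) := by
        rw [hPB', ← mul_assoc _ P (B k j), mul_assoc _ (P * X) P, hPX, ← mul_assoc _ P X, hPA']
      rw [e2, ((hP.mul (hB k j)).mul hP).trace_mul_comm]
      congr 1
      calc P * B k j * P * (P * A i k * (P * X)) = P * B k j * (P * P) * A i k * (P * X) := by
            simp only [mul_assoc]
        _ = P * (B k j * A i k) * (P * X) := by rw [hPP, hPB']; simp only [mul_assoc]
    rw [Finset.sum_congr rfl fun k _ => e1 k, ← Matrix.trace_sum, ← Finset.sum_mul,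
      ← Finset.mul_sum, hAB]
    split_ifs
    · rw [mul_one, ← mul_assoc, hPP]
    · rw [mul_zero, zero_mul, Matrix.trace_zero]
  have h3 : t i j * Matrix.trace (P * X) - (if i = j then Matrix.trace (P * X) else 0) =
      ∑ l, ∑ k, Matrix.trace (P * A i k * X * B l j) * (t k l - if k = l then 1 else 0) := by
    rw [h1, ← h2]
    simp only [mul_sub, Finset.sum_sub_distrib, mul_ite, mul_one, mul_zero, Finset.sum_ite_eq',
      Finset.mem_univ, if_true]
  rw [h3]
  exact sum_mem fun l _ => sum_mem fun k _ => J.mul_mem_left _ (ht k l)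

end CentralEntries

section Auxiliary

variable {K S : Type*} [CommRing K] [Ring S] [Algebra K S] [Algebra ℂ S] {N m : ℕ}

theorem HasCentralEntries.inFactor {S : Type*} [Ring S] {a : Fin m} {M : Matrix (Fin N) (Fin N) S}
    (h : HasCentralEntries M) : HasCentralEntries (inFactor a M) := fun f g s => by
  classical
  rw [inFactor_apply]
  split_ifs
  · exact h _ _ s
  · exact Commute.zero_left s

theorem hasCentralEntries_single {S : Type*} [Ring S] (i j : Fin N) :
    HasCentralEntries (Matrix.single i j (1 : S)) := fun k l s => by
  rw [Matrix.single_apply]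
  split_ifs
  · exact Commute.one_left s
  · exact Commute.zero_left s

theorem hasCentralEntries_tensorRep (x : MonoidAlgebra ℂ (Equiv.Perm (Fin m))) :
    HasCentralEntries (tensorRep N m S x) := fun f g s => by
  rw [tensorRep_eq, Matrix.map_apply]
  exact Algebra.commutes _ _

/-- The action of the group algebra on `ℂ^N ⊗ (ℂ^N)^{⊗ m}` permuting the last `m` factors. Matrices
over `S` of this size are written as `N × N` matrices of matrices. -/
def auxRep (N m : ℕ) (S : Type*) [Ring S] [Algebra ℂ S] :
    MonoidAlgebra ℂ (Equiv.Perm (Fin m)) →+*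
      Matrix (Fin N) (Fin N) (Matrix (Fin m → Fin N) (Fin m → Fin N) S) :=
  (Matrix.scalar (Fin N)).comp (tensorRep N m S)

theorem auxRep_apply (x : MonoidAlgebra ℂ (Equiv.Perm (Fin m))) :
    auxRep N m S x = Matrix.scalar (Fin N) (tensorRep N m S x) := rfl

/-- A matrix acting in the auxiliary factor and in the `a`-th factor. -/
def auxMatrix (a : Fin m) (H : Fin N → Fin N → Fin N → Fin N → S) :
    Matrix (Fin N) (Fin N) (Matrix (Fin m → Fin N) (Fin m → Fin N) S) :=
  Matrix.of fun i j => inFactor a (Matrix.of (H i j))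

/-- The permutation operator exchanging the auxiliary factor and the `a`-th factor. -/
def auxSwap (S : Type*) [Ring S] (a : Fin m) :
    Matrix (Fin N) (Fin N) (Matrix (Fin m → Fin N) (Fin m → Fin N) S) :=
  Matrix.of fun i j => inFactor a (Matrix.single j i 1)

theorem auxSwap_apply {S : Type*} [Ring S] (a : Fin m) (i j : Fin N) :
    auxSwap S a i j = inFactor a (Matrix.single j i 1) := rfl

theorem inFactor_sum {S : Type*} [Ring S] {ι : Type*} (s : Finset ι) (a : Fin m)
    (M : ι → Matrix (Fin N) (Fin N) S) :
    inFactor a (∑ i ∈ s, M i) = ∑ i ∈ s, inFactor a (M i) :=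
  map_sum (⟨⟨inFactor a, inFactor_zero a⟩, inFactor_add a⟩ :
    Matrix (Fin N) (Fin N) S →+ Matrix (Fin m → Fin N) (Fin m → Fin N) S) M s

theorem auxSwap_mul_auxMatrix {S : Type*} [Ring S] (a : Fin m)
    (H : Fin N → Fin N → Fin N → Fin N → S) :
    auxSwap S a * auxMatrix a H = auxMatrix a fun i j k l => H k j i l := by
  ext1 i j
  rw [Matrix.mul_apply]
  simp only [auxMatrix, auxSwap, Matrix.of_apply, inFactor_mul_inFactor_same]
  rw [← inFactor_sum]
  congr 1
  ext k l
  rw [Matrix.sum_apply, Finset.sum_eq_single k]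
  · rw [Matrix.single_mul_apply_same, one_mul, Matrix.of_apply, Matrix.of_apply]
  · intro b _ hb
    exact Matrix.single_mul_apply_of_ne _ _ _ _ _ hb.symm _
  · simp

theorem auxMatrix_mul_auxSwap {S : Type*} [Ring S] (a : Fin m)
    (H : Fin N → Fin N → Fin N → Fin N → S) :
    auxMatrix a H * auxSwap S a = auxMatrix a fun i j k l => H i l k j := by
  ext1 i j
  rw [Matrix.mul_apply]
  simp only [auxMatrix, auxSwap, Matrix.of_apply, inFactor_mul_inFactor_same]
  rw [← inFactor_sum]
  congr 1
  ext k l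
  rw [Matrix.sum_apply, Finset.sum_eq_single l]
  · rw [Matrix.mul_single_apply_same, mul_one, Matrix.of_apply, Matrix.of_apply]
  · intro b _ hb
    exact Matrix.mul_single_apply_of_ne _ _ _ _ _ hb.symm _
  · simp

theorem auxSwap_eq_auxMatrix {S : Type*} [Ring S] (a : Fin m) : auxSwap S a =
    auxMatrix a fun i j k l : Fin N => if j = k ∧ i = l then 1 else 0 := by
  ext1 i j
  rw [auxSwap, auxMatrix, Matrix.of_apply, Matrix.of_apply]
  congr 1

theorem auxSwap_mul_self {S : Type*} [Ring S] (a : Fin m) :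
    auxSwap (N := N) S a * auxSwap S a = 1 := by
  nth_rw 2 [auxSwap_eq_auxMatrix]
  rw [auxSwap_mul_auxMatrix]
  ext1 i j
  rw [auxMatrix, Matrix.of_apply, Matrix.one_apply]
  split_ifs with h
  · rw [← inFactor_one a]
    congr 1
    ext k l
    rw [Matrix.of_apply, Matrix.one_apply]
    exact if_congr (by simp [h]) rfl rfl
  · rw [← inFactor_zero a]
    congr 1
    ext k l
    rw [Matrix.of_apply, Matrix.zero_apply, if_neg fun h' => h h'.1.symm]

theorem swapElt_mul_auxSwap (a b e : Fin m) : swapElt (auxRep N m S) a b * auxSwap S e =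
    auxSwap S (Equiv.swap a b e) * swapElt (auxRep N m S) a b := by
  ext1 i j
  rw [swapElt, auxRep_apply, Matrix.scalar_apply, Matrix.diagonal_mul, Matrix.mul_diagonal,
    auxSwap_apply, auxSwap_apply, tensorRep_of_mul_inFactor]

theorem auxSwap_mul_auxSwap {a k : Fin m} (hak : a ≠ k) : auxSwap (N := N) S k * auxSwap S a =
    swapElt (auxRep N m S) a k * auxSwap S k := by
  classical
  ext i j f g
  rw [swapElt, auxRep_apply, Matrix.scalar_apply, Matrix.diagonal_mul, Matrix.mul_apply,
    tensorRep_of_mul_apply, auxSwap_apply, Matrix.sum_apply]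
  simp only [auxSwap_apply, inFactor_mul_inFactor_apply hak.symm]
  rw [inFactor_apply]
  simp only [Matrix.single_apply, Function.comp_apply, Equiv.swap_apply_right, mul_ite, mul_one,
    mul_zero]
  rw [Finset.sum_eq_single (f k)]
  · have h1 : (∀ b, b ≠ k → f (Equiv.swap a k b) = g b) ↔
        (∀ b, b ≠ k → b ≠ a → f b = g b) ∧ f k = g a := by
      constructor
      · refine fun h => ⟨fun b hb hb' => ?_, ?_⟩
        · have := h b hb
          rwa [Equiv.swap_apply_of_ne_of_ne hb' hb] at this
        · have := h a hak
          rwa [Equiv.swap_apply_left] at this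
      · rintro ⟨h, h'⟩ b hb
        by_cases hba : b = a
        · rw [hba, Equiv.swap_apply_left, h']
        · rw [Equiv.swap_apply_of_ne_of_ne hba hb, h b hb hba]
    simp only [h1]
    split_ifs <;> first | rfl | (exfalso; tauto)
  · intro b _ hb
    split_ifs <;> first | rfl | (exfalso; tauto)
  · simp

/-- The one-factor exchange relation, in terms of matrices. -/
theorem aux_exchange {S : Type*} [Ring S] [Algebra K S] (a : Fin m)
    {t F : Fin N → Fin N → S} {y y' : K}
    (h : ∀ i j k l, t i j * F k l = F k l * t i j + y • (F i l * t k j) - y' • (F k j * t i l) -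
      (y * y') • (F i j * t k l)) :
    (Matrix.of fun i j => Matrix.scalar (Fin m → Fin N) (t i j)) *
        Matrix.scalar (Fin N) (inFactor a (Matrix.of F)) =
      (1 + y • auxSwap S a) * Matrix.scalar (Fin N) (inFactor a (Matrix.of F)) *
        (Matrix.of fun i j => Matrix.scalar (Fin m → Fin N) (t i j)) * (1 - y' • auxSwap S a) := by
  classical
  have h1 : (Matrix.of fun i j => Matrix.scalar (Fin m → Fin N) (t i j)) *
      Matrix.scalar (Fin N) (inFactor a (Matrix.of F)) =
        auxMatrix a fun i j k l => t i j * F k l := by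
    ext i j f g
    rw [Matrix.scalar_apply, Matrix.mul_diagonal, Matrix.of_apply, Matrix.scalar_apply,
      Matrix.diagonal_mul, auxMatrix, Matrix.of_apply, inFactor_apply, inFactor_apply, mul_ite,
      mul_zero]
    rfl
  have h2 : Matrix.scalar (Fin N) (inFactor a (Matrix.of F)) *
      (Matrix.of fun i j => Matrix.scalar (Fin m → Fin N) (t i j)) =
        auxMatrix a fun i j k l => F k l * t i j := by
    ext i j f g
    rw [Matrix.scalar_apply, Matrix.diagonal_mul, Matrix.of_apply, Matrix.scalar_apply,
      Matrix.mul_diagonal, auxMatrix, Matrix.of_apply, inFactor_apply, inFactor_apply, ite_mul,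
      zero_mul]
    rfl
  rw [mul_assoc (1 + _), h1, h2, add_mul, one_mul, smul_mul_assoc, auxSwap_mul_auxMatrix, mul_sub,
    mul_one, mul_smul_comm, add_mul, smul_mul_assoc, auxMatrix_mul_auxSwap, auxMatrix_mul_auxSwap]
  ext i j f g
  simp only [Matrix.sub_apply, Matrix.add_apply, Matrix.smul_apply, auxMatrix, Matrix.of_apply,
    inFactor_apply]
  split_ifs
  · rw [h, smul_add, smul_smul, mul_comm y']
    abel
  · simp

end Auxiliary

/-! ### Invariance of the traces -/

section Crossing

variable {K S : Type*} [CommRing K] [Ring S] [Algebra K S] {N m : ℕ}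

theorem commute_entry_fwdProd {p R : Type*} [Fintype p] [DecidableEq p] [Ring R] {x : R}
    {f : ℕ → Matrix p p R} {n : ℕ} (h : ∀ a < n, ∀ i j, Commute x (f a i j)) (i j : p) :
    Commute x (fwdProd f n i j) := by
  induction n generalizing i j with
  | zero =>
    rw [fwdProd, Matrix.one_apply]
    split_ifs
    · exact Commute.one_right x
    · exact Commute.zero_right x
  | succ n ih =>
    rw [fwdProd, Matrix.mul_apply]
    exact Commute.sum_right _ _ _ fun k _ =>
      (ih (fun a ha => h a (by omega)) i k).mul_right (h n (by omega) k j)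

theorem commute_entry_bwdProd {p R : Type*} [Fintype p] [DecidableEq p] [Ring R] {x : R}
    {f : ℕ → Matrix p p R} {n : ℕ} (h : ∀ a < n, ∀ i j, Commute x (f a i j)) (i j : p) :
    Commute x (bwdProd f n i j) := by
  induction n generalizing i j with
  | zero =>
    rw [bwdProd, Matrix.one_apply]
    split_ifs
    · exact Commute.one_right x
    · exact Commute.zero_right x
  | succ n ih =>
    rw [bwdProd, Matrix.mul_apply]
    exact Commute.sum_right _ _ _ fun k _ =>
      (h n (by omega) i k).mul_right (ih (fun a ha => h a (by omega)) k j)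

theorem hasCentralEntries_bwdProd {p n : Type*} [Fintype p] [DecidableEq p] [Fintype n]
    [DecidableEq n] {f : ℕ → Matrix p p (Matrix n n S)} {k : ℕ}
    (h : ∀ a < k, ∀ i j, HasCentralEntries (f a i j)) (i j : p) :
    HasCentralEntries (bwdProd f k i j) := by
  induction k generalizing i j with
  | zero =>
    rw [bwdProd, Matrix.one_apply]
    split_ifs
    · exact .one
    · exact .zero
  | succ k ih =>
    rw [bwdProd, Matrix.mul_apply]
    exact .sum _ fun e _ => (h k (by omega) i e).mul (ih (fun a ha => h a (by omega)) e j)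

theorem one_apply_commute {p R : Type*} [DecidableEq p] [Ring R] (x : R) (i j : p) :
    Commute x ((1 : Matrix p p R) i j) := by
  rw [Matrix.one_apply]
  split_ifs
  · exact Commute.one_right x
  · exact Commute.zero_right x

theorem commute_auxSwap_entry {a b : Fin m} (hab : a ≠ b) {M : Matrix (Fin N) (Fin N) S}
    (i j : Fin N) : Commute (inFactor a M) (auxSwap S b i j) :=
  commute_inFactor hab fun _ _ _ _ => (hasCentralEntries_single j i _ _ _).symm

theorem commute_auxSwap_entry' {a b : Fin m} (hab : a ≠ b) (z : K)
    {M : Matrix (Fin N) (Fin N) S} (i j : Fin N) :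
    Commute (inFactor a M) ((1 + z • auxSwap S b : Matrix (Fin N) (Fin N) _) i j) :=
  (one_apply_commute _ i j).add_right ((commute_auxSwap_entry hab i j).smul_right z)

theorem commute_scalar_auxSwap {a b : Fin m} (hab : a ≠ b) (M : Matrix (Fin N) (Fin N) S) :
    Commute (Matrix.scalar (Fin N) (inFactor a M)) (auxSwap S b) := by
  ext1 i j
  rw [Matrix.scalar_apply, Matrix.diagonal_mul, Matrix.mul_diagonal]
  exact (commute_auxSwap_entry hab i j).eq

/-- The crossing relation for one factor. -/
theorem crossing_one (a : Fin m) {y y' : K} (h : y - y' = N * (y * y')) (i j : Fin N) :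
    ∑ k, (1 - y' • auxSwap S a : Matrix (Fin N) (Fin N) _) k j *
        (1 + y • auxSwap S a : Matrix (Fin N) (Fin N) _) i k =
      if i = j then 1 else 0 := by
  have hE : ∑ k, inFactor a (Matrix.single j k (1 : S)) * inFactor a (Matrix.single k i 1) =
      (N : K) • inFactor a (Matrix.single j i 1) := by
    simp only [inFactor_mul_inFactor_same, Matrix.single_mul_single_same, mul_one,
      Finset.sum_const, Finset.card_univ, Fintype.card_fin]
    rw [Nat.cast_smul_eq_nsmul]
  simp only [Matrix.sub_apply, Matrix.add_apply, Matrix.smul_apply, auxSwap_apply, sub_mul,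
    mul_add, Finset.sum_sub_distrib, Finset.sum_add_distrib, Matrix.one_apply, ite_mul, mul_ite,
    one_mul, mul_one, zero_mul, mul_zero, Finset.sum_ite_eq, Finset.sum_ite_eq',
    Finset.mem_univ, if_true, smul_mul_smul_comm, ← Finset.smul_sum, hE]
  have h0 : y • inFactor a (Matrix.single j i (1 : S)) -
        y' • inFactor a (Matrix.single j i (1 : S)) =
      (y' * y) • (N : K) • inFactor a (Matrix.single j i (1 : S)) := by
    rw [← sub_smul, h, smul_smul]
    congr 1
    ring
  rw [← h0]
  abel

/-- The ordered products of the `R`-matrices attaching the auxiliary factor to the left and to the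
right are inverse to each other after the partial transposition in the auxiliary factor. The
hypothesis holds for `y a = (v_a - N/2)⁻¹` and `y' a = (v_a + N/2)⁻¹`, the poles at the critical
level. -/
theorem crossing {y y' : Fin m → K} (h : ∀ a, y a - y' a = N * (y a * y' a)) {n : ℕ} (hn : n ≤ m)
    (i j : Fin N) :
    ∑ k, bwdProd (extendOne fun a => 1 - y' a • auxSwap S a) n k j *
        fwdProd (extendOne fun a => 1 + y a • auxSwap S a) n i k = if i = j then 1 else 0 := by
  induction n with
  | zero => simp [bwdProd, fwdProd, Matrix.one_apply]
  | succ n ih =>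
    have hnm : n < m := hn
    set k₀ : Fin m := ⟨n, hnm⟩ with hk₀
    set A := fwdProd (extendOne fun a => 1 + y a • auxSwap S a) n with hA
    set B := bwdProd (extendOne fun a => 1 - y' a • auxSwap S a) n with hB
    rw [fwdProd, bwdProd, extendOne_of_lt _ hnm, extendOne_of_lt _ hnm, ← hk₀, ← hA, ← hB]
    have hne : ∀ a (ha : a < n), k₀ ≠ ⟨a, ha.trans hnm⟩ := fun a ha h' => by
      simp [hk₀] at h'; omega
    have hcA : ∀ (M : Matrix (Fin N) (Fin N) S) i j, Commute (inFactor k₀ M) (A i j) :=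
      fun M => commute_entry_fwdProd fun a ha i j => by
        rw [extendOne_of_lt _ (ha.trans hnm)]
        exact commute_auxSwap_entry' (hne a ha) _ i j
    have hcB : ∀ (M : Matrix (Fin N) (Fin N) S) i j, Commute (inFactor k₀ M) (B i j) :=
      fun M => commute_entry_bwdProd fun a ha i j => by
        rw [extendOne_of_lt _ (ha.trans hnm), sub_eq_add_neg, ← neg_smul]
        exact commute_auxSwap_entry' (hne a ha) _ i j
    have hc : ∀ p k r s i j, Commute ((1 + y k₀ • auxSwap S k₀ : Matrix (Fin N) (Fin N) _) p k)
        (B r s * A i j) := fun p k r s i j => by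
      change Commute ((1 : Matrix (Fin N) (Fin N) _) p k + y k₀ • auxSwap S k₀ p k) _
      refine Commute.add_left (one_apply_commute _ _ _).symm (Commute.smul_left ?_ _)
      exact (hcB _ r s).mul_right (hcA _ i j)
    calc _ = ∑ q, ∑ p, (∑ k, (1 - y' k₀ • auxSwap S k₀ : Matrix (Fin N) (Fin N) _) k q *
          (1 + y k₀ • auxSwap S k₀ : Matrix (Fin N) (Fin N) _) p k) * (B q j * A i p) := by
          simp only [Matrix.mul_apply, Finset.sum_mul, Finset.mul_sum]
          refine Finset.sum_comm.trans (Eq.trans ?_ Finset.sum_comm)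
          refine Finset.sum_congr rfl fun p _ => Finset.sum_comm.trans ?_
          refine Finset.sum_congr rfl fun q _ => Finset.sum_congr rfl fun k _ => ?_
          rw [mul_assoc, ← mul_assoc (B q j), ← (hc p k q j i p).eq, ← mul_assoc]
      _ = ∑ q, ∑ p, (if p = q then 1 else 0) * (B q j * A i p) := by
          simp only [crossing_one k₀ (h k₀)]
      _ = _ := by
          rw [← ih hnm.le]
          simp

/-- The trace of an ordered product of matrices over a weight space of the symmetric group is
invariant under `t`, if `t` can be moved past each factor by `R`-matrices whose poles `y a` and
`y' a` are shifted by the contents, and if the crossing relation holds. -/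
theorem mul_trace_weightIdem_sub_mem [Algebra ℂ S] {J : Ideal S} {t : Fin N → Fin N → S}
    (ht : ∀ i j, t i j - (if i = j then 1 else 0) ∈ J) {c : Fin m → ℤ}
    {F : Fin m → Matrix (Fin N) (Fin N) S} {y y' : Fin m → K} {ξ ξ' : K}
    (hF : ∀ a i j k l, t i j * F a k l = F a k l * t i j + y a • (F a i l * t k j) -
      y' a • (F a k j * t i l) - (y a * y' a) • (F a i j * t k l))
    (hyy' : ∀ a, y a - y' a = N * (y a * y' a)) (hy : ∀ a, y a * (1 - c a * ξ) = ξ)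
    (hy' : ∀ a, y' a * (1 - c a * ξ') = ξ')
    (hreg : ∀ x z : Matrix (Fin N) (Fin N) (Matrix (Fin m → Fin N) (Fin m → Fin N) S),
      z = ξ • (x * z) → z = 0)
    (hPX : tensorRep N m S (weightIdem c) * fwdProd (extendOne fun a => inFactor a (F a)) m *
        tensorRep N m S (weightIdem c) =
      tensorRep N m S (weightIdem c) * fwdProd (extendOne fun a => inFactor a (F a)) m)
    (i j : Fin N) :
    t i j * Matrix.trace (tensorRep N m S (weightIdem c) *
        fwdProd (extendOne fun a => inFactor a (F a)) m) -
      (if i = j then Matrix.trace (tensorRep N m S (weightIdem c) *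
        fwdProd (extendOne fun a => inFactor a (F a)) m) else 0) ∈ J := by
  have hswap := swapElt_mul_auxSwap (N := N) (m := m) (S := S)
  have hmul : ∀ a k : Fin m, a < k → auxSwap (N := N) S k * auxSwap S a =
      swapElt (auxRep N m S) a k * auxSwap S k := fun a k hak => auxSwap_mul_auxSwap hak.ne
  have hPP : tensorRep N m S (weightIdem c) * tensorRep N m S (weightIdem c) =
      tensorRep N m S (weightIdem c) := by rw [← map_mul, weightIdem_mul_self]
  have hPA := weightIdem_mul_fwdProd_mul_weightIdem (K := K) (c := c) hswap hmul
    auxSwap_mul_self hy hreg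
  have hPB := weightIdem_mul_bwdProd_mul_weightIdem (K := K) (c := c) hswap hmul hy'
  have hAB := crossing (S := S) hyy' le_rfl
  have hB : ∀ i j, HasCentralEntries (bwdProd (extendOne fun a : Fin m =>
      1 - y' a • auxSwap (N := N) S a) m i j) := by
    refine hasCentralEntries_bwdProd fun a ha i j => ?_
    rw [extendOne_of_lt _ ha]
    refine HasCentralEntries.sub ?_ ((hasCentralEntries_single j i).inFactor.smul _)
    rw [Matrix.one_apply]
    split_ifs
    · exact .one
    · exact .zero
  refine mul_trace_sub_mem ht (hasCentralEntries_tensorRep (weightIdem c)) hB ?_ hPP hPX hPA hPB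
    hAB i j
  have hne : ∀ {a b : ℕ} {ha : a < m} {hb : b < m}, a ≠ b → (⟨a, ha⟩ : Fin m) ≠ ⟨b, hb⟩ :=
    fun hab h => hab (Fin.mk.inj h)
  rw [map_fwdProd]
  refine mul_fwdProd_of_exchange (fun a ha => ?_) (fun a ha b hb hab => ?_)
    fun a ha b hb hab => ?_
  · rw [extendOne_of_lt _ ha, extendOne_of_lt _ ha, extendOne_of_lt _ ha]
    exact aux_exchange ⟨a, ha⟩ (hF _)
  · rw [extendOne_of_lt _ ha, extendOne_of_lt _ hb]
    exact (Commute.one_right _).add_right ((commute_scalar_auxSwap (hne hab) _).smul_right _)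
  · rw [extendOne_of_lt _ ha, extendOne_of_lt _ hb]
    exact (Commute.one_right _).sub_right ((commute_scalar_auxSwap (hne hab) _).smul_right _)

end Crossing

section Poles

variable {N : ℕ}

theorem leftPole_sub_rightPole (c : ℂ) :
    leftPole N c - rightPole N c = N * (leftPole N c * rightPole N c) := by
  rw [leftPole, rightPole, invSub_sub_invSub, add_sub_add_left_eq_sub, ← map_sub]
  congr 1
  have h : c + N / 2 - (c - N / 2) = (N : ℂ) := by ring
  rw [h, map_natCast, map_natCast]

theorem leftPole_mul_one_sub (c : ℤ) :
    leftPole N c * (1 - c * leftPole N 0) = leftPole N 0 := by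
  have h := invSub_sub_invSub (PowerSeries.X + PowerSeries.C ((c : ℂ) + N / 2))
    (PowerSeries.X + PowerSeries.C ((0 : ℂ) + N / 2))
  rw [add_sub_add_left_eq_sub, ← map_sub, add_sub_add_right_eq_sub, sub_zero, map_intCast,
    map_intCast] at h
  rw [leftPole, leftPole]
  linear_combination h

theorem rightPole_mul_one_sub (c : ℤ) :
    rightPole N c * (1 - c * rightPole N 0) = rightPole N 0 := by
  have h := invSub_sub_invSub (PowerSeries.X + PowerSeries.C ((c : ℂ) - N / 2))
    (PowerSeries.X + PowerSeries.C ((0 : ℂ) - N / 2))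
  rw [add_sub_add_left_eq_sub, ← map_sub, sub_sub_sub_cancel_right, sub_zero, map_intCast,
    map_intCast] at h
  rw [rightPole, rightPole]
  linear_combination h

end Poles

section Final

attribute [local instance] seriesAlgebra

/-- In two variables, an equation `z = ξ x z` with `ξ` divisible by the outer variable has only the
zero solution. -/
theorem eq_zero_of_eq_smul_mul {S : Type*} [Ring S] [Algebra ℂ S] {p n : Type*} [Fintype p]
    [DecidableEq p] [Fintype n] [DecidableEq n] {ξ : ℂ⟦X⟧⟦X⟧} (hξ : PowerSeries.coeff 0 ξ = 0)
    (x z : Matrix p p (Matrix n n S⟦X⟧⟦X⟧)) (h : z = ξ • (x * z)) : z = 0 := by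
  have key : ∀ k i j f g, PowerSeries.coeff k (z i j f g) = 0 := by
    intro k
    induction k using Nat.strong_induction_on with
    | _ k ih =>
      intro i j f g
      rw [h]
      change PowerSeries.coeff k (ξ • ((x * z) i j f g)) = 0
      rw [coeff_series_smul]
      refine Finset.sum_eq_zero fun e he => ?_
      rw [Finset.HasAntidiagonal.mem_antidiagonal] at he
      rcases Nat.eq_zero_or_pos e.1 with h0 | h0
      · rw [h0, hξ, zero_smul]
      · rw [Matrix.mul_apply, Matrix.sum_apply, map_sum, Finset.sum_eq_zero, smul_zero]
        intro l _
        rw [Matrix.mul_apply, map_sum]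
        refine Finset.sum_eq_zero fun d _ => ?_
        rw [PowerSeries.coeff_mul]
        refine Finset.sum_eq_zero fun e' he' => ?_
        rw [Finset.HasAntidiagonal.mem_antidiagonal] at he'
        rw [ih e'.2 (by omega), mul_zero]
  ext1 i j
  ext1 f g
  ext1 k
  rw [key, Matrix.zero_apply, Matrix.zero_apply, map_zero]

variable {N : ℕ} [NeZero N]

/-- The left ideal of the series all of whose coefficients annihilate the vacuum vector. -/
def vacuumAnnihilator (N : ℕ) [NeZero N] : Ideal (VacuumEnd N)⟦X⟧⟦X⟧ where
  carrier := {b | ∀ r k, PowerSeries.coeff k (PowerSeries.coeff r b) (vacuum N (-(N : ℂ))) = 0}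
  zero_mem' r k := by simp
  add_mem' ha hb r k := by
    rw [map_add, map_add, LinearMap.add_apply, ha, hb, add_zero]
  smul_mem' a b hb r k := by
    rw [smul_eq_mul, PowerSeries.coeff_mul, map_sum, LinearMap.sum_apply]
    refine Finset.sum_eq_zero fun p _ => ?_
    rw [PowerSeries.coeff_mul, LinearMap.sum_apply]
    refine Finset.sum_eq_zero fun p' _ => ?_
    rw [Module.End.mul_apply, hb, map_zero]

theorem extT_smul_vacuum (i j : Fin N) (r : ℕ) : extT i j r • vacuum N (-(N : ℂ)) =
    if r = 0 ∧ i = j then vacuum N (-(N : ℂ)) else 0 := by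
  cases r with
  | zero =>
    have h : (extT i j 0 : extendedDY N) = if i = j then 1 else 0 := by
      apply Subtype.ext
      simp only [extT, DY.tPos, Free.tPos]
      split_ifs <;> simp
    rw [h]
    split_ifs <;> simp_all
  | succ r =>
    rw [if_neg (by simp)]
    change Submodule.Quotient.mk (extT i j (r + 1) * 1) = 0
    rw [mul_one, Submodule.Quotient.mk_eq_zero]
    exact Submodule.subset_span (Or.inr ⟨i, j, r + 1, by omega, rfl⟩)

theorem posSeries_sub_mem (i j : Fin N) :
    posSeries i j - (if i = j then 1 else 0) ∈ vacuumAnnihilator N := by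
  intro r k
  rw [posSeries, map_sub, PowerSeries.coeff_mk, map_sub, PowerSeries.coeff_C, LinearMap.sub_apply]
  have h := extT_smul_vacuum i j r
  split_ifs at h ⊢ with h1 h2 h3 <;>
    simp_all [PowerSeries.coeff_one, vacuumAction_apply]


variable {m : ℕ}

theorem C_mapMatrix_tensorRep (x : MonoidAlgebra ℂ (Equiv.Perm (Fin m))) :
    (PowerSeries.C (R := (VacuumEnd N)⟦X⟧)).mapMatrix (tensorRep N m (VacuumEnd N)⟦X⟧ x) =
      tensorRep N m (VacuumEnd N)⟦X⟧⟦X⟧ x :=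
  tensorRep_map _ (fun z => C_algebraMap z) _

theorem C_mapMatrix_fwdProd (c : Fin m → ℤ) :
    (PowerSeries.C (R := (VacuumEnd N)⟦X⟧)).mapMatrix
        (fwdProd (extendOne fun a => inFactor a (plusSeries (N := N) (c a : ℂ))) m) =
      fwdProd (extendOne fun a => inFactor a ((plusSeries (N := N) (c a : ℂ)).map
        (PowerSeries.C (R := (VacuumEnd N)⟦X⟧)))) m := by
  rw [map_fwdProd]
  refine fwdProd_congr fun b hb => ?_
  rw [extendOne_of_lt _ hb, extendOne_of_lt _ hb, inFactor_map]

theorem C_trace_plusSeries (c : Fin m → ℤ) :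
    PowerSeries.C (Matrix.trace (tensorRep N m (VacuumEnd N)⟦X⟧ (weightIdem c) *
      fwdProd (extendOne fun a => inFactor a (plusSeries (c a : ℂ))) m)) =
    Matrix.trace (tensorRep N m (VacuumEnd N)⟦X⟧⟦X⟧ (weightIdem c) *
      fwdProd (extendOne fun a => inFactor a ((plusSeries (N := N) (c a : ℂ)).map
        (PowerSeries.C (R := (VacuumEnd N)⟦X⟧)))) m) := by
  rw [← C_mapMatrix_tensorRep, ← C_mapMatrix_fwdProd, ← map_mul]
  exact AddMonoidHom.map_trace (PowerSeries.C (R := (VacuumEnd N)⟦X⟧)) _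

/-- The product of the matrices `T⁺(u + c_a)` preserves the weight space with weight `c`. -/
theorem weightIdem_plusSeries (c : Fin m → ℤ) :
    tensorRep N m (VacuumEnd N)⟦X⟧⟦X⟧ (weightIdem c) *
        fwdProd (extendOne fun a => inFactor a ((plusSeries (N := N) (c a : ℂ)).map
          (PowerSeries.C (R := (VacuumEnd N)⟦X⟧)))) m *
        tensorRep N m (VacuumEnd N)⟦X⟧⟦X⟧ (weightIdem c) =
      tensorRep N m (VacuumEnd N)⟦X⟧⟦X⟧ (weightIdem c) *
        fwdProd (extendOne fun a => inFactor a ((plusSeries (N := N) (c a : ℂ)).map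
          (PowerSeries.C (R := (VacuumEnd N)⟦X⟧)))) m := by
  have h := (isWeight_mul_fwdProd (S := VacuumEnd N)
    (Y := fun a : Fin m => plusSeries (N := N) (c a : ℂ))
    (fun a k _ i j r l => plusSeries_relation c a k i j r l)
    (isWeight_weightIdem m) le_rfl).mul_weightIdem
  rw [← C_mapMatrix_tensorRep, ← C_mapMatrix_fwdProd, ← map_mul, ← map_mul, h]

/-- The coefficients of the trace of an ordered product of the matrices `T⁺(u + c_a)`, restricted
to a weight space of the symmetric group, are invariant. -/
theorem posSeries_mul_trace_sub_mem (c : Fin m → ℤ) (i j : Fin N) :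
    let f := Matrix.trace (tensorRep N m (VacuumEnd N)⟦X⟧ (weightIdem c) *
      fwdProd (extendOne fun a => inFactor a (plusSeries (c a : ℂ))) m)
    posSeries i j * PowerSeries.C f - (if i = j then PowerSeries.C f else 0) ∈
      vacuumAnnihilator N := by
  intro f
  have key := mul_trace_weightIdem_sub_mem (K := ℂ⟦X⟧⟦X⟧) (S := (VacuumEnd N)⟦X⟧⟦X⟧) (m := m)
    (t := posSeries) (c := c) (F := fun a => (plusSeries (N := N) (c a : ℂ)).map
      (PowerSeries.C (R := (VacuumEnd N)⟦X⟧))) (y := fun a => leftPole N (c a))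
    (y' := fun a => rightPole N (c a)) (ξ := leftPole N 0) (ξ' := rightPole N 0)
    posSeries_sub_mem (fun a i j k l => vacuum_mixed_relation (c a : ℂ) i j k l)
    (fun a => leftPole_sub_rightPole (N := N) (c a))
    (fun a => leftPole_mul_one_sub (N := N) (c a))
    (fun a => rightPole_mul_one_sub (N := N) (c a))
    (eq_zero_of_eq_smul_mul (coeff_zero_leftPole N 0)) (weightIdem_plusSeries c) i j
  rw [← C_trace_plusSeries] at key
  exact key

end Final

/-! ### The series `𝕋⁺_μ(u)` on the vacuum vector -/

section Immanants

variable {N : ℕ} [NeZero N]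

theorem tensorRep_smul {S : Type*} [Ring S] [Algebra ℂ S] {N m : ℕ} (κ : ℂ)
    (x : MonoidAlgebra ℂ (Equiv.Perm (Fin m))) :
    tensorRep N m S (κ • x) = κ • tensorRep N m S x := by
  rw [tensorRep_eq, tensorRep_eq, groupAlgebraTensor, groupAlgebraTensor]
  ext f g
  simp [Matrix.sum_apply, Finset.mul_sum, mul_assoc, -Algebra.smul_mul_assoc,
    Algebra.smul_def (R := ℂ) (A := S)]

/-- The operator `𝕋⁺_μ(u)` on the vacuum module is a multiple of the trace of the
ordered product of the matrices `T⁺(u + c_a)` over the weight space of the contents. -/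
theorem exists_seriesMap_immanantSeries {μ : YoungDiagram} {m : ℕ} (U : StandardTableau μ m) :
    ∃ κ : ℂ, seriesMap ((vacuumAction N).comp dualToExtended) (immanantSeries N U) =
      κ • Matrix.trace (tensorRep N m (VacuumEnd N)⟦X⟧ (weightIdem U.content) *
        fwdProd (extendOne fun a => inFactor a (plusSeries (U.content a : ℂ))) m) := by
  obtain ⟨κ, hκ⟩ := StandardTableau.exists_youngIdempotent_eq_smul U U.idem_ne_zero
  refine ⟨κ, ?_⟩
  set φ := seriesMap ((vacuumAction N).comp dualToExtended) with hφ
  have h1 : φ (immanantSeries N U) = Matrix.trace ((φ : _ →+* _).mapMatrix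
      (tensorRep N m (dualYangianHat N)⟦X⟧ (youngIdempotent U) *
        fwdProd (extendOne fun a => inFactor a (dualSeries (N := N) (U.content a : ℂ))) m)) := by
    rw [immanantSeries, ← tensorRep_eq, prod_ofFn_eq_fwdProd _ _ (extendOne_coe _)]
    exact AddMonoidHom.map_trace φ _
  rw [h1, map_mul,
    tensorRep_map (φ : (dualYangianHat N)⟦X⟧ →+* (VacuumEnd N)⟦X⟧) fun z => φ.commutes z, map_fwdProd, hκ]
  have h2 : tensorRep N m (VacuumEnd N)⟦X⟧ (κ • U.idem) =
      κ • tensorRep N m (VacuumEnd N)⟦X⟧ (weightIdem U.content) := by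
    exact tensorRep_smul κ (weightIdem U.content)
  rw [h2, smul_mul_assoc, Matrix.trace_smul]
  congr 3
  refine fwdProd_congr fun a ha => ?_
  rw [extendOne_of_lt _ ha, extendOne_of_lt _ ha, inFactor_map]
  rfl

theorem immanantSeries_smul_vacuum_mem {μ : YoungDiagram} {m : ℕ} (U : StandardTableau μ m)
    (k : ℕ) : dualToExtended (PowerSeries.coeff k (immanantSeries N U)) • vacuum N (-(N : ℂ)) ∈
      invariants N (-(N : ℂ)) := by
  obtain ⟨κ, hκ⟩ := exists_seriesMap_immanantSeries (N := N) U
  set f := Matrix.trace (tensorRep N m (VacuumEnd N)⟦X⟧ (weightIdem U.content) *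
        fwdProd (extendOne fun a => inFactor a (plusSeries (N := N) (U.content a : ℂ))) m) with hf
  have h1 : dualToExtended (PowerSeries.coeff k (immanantSeries N U)) • vacuum N (-(N : ℂ)) =
      κ • PowerSeries.coeff k f (vacuum N (-(N : ℂ))) := by
    have h := congrArg (PowerSeries.coeff k) hκ
    rw [coeff_seriesMap, PowerSeries.coeff_smul] at h
    exact congrArg (fun b : VacuumEnd N => b (vacuum N (-(N : ℂ)))) h
  rw [h1]
  refine Submodule.smul_mem _ _ fun i j r => ?_
  have h2 := posSeries_mul_trace_sub_mem (N := N) U.content i j r k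
  rw [posSeries, map_sub, PowerSeries.coeff_mul_C, PowerSeries.coeff_mk, map_sub,
    PowerSeries.coeff_C_mul, LinearMap.sub_apply, Module.End.mul_apply, vacuumAction_apply,
    sub_eq_zero] at h2
  rw [h2]
  by_cases hij : i = j
  · rw [if_pos hij, PowerSeries.coeff_C]
    split_ifs <;> simp_all
  · rw [if_neg hij, if_neg fun h => hij h.2]
    simp

end Immanants

end

end DoubleYangianGL

theorem theorem2p4 (N : ℕ) [NeZero N] (μ : YoungDiagram) (hμ : μ.rowLens.length ≤ N)
    (U : DoubleYangianGL.StandardTableau μ μ.card) (k : ℕ) :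
    DoubleYangianGL.dualToExtended
        (PowerSeries.coeff k (DoubleYangianGL.immanantSeries N U)) •
      DoubleYangianGL.vacuum N (-(N : ℂ)) ∈ DoubleYangianGL.invariants N (-(N : ℂ)) :=
  DoubleYangianGL.immanantSeries_smul_vacuum_mem U k
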